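/- **Setting.** Let $\mathbb T=\mathbb R/2\pi\mathbb Z$, let $\kappa\ge 0$, let $g$ be a probability density on $\mathbb R$ (natural frequencies $\nu$) and $\rho$ a probability density on $[1,\infty)$ (random parameter $z$). Put $$I(\theta,z)=a(z)(1+\cos\theta)^z,\qquad a(z)=\frac{2^z\Gamma(z+1)^2}{\Gamma(2z+1)},$$ and consider the random kinetic Winfree equation on $\mathbb R_+\times\mathbb T\times\mathbb R\times[1,\infty)$ $$\partial_t f+\partial_\theta(fL[f])=0,\quad f|_{t=0}=f^{\rm in},\qquad L[f]=\nu-\sigma(t,z)\sin\theta,\quad \sigma(t,z)=\kappa\int_{\mathbb T\times\mathbb R} I(\theta_*,z)f(t,\theta_*,\nu_*,z)g(\nu_*)\,d\theta_*d\nu_*,$$ where the initial datum $f^{\rm in}=f^{\rm in}(\theta,\nu)\ge 0$ does not depend on $z$ and $\int f^{\rm in}g\,d\theta d\nu=1$. A global solution is a measurable $f=f(t,\theta,\nu,z)$ such that, for a.e. $z\ge1$ and $g\,d\nu$-a.e. $\nu$, one has for every $t\ge 0$ that $f(t,\cdot,\nu,z)$ is nonnegative and integrable on $\mathbb T$ and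 $$\int_{\mathbb T} f(t)\psi\,d\theta=\int_{\mathbb T} f^{\rm in}\psi\,d\theta+\int_0^t\!\int_{\mathbb T} f(s)L[f](s)\,\psi'\,d\theta ds\qquad\text{for all }\psi\in C^1(\mathbb T).$$ The norms of $L^p_{\theta,\nu,z}$ and $L^\infty_{\theta,z}$ are taken with respect to the measures $\rho(z)g(\nu)\,d\theta d\nu dz$ and $\rho(z)\,d\theta dz$. Moreover, with weak $z$-derivatives on $(1,\infty)$, $\|h\|_{W^{k,p}_{\theta,\nu,z}}=\big(\sum_{l=0}^k\|\partial_z^lh\|_{L^p_{\theta,\nu,z}}^p\big)^{1/p}$ (the maximum over $l$ if $p=\infty$). **Theorem.** Let $k\ge1$, $1<p\le\infty$, $0<T<\infty$. Assume that $$C:=\max_{0\le l\le k}\|\partial_z^lI\|_{L^\infty_{\theta,z}}<\infty,\qquad \partial_\theta^jf^{\rm in}\in L^\infty_{\theta,\nu,z}\quad(0\le j\le k),$$ where $\partial_\theta^j$ is the weak derivative on $\mathbb T$, and let $f$ be a global solution. Then, for every $t\in[0,T]$, $f(t)$ has weak $z$-derivatives up to order $k$, and $$\|f(t)\|_{W^{k,p}_{\theta,\nu,z}}\le\|f^{\rm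 in}\|_{L^p_{\theta,\nu,z}}\,e^{\Lambda_{1}t}+\frac{\Lambda_{2}}{\Lambda_{1}}\big(e^{\Lambda_{1}t}-1\big),$$ with constants $\Lambda_{1}>0$ and $\Lambda_{2}\ge0$ that depend only on $k$, $T$, $C$, $\kappa$ and, for $f^{\rm in}$, on an upper bound of $\max_{0\le j\le k}\|\partial_\theta^jf^{\rm in}\|_{L^\infty_{\theta,\nu,z}}$; in particular not on $p$. -/

import Mathlib

open MeasureTheory Set
open scoped ContDiff ENNReal

noncomputable section

namespace Winfree

/-! ### Measures and densities -/

/-- Lebesgue measure on one period; it represents the torus `ℝ / 2πℤ`. -/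
def torus : Measure ℝ := volume.restrict (Ioc 0 (2 * Real.pi))

/-- Lebesgue measure on the range `[1, ∞)` of the random parameter `z`. -/
def zLebesgue : Measure ℝ := volume.restrict (Ici 1)

/-- `h` is a probability density with respect to `μ`. -/
structure IsProbDensity (μ : Measure ℝ) (h : ℝ → ℝ) : Prop where
  measurable : Measurable h
  nonneg : ∀ x, 0 ≤ h x
  mass : ∫⁻ x, ENNReal.ofReal (h x) ∂μ = 1

/-- The law `g(ν) dν` of the natural frequency. -/
def freqLaw (g : ℝ → ℝ) : Measure ℝ := volume.withDensity fun ν => ENNReal.ofReal (g ν)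

/-- The law `ρ(z) dz` on `[1, ∞)` of the random parameter. -/
def randLaw (ρ : ℝ → ℝ) : Measure ℝ := zLebesgue.withDensity fun z => ENNReal.ofReal (ρ z)

/-! ### The influence function -/

/-- The normalizing factor `a(z) = 2^z Γ(z+1)² / Γ(2z+1)`. -/
def normFactor (z : ℝ) : ℝ := (2 : ℝ) ^ z * Real.Gamma (z + 1) ^ 2 / Real.Gamma (2 * z + 1)

/-- The influence function `I(θ, z) = a(z) (1 + cos θ)^z`. -/
def influence (θ z : ℝ) : ℝ := normFactor z * (1 + Real.cos θ) ^ z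

/-- `‖∂_z^l I‖_{L^∞_{θ,z}}`: the essential supremum for the weighted measure `ρ(z) dθ dz`. -/
def influenceNorm (ρ : ℝ → ℝ) (l : ℕ) : ℝ≥0∞ :=
  eLpNorm (fun x : ℝ × ℝ => iteratedDeriv l (fun z => influence x.1 z) x.2) ⊤
    (torus.prod (randLaw ρ))

/-! ### Weighted norms -/

/-- The weighted norm `‖h‖_{L^p_{θ,ν,z}}`, for the measure `ρ(z) g(ν) dθ dν dz`. -/
def lpNorm (g ρ : ℝ → ℝ) (p : ℝ≥0∞) (h : ℝ → ℝ → ℝ → ℝ) : ℝ≥0∞ :=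
  eLpNorm (fun x : ℝ × ℝ × ℝ => h x.1 x.2.1 x.2.2) p
    (torus.prod ((freqLaw g).prod (randLaw ρ)))

/-- The norm `(∑_{l ≤ k} ‖∂_z^l h‖_{L^p}^p)^{1/p}` (the maximum over `l ≤ k` if `p = ∞`) of a
function `h` whose `z`-derivatives of order `l = 0, …, k` are `D l`. -/
def sobolevNorm (g ρ : ℝ → ℝ) (k : ℕ) (p : ℝ≥0∞) (D : ℕ → ℝ → ℝ → ℝ → ℝ) : ℝ≥0∞ :=
  if p = ⊤ then (Finset.range (k + 1)).sup fun l => lpNorm g ρ ⊤ (D l)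
  else (∑ l ∈ Finset.range (k + 1), lpNorm g ρ p (D l) ^ p.toReal) ^ (1 / p.toReal)

/-! ### Weak derivatives -/

/-- `u(θ, ν)` is the weak derivative `∂_θ^j h` on the torus, for almost every frequency `ν`. -/
structure IsWeakThetaDeriv (g : ℝ → ℝ) (j : ℕ) (h u : ℝ → ℝ → ℝ) : Prop where
  measurable : Measurable fun x : ℝ × ℝ => u x.1 x.2
  weak : ∀ᵐ ν ∂(freqLaw g),
    Integrable (fun θ => h θ ν) torus ∧ Integrable (fun θ => u θ ν) torus ∧
    ∀ ψ : ℝ → ℝ, ContDiff ℝ ∞ ψ → Function.Periodic ψ (2 * Real.pi) →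
      ∫ θ, h θ ν * iteratedDeriv j ψ θ ∂torus = (-1) ^ j * ∫ θ, u θ ν * ψ θ ∂torus

/-- `u(θ, ν, z)` is the weak derivative `∂_z^l h` on `(1, ∞)`, for almost every `(θ, ν)`. -/
structure IsWeakZDeriv (g : ℝ → ℝ) (l : ℕ) (h u : ℝ → ℝ → ℝ → ℝ) : Prop where
  measurable : Measurable fun x : ℝ × ℝ × ℝ => u x.1 x.2.1 x.2.2
  weak : ∀ᵐ x ∂(torus.prod (freqLaw g)),
    LocallyIntegrableOn (h x.1 x.2) (Ioi 1) ∧ LocallyIntegrableOn (u x.1 x.2) (Ioi 1) ∧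
    ∀ φ : ℝ → ℝ, ContDiff ℝ ∞ φ → HasCompactSupport φ → tsupport φ ⊆ Ioi 1 →
      ∫ z in Ioi 1, h x.1 x.2 z * iteratedDeriv l φ z
        = (-1) ^ l * ∫ z in Ioi 1, u x.1 x.2 z * φ z

/-! ### The random kinetic Winfree equation -/

/-- `σ(t, z) = κ ∫ I(θ, z) f(t, θ, ν, z) g(ν) dθ dν`. -/
def meanField (κ : ℝ) (g : ℝ → ℝ) (f : ℝ → ℝ → ℝ → ℝ → ℝ) (t z : ℝ) : ℝ :=
  κ * ∫ x : ℝ × ℝ, influence x.1 z * f t x.1 x.2 z ∂(torus.prod (freqLaw g))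

/-- The velocity `L[f](t, θ, ν, z) = ν - σ(t, z) sin θ`. -/
def velocity (κ : ℝ) (g : ℝ → ℝ) (f : ℝ → ℝ → ℝ → ℝ → ℝ) (t θ ν z : ℝ) : ℝ :=
  ν - meanField κ g f t z * Real.sin θ

/-- Admissible initial data: `f^in(θ, ν) ≥ 0` and `∫ f^in(θ, ν) g(ν) dθ dν = 1`. -/
structure IsInitialDatum (g : ℝ → ℝ) (fin : ℝ → ℝ → ℝ) : Prop where
  measurable : Measurable fun x : ℝ × ℝ => fin x.1 x.2
  nonneg : ∀ᵐ x ∂(torus.prod (freqLaw g)), 0 ≤ fin x.1 x.2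
  mass : ∫ x, fin x.1 x.2 ∂(torus.prod (freqLaw g)) = 1

/-- `f(t, θ, ν, z)` is a global solution, in the sense of distributions on the torus, of
`∂_t f + ∂_θ (f L[f]) = 0` for `t > 0`, with `f = f^in` at `t = 0`: for almost every `z ≥ 1` and
almost every frequency `ν` the density `f(t, ·, ν, z)` is nonnegative, integrable, and satisfies
the equation, integrated in time, against every test function on the torus. -/
structure IsGlobalSolution (κ : ℝ) (g : ℝ → ℝ) (fin : ℝ → ℝ → ℝ)
    (f : ℝ → ℝ → ℝ → ℝ → ℝ) : Prop where
  measurable : Measurable fun x : ℝ × ℝ × ℝ × ℝ => f x.1 x.2.1 x.2.2.1 x.2.2.2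
  weak : ∀ᵐ z ∂zLebesgue, ∀ᵐ ν ∂(freqLaw g), ∀ t : ℝ, 0 ≤ t →
    (∀ᵐ θ ∂torus, 0 ≤ f t θ ν z) ∧ Integrable (fun θ => f t θ ν z) torus ∧
    ∀ ψ : ℝ → ℝ, ContDiff ℝ 1 ψ → Function.Periodic ψ (2 * Real.pi) →
      ∫ θ, f t θ ν z * ψ θ ∂torus
        = (∫ θ, fin θ ν * ψ θ ∂torus)
          + ∫ s in (0 : ℝ)..t, ∫ θ, f s θ ν z * velocity κ g f s θ ν z * deriv ψ θ ∂torus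

end Winfree

end

/-! For fixed $z$ a solution is carried by characteristics:
$f(t,\theta,\nu,z)=F(Y_0,\nu)\exp\big(\int_0^t\sigma(r,z)\cos Y_r\,dr\big)$. Here $Y_r$ solves
$Y'=\nu-\sigma\sin Y$ and passes through $\theta$ at time $t$, and $F$ is the Lipschitz periodic
representative of the initial datum. The parameter enters only through $\sigma$, which is again an
integral of $I f$. Differentiating $l$ times in $z$ gives a system for $\partial_z^l\sigma$ and
$\partial_z^lY$ that is affine in these top order terms, with coefficients made of lower orders.
Induction on $l$ and a Gronwall argument then bound all orders. Since $z$ acts through integrals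
over $[0,t]$, the derivatives of $f$ of order at least one are $O(t)$.

A given solution is only measurable in $z$, so it cannot be differentiated directly. Instead a
Picard iteration is run with mollified data and with the exponential replaced by a bounded cut-off.
Its iterates are $C^k$ in $z$ by construction, with bounds uniform in the step
(`exists_scheme_bound`, `exists_density_bound`). At almost every fixed $z$ the iterates converge to
the given solution (`SolvesAt.tendsto_density`). This requires that every weak solution is the
transported one, which `IsWeakSolution.eq_flow` derives from test functions independent of time. A
pointwise limit of functions with $k$ bounded derivatives lies in $W^{k,\infty}$ with the same bound
(`hasQuotients_of_tendsto`). `exists_quotient_bound` combines these facts.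

The bound $C$ on the influence function holds only for $\rho$-almost every $z$. By continuity it
holds, enlarged by 1, on an interval around each such $z$. The local constant depends on $C$ alone,
and countably many rational intervals suffice (`ae_abs_zDeriv_le`). Existence of the weak
derivatives on all of $(1,\infty)$ uses separate, non-uniform bounds on compact intervals.

For the norm, order zero is controlled in $L^p$ by $\|f^{\rm in}\|_{L^p}$ times the maximal Jacobian
$e^{\kappa|C|t}$ (`IsGlobalSolution.lpNorm_le`). Each higher order contributes at most $7Kt$,
because the total mass is $2\pi\le 7$. The inequality $t\le(e^{\Lambda_1t}-1)/\Lambda_1$ gives the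
stated form, without dependence on $p$. -/

namespace Winfree

/-! ### Estimates for iterated derivatives of compositions, products and integrals -/

section Calculus

variable {J : Set ℝ} {z : ℝ}

theorem abs_iteratedDerivWithin_comp_le (hJ : IsOpen J) (hz : z ∈ J) {n l : ℕ} (hl : l ≤ n)
    {g u : ℝ → ℝ} (hg : ContDiff ℝ n g) (hu : ContDiffOn ℝ n u J) {G D : ℝ} (hD : 1 ≤ D)
    (hG : ∀ i ≤ l, |iteratedDeriv i g (u z)| ≤ G)
    (hu' : ∀ i, 1 ≤ i → i ≤ l → |iteratedDerivWithin i u J z| ≤ D) :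
    |iteratedDerivWithin l (fun z => g (u z)) J z| ≤ l.factorial * G * D ^ l := by
  have := norm_iteratedFDerivWithin_comp_le (𝕜 := ℝ) (g := g) (f := u) (n := l) (s := J)
    (t := univ) (x := z) (N := n) hg.contDiffOn hu (by exact_mod_cast hl) uniqueDiffOn_univ
    hJ.uniqueDiffOn (mapsTo_univ _ _) hz (C := G) (D := D)
    (fun i hi => by
      rw [norm_iteratedFDerivWithin_eq_norm_iteratedDerivWithin, iteratedDerivWithin_univ]
      exact hG i hi)
    (fun i h1 hi => by
      rw [norm_iteratedFDerivWithin_eq_norm_iteratedDerivWithin]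
      exact (hu' i h1 hi).trans (le_self_pow₀ hD (by omega)))
  rw [norm_iteratedFDerivWithin_eq_norm_iteratedDerivWithin] at this
  exact this

/-- Leibniz's rule for $(g\circ u)'=(g'\circ u)u'$. Only the term `i = 0` contains the derivative of
`u` of order `l + 1`. -/
theorem iteratedDerivWithin_comp_succ (hJ : IsOpen J) (hz : z ∈ J) {n l : ℕ} (hl : l + 1 ≤ n)
    {g u : ℝ → ℝ} (hg : ContDiff ℝ n g) (hu : ContDiffOn ℝ n u J) :
    iteratedDerivWithin (l + 1) (fun z => g (u z)) J z = ∑ i ∈ Finset.range (l + 1),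
      (l.choose i : ℝ) * iteratedDerivWithin i (fun z => deriv g (u z)) J z
        * iteratedDerivWithin (l - i + 1) u J z := by
  have hn : (n : ℕ∞ω) ≠ 0 := by
    have : n ≠ 0 := by omega
    exact_mod_cast this
  have hln : ((l : ℕ∞ω) + 1) ≤ n := by exact_mod_cast hl
  rw [iteratedDerivWithin_succ']
  have h1 : EqOn (derivWithin (fun z => g (u z)) J)
      ((fun z => deriv g (u z)) * derivWithin u J) J := by
    intro y hy
    have hd : HasDerivAt g (deriv g (u y)) (u y) :=
      ((hg.differentiable hn) (u y)).hasDerivAt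
    have hd2 := ((hu.differentiableOn hn) y hy).hasDerivWithinAt
    exact (hd.comp_hasDerivWithinAt y hd2).derivWithin (hJ.uniqueDiffOn y hy)
  rw [iteratedDerivWithin_congr h1 hz, iteratedDerivWithin_mul hz hJ.uniqueDiffOn]
  · simp only [iteratedDerivWithin_succ']
  · have hg' : ContDiff ℝ l (deriv g) := by
      have : ContDiff ℝ ((l : ℕ∞ω) + 1) g := hg.of_le hln
      exact (contDiff_succ_iff_deriv.1 this).2.2
    exact (hg'.comp_contDiffOn (hu.of_le ((le_self_add).trans hln))) z hz
  · exact (hu.derivWithin hJ.uniqueDiffOn hln) z hz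

/-- The top derivative of `u` enters linearly with coefficient `G`, which permits a Gronwall
argument order by order. Every other term keeps a factor `E`, so a bound proportional to time is
inherited. -/
theorem abs_iteratedDerivWithin_comp_succ_le (hJ : IsOpen J) (hz : z ∈ J) {n l : ℕ}
    (hl : l + 1 ≤ n) {g u : ℝ → ℝ} (hg : ContDiff ℝ n g) (hu : ContDiffOn ℝ n u J) {G D E : ℝ}
    (hD : 1 ≤ D) (hE0 : 0 ≤ E) (hED : E ≤ D) (hG : ∀ i ≤ l + 1, |iteratedDeriv i g (u z)| ≤ G)
    (hu' : ∀ i, 1 ≤ i → i ≤ l → |iteratedDerivWithin i u J z| ≤ E) :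
    |iteratedDerivWithin (l + 1) (fun z => g (u z)) J z| ≤
      G * |iteratedDerivWithin (l + 1) u J z| + 2 ^ l * (l.factorial * G * D ^ l) * E := by
  have hG0 : 0 ≤ G := (abs_nonneg _).trans (hG 0 (Nat.zero_le _))
  rw [iteratedDerivWithin_comp_succ hJ hz hl hg hu, Finset.sum_range_succ']
  refine (abs_add_le _ _).trans ?_
  rw [add_comm]
  refine add_le_add ?_ ?_
  · simp only [Nat.choose_zero_right, Nat.cast_one, one_mul, iteratedDerivWithin_zero,
      Nat.sub_zero, abs_mul]
    gcongr
    have := hG 1 (by omega)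
    rwa [iteratedDeriv_one] at this
  · have hln : ((l : ℕ∞ω) + 1) ≤ n := by exact_mod_cast hl
    have hg' : ContDiff ℝ l (deriv g) := by
      have : ContDiff ℝ ((l : ℕ∞ω) + 1) g := hg.of_le hln
      exact (contDiff_succ_iff_deriv.1 this).2.2
    have hul : ContDiffOn ℝ l u J := hu.of_le ((le_self_add).trans hln)
    refine (Finset.abs_sum_le_sum_abs _ _).trans ?_
    have hterm : ∀ i ∈ Finset.range l,
        |(l.choose (i + 1) : ℝ) * iteratedDerivWithin (i + 1) (fun z => deriv g (u z)) J z
          * iteratedDerivWithin (l - (i + 1) + 1) u J z|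
        ≤ (l.choose (i + 1) : ℝ) * ((l.factorial * G * D ^ l) * E) := by
      intro i hi
      have hi' : i < l := Finset.mem_range.1 hi
      rw [abs_mul, abs_mul, Nat.abs_cast, mul_assoc]
      gcongr
      · refine (abs_iteratedDerivWithin_comp_le hJ hz (n := l) (l := i + 1) (by omega) hg' hul hD
          (G := G) ?_ ?_).trans ?_
        · intro j hj
          rw [← iteratedDeriv_succ']
          exact hG (j + 1) (by omega)
        · intro j h1 hj
          exact (hu' j h1 (by omega)).trans hED
        · gcongr
          · exact hi'
          · exact hi'
      · exact hu' _ (by omega) (by omega)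
    refine (Finset.sum_le_sum hterm).trans ?_
    rw [← Finset.sum_mul, mul_assoc (2 ^ l : ℝ)]
    refine mul_le_mul_of_nonneg_right ?_ (mul_nonneg (by positivity) hE0)
    have h2 := Nat.sum_range_choose l
    rw [Finset.sum_range_succ'] at h2
    have h3 : ∑ i ∈ Finset.range l, l.choose (i + 1) ≤ 2 ^ l := by omega
    exact_mod_cast h3

/-- The two extreme Leibniz terms are kept apart since they carry the top order. The intermediate
ones have at least one derivative on `v` and thus a factor `E`. -/
theorem abs_iteratedDerivWithin_mul_le (hJ : IsOpen J) (hz : z ∈ J) {n l : ℕ} (hl : l + 1 ≤ n)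
    {u v : ℝ → ℝ} (hu : ContDiffOn ℝ n u J) (hv : ContDiffOn ℝ n v J) {P E : ℝ} (hE0 : 0 ≤ E)
    (hP : ∀ i, 1 ≤ i → i ≤ l → |iteratedDerivWithin i u J z| ≤ P)
    (hE : ∀ i, 1 ≤ i → i ≤ l → |iteratedDerivWithin i v J z| ≤ E) :
    |iteratedDerivWithin (l + 1) (fun z => u z * v z) J z| ≤
      |u z| * |iteratedDerivWithin (l + 1) v J z| + |iteratedDerivWithin (l + 1) u J z| * |v z|
        + 2 ^ (l + 1) * |P| * E := by
  have hln : ((l + 1 : ℕ) : ℕ∞ω) ≤ n := by exact_mod_cast hl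
  have h0 := iteratedDerivWithin_mul hz hJ.uniqueDiffOn ((hu.of_le hln) z hz)
    ((hv.of_le hln) z hz)
  rw [show (fun z => u z * v z) = u * v from rfl, h0, Finset.sum_range_succ',
    Finset.sum_range_succ]
  have hsum : |∑ i ∈ Finset.range l, ((l + 1).choose (i + 1) : ℝ)
      * iteratedDerivWithin (i + 1) u J z * iteratedDerivWithin (l + 1 - (i + 1)) v J z|
      ≤ 2 ^ (l + 1) * |P| * E := by
    refine (Finset.abs_sum_le_sum_abs _ _).trans ?_
    have hterm : ∀ i ∈ Finset.range l, |((l + 1).choose (i + 1) : ℝ)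
        * iteratedDerivWithin (i + 1) u J z * iteratedDerivWithin (l + 1 - (i + 1)) v J z|
        ≤ ((l + 1).choose (i + 1) : ℝ) * (|P| * E) := by
      intro i hi
      have hi' : i < l := Finset.mem_range.1 hi
      rw [abs_mul, abs_mul, Nat.abs_cast, mul_assoc]
      have h1 := (hP (i + 1) (by omega) (by omega)).trans (le_abs_self _)
      have h2 := hE (l + 1 - (i + 1)) (by omega) (by omega)
      gcongr
    refine (Finset.sum_le_sum hterm).trans ?_
    rw [← Finset.sum_mul, mul_assoc]
    refine mul_le_mul_of_nonneg_right ?_ (by positivity)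
    have h2 := Nat.sum_range_choose (l + 1)
    rw [Finset.sum_range_succ', Finset.sum_range_succ] at h2
    have h3 : ∑ i ∈ Finset.range l, (l + 1).choose (i + 1) ≤ 2 ^ (l + 1) := by omega
    exact_mod_cast h3
  refine (abs_add_le _ _).trans ?_
  refine (add_le_add (abs_add_le _ _) le_rfl).trans ?_
  simp only [abs_mul, Nat.choose_self, Nat.choose_zero_right, Nat.cast_one, one_mul, Nat.sub_self,
    iteratedDerivWithin_zero, Nat.sub_zero]
  linarith

/-- The derivative is the limit of difference quotients along a single sequence of increments,
chosen so small that `z + h m` stays in `J`. -/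
theorem aestronglyMeasurable_of_hasDerivAt {X : Type*} [MeasurableSpace X] {μ : Measure X}
    (hJ : IsOpen J) (hz : z ∈ J) {F : ℝ → X → ℝ} {F' : X → ℝ}
    (hmeas : ∀ z ∈ J, AEStronglyMeasurable (F z) μ)
    (hF : ∀ᵐ x ∂μ, HasDerivAt (fun z => F z x) (F' x) z) : AEStronglyMeasurable F' μ := by
  obtain ⟨δ, hδ, hball⟩ := Metric.isOpen_iff.1 hJ z hz
  set h : ℕ → ℝ := fun m => δ / 2 / ((m : ℝ) + 1) with hh
  have hpos : ∀ m, 0 < h m := fun m => by positivity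
  have hlim : Filter.Tendsto h Filter.atTop (nhdsWithin 0 {0}ᶜ) := by
    refine tendsto_nhdsWithin_iff.2 ⟨?_, Filter.Eventually.of_forall fun m => (hpos m).ne'⟩
    exact tendsto_const_div_atTop_nhds_zero_nat (δ / 2) |>.comp (Filter.tendsto_add_atTop_nat 1)
      |>.congr fun m => by simp [hh]
  have hmem : ∀ m, z + h m ∈ J := fun m => hball (by
    have : h m ≤ δ / 2 := div_le_self (by positivity) (by linarith [Nat.cast_nonneg (α := ℝ) m])
    rw [Metric.mem_ball, Real.dist_eq, add_sub_cancel_left, abs_of_pos (hpos m)]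
    linarith)
  refine aestronglyMeasurable_of_tendsto_ae Filter.atTop
    (f := fun m x => (h m)⁻¹ * (F (z + h m) x - F z x)) (fun m => ?_) ?_
  · exact ((hmeas _ (hmem m)).sub (hmeas z hz)).const_mul _
  · filter_upwards [hF] with x hx
    exact (hasDerivAt_iff_tendsto_slope_zero.1 hx).comp hlim

/-- Differentiation under the integral sign, to finite order. -/
theorem contDiffOn_integral {X : Type*} [MeasurableSpace X] {μ : Measure X} [IsFiniteMeasure μ]
    (hJ : IsOpen J) {n : ℕ} {u : X → ℝ → ℝ} (hmeas : ∀ z ∈ J, AEStronglyMeasurable (u · z) μ)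
    (hu : ∀ᵐ x ∂μ, ContDiffOn ℝ n (u x) J)
    (hb : ∀ l ≤ n, ∃ B, ∀ᵐ x ∂μ, ∀ z ∈ J, |iteratedDerivWithin l (u x) J z| ≤ B) :
    ContDiffOn ℝ n (fun z => ∫ x, u x z ∂μ) J ∧
    ∀ l ≤ n, ∀ z ∈ J, Integrable (fun x => iteratedDerivWithin l (u x) J z) μ ∧
      iteratedDerivWithin l (fun z => ∫ x, u x z ∂μ) J z
        = ∫ x, iteratedDerivWithin l (u x) J z ∂μ := by
  have hder : ∀ l < n, ∀ᵐ x ∂μ, ∀ z ∈ J, HasDerivAt (fun z => iteratedDerivWithin l (u x) J z)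
      (iteratedDerivWithin (l + 1) (u x) J z) z := by
    intro l hl
    filter_upwards [hu] with x hx z hz
    have h1 := (hx.differentiableOn_iteratedDerivWithin (m := l) (by exact_mod_cast hl)
      hJ.uniqueDiffOn) z hz
    rw [iteratedDerivWithin_succ]
    exact h1.hasDerivWithinAt.hasDerivAt (hJ.mem_nhds hz)
  -- Measurability climbs from each order to the next through difference quotients, so it has to be
  -- assumed for `u` only.
  have hm : ∀ l ≤ n, ∀ z ∈ J, AEStronglyMeasurable (fun x => iteratedDerivWithin l (u x) J z) μ := by
    intro l
    induction l with
    | zero => intro _ z hz; simpa using hmeas z hz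
    | succ l ih =>
      intro hl z hz
      refine aestronglyMeasurable_of_hasDerivAt hJ hz
        (F := fun z x => iteratedDerivWithin l (u x) J z) (fun z hz => ih (by omega) z hz) ?_
      filter_upwards [hder l (by omega)] with x hx using hx z hz
  have hint : ∀ l ≤ n, ∀ z ∈ J, Integrable (fun x => iteratedDerivWithin l (u x) J z) μ := by
    intro l hl z hz
    obtain ⟨B, hB⟩ := hb l hl
    refine Integrable.of_bound (hm l hl z hz) B ?_
    filter_upwards [hB] with x hx using hx z hz
  have hID : ∀ l < n, ∀ z ∈ J, HasDerivAt (fun z => ∫ x, iteratedDerivWithin l (u x) J z ∂μ)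
      (∫ x, iteratedDerivWithin (l + 1) (u x) J z ∂μ) z := by
    intro l hl z hz
    obtain ⟨B, hB⟩ := hb (l + 1) (by omega)
    refine (hasDerivAt_integral_of_dominated_loc_of_deriv_le (hJ.mem_nhds hz) (bound := fun _ => B)
      (F := fun z x => iteratedDerivWithin l (u x) J z)
      (F' := fun z x => iteratedDerivWithin (l + 1) (u x) J z) ?_ (hint l hl.le z hz)
      (hm (l + 1) hl z hz) ?_ (integrable_const _) ?_).2
    · filter_upwards [hJ.mem_nhds hz] with y hy using hm l hl.le y hy
    · filter_upwards [hB] with x hx y hy using hx y hy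
    · filter_upwards [hder l hl] with x hx y hy using hx y hy
  have heq : ∀ l ≤ n, EqOn (iteratedDerivWithin l (fun z => ∫ x, u x z ∂μ) J)
      (fun z => ∫ x, iteratedDerivWithin l (u x) J z ∂μ) J := by
    intro l
    induction l with
    | zero => intro _ z hz; simp
    | succ l ih =>
      intro hl z hz
      rw [iteratedDerivWithin_succ, derivWithin_congr (ih (by omega)) (ih (by omega) hz)]
      exact (hID l hl z hz).hasDerivWithinAt.derivWithin (hJ.uniqueDiffOn z hz)
  refine ⟨?_, fun l hl z hz => ⟨hint l hl z hz, heq l hl hz⟩⟩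
  rw [contDiffOn_nat_iff_continuousOn_differentiableOn_deriv hJ.uniqueDiffOn]
  refine ⟨fun l hl => ?_, fun l hl => ?_⟩
  · refine ContinuousOn.congr ?_ (heq l hl)
    obtain ⟨B, hB⟩ := hb l hl
    refine continuousOn_of_dominated (bound := fun _ => B) (fun z hz => hm l hl z hz)
      (fun z hz => ?_) (integrable_const _) ?_
    · filter_upwards [hB] with x hx using hx z hz
    · filter_upwards [hu] with x hx
      exact hx.continuousOn_iteratedDerivWithin (by exact_mod_cast hl) hJ.uniqueDiffOn
  · refine DifferentiableOn.congr ?_ (heq l hl.le)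
    exact fun z hz => (hID l hl z hz).differentiableAt.differentiableWithinAt

end Calculus

/-! ### Regularity of the influence function -/

/-- The complex Gamma function is holomorphic on the right half plane, hence analytic, and
restriction to the real axis preserves smoothness. -/
theorem contDiffAt_Gamma {x : ℝ} (hx : 0 < x) : ContDiffAt ℝ ∞ Real.Gamma x := by
  have h1 : DifferentiableOn ℂ Complex.Gamma {s : ℂ | 0 < s.re} := by
    intro s hs
    refine (Complex.differentiableAt_Gamma s fun m hm => ?_).differentiableWithinAt
    have : (0 : ℝ) < s.re := hs
    rw [hm] at this
    simp only [Complex.neg_re, Complex.natCast_re] at this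
    linarith [Nat.cast_nonneg (α := ℝ) m]
  have h2 : AnalyticAt ℂ Complex.Gamma (x : ℂ) :=
    h1.analyticAt ((isOpen_lt continuous_const Complex.continuous_re).mem_nhds (by simpa using hx))
  exact (h2.contDiffAt (n := ∞)).real_of_complex

theorem contDiffOn_normFactor : ContDiffOn ℝ ∞ normFactor (Ioi 0) := by
  intro z hz
  have hz0 : (0 : ℝ) < z := hz
  have h1 : ContDiffAt ℝ ∞ (fun z : ℝ => Real.Gamma (z + 1)) z :=
    ContDiffAt.comp (g := Real.Gamma) z (contDiffAt_Gamma (by linarith)) (by fun_prop)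
  have h2 : ContDiffAt ℝ ∞ (fun z : ℝ => Real.Gamma (2 * z + 1)) z :=
    ContDiffAt.comp (g := Real.Gamma) (f := fun z => 2 * z + 1) z
      (contDiffAt_Gamma (by linarith)) (by fun_prop)
  have h3 : ContDiffAt ℝ ∞ (fun z : ℝ => (2 : ℝ) ^ z) z :=
    contDiffAt_const.rpow contDiffAt_id (by norm_num)
  exact (((h3.mul (h1.pow 2)).div h2 (Real.Gamma_pos_of_pos (by linarith)).ne')).contDiffWithinAt

theorem one_add_cos_nonneg (θ : ℝ) : 0 ≤ 1 + Real.cos θ := by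
  linarith [Real.neg_one_le_cos θ]

theorem influence_periodic (θ z : ℝ) : influence (θ + 2 * Real.pi) z = influence θ z := by
  simp [influence]

theorem hasDerivAt_rpow_mul_log_pow {x : ℝ} (hx : 0 ≤ x) (i : ℕ) {z : ℝ} (hz : 0 < z) :
    HasDerivAt (fun z => x ^ z * Real.log x ^ i) (x ^ z * Real.log x ^ (i + 1)) z := by
  rcases hx.eq_or_lt with rfl | hx
  -- At the base 0, which occurs for $\theta=\pi$, the function vanishes for all positive exponents.
  · refine HasDerivAt.congr_of_eventuallyEq (f := fun _ => 0) ?_ ?_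
    · simpa [Real.zero_rpow hz.ne'] using hasDerivAt_const z (0 : ℝ)
    · filter_upwards [lt_mem_nhds hz] with y hy
      simp [Real.zero_rpow hy.ne']
  · have := ((Real.hasStrictDerivAt_const_rpow hx z).hasDerivAt).mul_const (Real.log x ^ i)
    rwa [mul_assoc, ← pow_succ'] at this

theorem iteratedDerivWithin_rpow {x : ℝ} (hx : 0 ≤ x) (i : ℕ) :
    EqOn (iteratedDerivWithin i (fun z : ℝ => x ^ z) (Ioi 0)) (fun z : ℝ => x ^ z * Real.log x ^ i)
      (Ioi 0) := by
  induction i with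
  | zero => intro z _; simp
  | succ i ih =>
    intro z hz
    rw [iteratedDerivWithin_succ, derivWithin_congr ih (ih hz)]
    exact (hasDerivAt_rpow_mul_log_pow hx i hz).hasDerivWithinAt.derivWithin
      (isOpen_Ioi.uniqueDiffOn z hz)

theorem contDiffOn_rpow {x : ℝ} (hx : 0 ≤ x) : ContDiffOn ℝ ∞ (fun z : ℝ => x ^ z) (Ioi 0) := by
  rcases hx.eq_or_lt with rfl | hx
  · exact contDiffOn_const (c := (0 : ℝ)) |>.congr fun y hy =>
      Real.zero_rpow (mem_Ioi.1 hy).ne'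
  · exact (contDiff_const.rpow contDiff_id fun _ => hx.ne').contDiffOn

/-- With $y=x^{1/i}$ one has $x^z(\log x)^i=x^{z-1}(i\,y\log y)^i$, and $y\log y$ is continuous at
0. One power of $x$ pays for the logarithms, and the remaining $x^{z-1}$ is continuous because
$z>1$. -/
theorem continuousAt_rpow_mul_log_pow (i : ℕ) {x z : ℝ} (hx : 0 ≤ x) (hz : 1 < z) :
    ContinuousWithinAt (fun p : ℝ × ℝ => p.1 ^ p.2 * Real.log p.1 ^ i) (Ici 0 ×ˢ Ioi 1) (x, z) := by
  rcases Nat.eq_zero_or_pos i with rfl | hi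
  · simp only [pow_zero, mul_one]
    exact (Real.continuousAt_rpow (x, z) (Or.inr (by simpa using by linarith))).continuousWithinAt
  · have hi' : (0 : ℝ) < i := by exact_mod_cast hi
    have hc : ContinuousAt (fun p : ℝ × ℝ => p.1 ^ (p.2 - 1)
        * ((i : ℝ) * (p.1 ^ (1 / (i : ℝ)) * Real.log (p.1 ^ (1 / (i : ℝ))))) ^ i) (x, z) := by
      refine ContinuousAt.mul ?_ ?_
      · exact (Real.continuousAt_rpow (x, z - 1) (Or.inr (by simpa using by linarith))).comp
          (f := fun p : ℝ × ℝ => (p.1, p.2 - 1)) (x := (x, z)) (by fun_prop)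
      · have h1 : Continuous fun p : ℝ × ℝ => p.1 ^ (1 / (i : ℝ)) :=
          continuous_fst.rpow_const fun _ => Or.inr (by positivity)
        exact ((continuous_const.mul (Real.continuous_mul_log.comp h1)).pow i).continuousAt
    refine hc.continuousWithinAt.congr_of_mem ?_ ⟨hx, hz⟩
    rintro ⟨y, w⟩ ⟨hy, hw⟩
    have hy' : (0 : ℝ) ≤ y := hy
    have hw' : (1 : ℝ) < w := hw
    rcases hy'.eq_or_lt with rfl | hy'
    · simp [Real.zero_rpow (show w ≠ 0 by linarith), hi.ne']
    · simp only
      rw [Real.log_rpow hy', mul_pow, mul_pow, mul_pow, ← Real.rpow_natCast (y ^ (1 / (i : ℝ))),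
        ← Real.rpow_mul hy'.le, one_div_mul_cancel hi'.ne', Real.rpow_one, Real.rpow_sub_one hy'.ne']
      have : (i : ℝ) ^ i * (1 / (i : ℝ)) ^ i = 1 := by
        rw [← mul_pow, mul_one_div_cancel hi'.ne', one_pow]
      field_simp
      linear_combination (-Real.log y ^ i) * this

theorem contDiffOn_influence (θ : ℝ) : ContDiffOn ℝ ∞ (influence θ) (Ioi 0) :=
  contDiffOn_normFactor.mul (contDiffOn_rpow (one_add_cos_nonneg θ))

/-- Joint continuity includes the angles where $1+\cos\theta=0$. Bounds uniform in $\theta$ then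
follow from compactness of a period. -/
theorem continuousOn_iteratedDeriv_influence (l : ℕ) :
    ContinuousOn (fun p : ℝ × ℝ => iteratedDeriv l (influence p.1) p.2) (univ ×ˢ Ioi 1) := by
  have h1 : EqOn (fun p : ℝ × ℝ => iteratedDeriv l (influence p.1) p.2)
      (fun p => ∑ i ∈ Finset.range (l + 1), (l.choose i : ℝ)
        * iteratedDerivWithin i normFactor (Ioi 0) p.2
        * ((1 + Real.cos p.1) ^ p.2 * Real.log (1 + Real.cos p.1) ^ (l - i))) (univ ×ˢ Ioi 1) := by
    rintro ⟨θ, z⟩ ⟨-, hz⟩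
    have hz0 : z ∈ Ioi (0 : ℝ) := lt_trans one_pos (mem_Ioi.1 hz)
    simp only
    rw [← iteratedDerivWithin_of_isOpen isOpen_Ioi hz0]
    have hl : (l : ℕ∞ω) ≤ (∞ : ℕ∞ω) := by exact_mod_cast le_top
    have := iteratedDerivWithin_mul hz0 isOpen_Ioi.uniqueDiffOn
      ((contDiffOn_normFactor.of_le hl) z hz0)
      (((contDiffOn_rpow (one_add_cos_nonneg θ)).of_le hl) z hz0)
    refine this.trans (Finset.sum_congr rfl fun i _ => ?_)
    rw [iteratedDerivWithin_rpow (one_add_cos_nonneg θ) (l - i) hz0]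
  refine ContinuousOn.congr ?_ h1
  refine continuousOn_finsetSum _ fun i _ => ?_
  refine ContinuousOn.mul (ContinuousOn.mul continuousOn_const ?_) ?_
  · have := contDiffOn_normFactor.continuousOn_iteratedDerivWithin (m := i)
      (by exact_mod_cast le_top) isOpen_Ioi.uniqueDiffOn
    exact this.comp continuousOn_snd fun p hp => lt_trans one_pos (mem_Ioi.1 hp.2)
  · rintro ⟨θ, z⟩ ⟨-, hz⟩
    have h2 := continuousAt_rpow_mul_log_pow (l - i) (one_add_cos_nonneg θ) hz
    have h3 : ContinuousWithinAt (fun p : ℝ × ℝ => (1 + Real.cos p.1, p.2)) (univ ×ˢ Ioi 1)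
      (θ, z) := by fun_prop
    exact ContinuousWithinAt.comp (x := ((θ, z) : ℝ × ℝ)) (t := Ici 0 ×ˢ Ioi 1) h2 h3
      fun p hp => ⟨one_add_cos_nonneg p.1, hp.2⟩

/-- The truncation `max p.2 1` extends the influence function continuously to all real parameters.
The scheme uses this extension, so that its fields are measurable everywhere. -/
theorem continuous_influence_max :
    Continuous fun p : ℝ × ℝ => influence p.1 (max p.2 1) := by
  unfold influence
  refine Continuous.mul ?_ ?_
  · exact contDiffOn_normFactor.continuousOn.comp_continuous (by fun_prop)
      fun p => mem_Ioi.2 (lt_of_lt_of_le one_pos (le_max_right _ _))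
  · exact Continuous.rpow (by fun_prop) (by fun_prop)
      fun p => Or.inr (lt_of_lt_of_le one_pos (le_max_right _ _))

theorem iteratedDeriv_influence_periodic (l : ℕ) (z : ℝ) :
    Function.Periodic (fun θ => iteratedDeriv l (influence θ) z) (2 * Real.pi) := by
  intro θ
  have : influence (θ + 2 * Real.pi) = influence θ := funext fun z => influence_periodic θ z
  simp only [this]

theorem abs_iteratedDeriv_influence_le_of_Icc {l : ℕ} {z B : ℝ}
    (h : ∀ θ ∈ Icc 0 (2 * Real.pi), |iteratedDeriv l (influence θ) z| ≤ B) (θ : ℝ) :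
    |iteratedDeriv l (influence θ) z| ≤ B := by
  obtain ⟨y, hy, hy2⟩ := (iteratedDeriv_influence_periodic l z).exists_mem_Ico₀
    (by positivity) θ
  rw [show iteratedDeriv l (influence θ) z = _ from hy2]
  exact h y ⟨hy.1, hy.2.le⟩

/-- A uniform bound for the `z`-derivatives of the influence function on a compact interval. -/
theorem exists_influence_bound (k : ℕ) {a b : ℝ} (ha : 1 < a) :
    ∃ C, 0 ≤ C ∧ ∀ l ≤ k, ∀ θ, ∀ z ∈ Icc a b, |iteratedDeriv l (influence θ) z| ≤ C := by
  have : ∀ l, ∃ C, 0 ≤ C ∧ ∀ θ, ∀ z ∈ Icc a b, |iteratedDeriv l (influence θ) z| ≤ C := by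
    intro l
    have hK : IsCompact ((Icc 0 (2 * Real.pi)) ×ˢ (Icc a b)) := isCompact_Icc.prod isCompact_Icc
    obtain ⟨C, hC⟩ := hK.exists_bound_of_continuousOn
      ((continuousOn_iteratedDeriv_influence l).mono
        fun p hp => ⟨mem_univ _, lt_of_lt_of_le ha hp.2.1⟩)
    refine ⟨|C|, abs_nonneg _, fun θ z hz => ?_⟩
    exact abs_iteratedDeriv_influence_le_of_Icc
      (fun θ hθ => (hC (θ, z) ⟨hθ, hz⟩).trans (le_abs_self _)) θ
  choose C hC0 hC using this
  refine ⟨∑ l ∈ Finset.range (k + 1), C l, Finset.sum_nonneg fun i _ => hC0 i,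
    fun l hl θ z hz => (hC l θ z hz).trans ?_⟩
  exact Finset.single_le_sum (f := C) (fun i _ => hC0 i) (Finset.mem_range.2 (by omega))

/-- By the tube lemma over one period, a bound at a single parameter persists on an interval at the
cost of adding 1. This turns an almost everywhere bound into bounds on intervals. -/
theorem exists_influence_bound_nhds (k : ℕ) {z₀ C : ℝ} (hz₀ : 1 < z₀)
    (hC : ∀ l ≤ k, ∀ θ, |iteratedDeriv l (influence θ) z₀| ≤ C) :
    ∃ a b, 1 < a ∧ a < z₀ ∧ z₀ < b ∧
      ∀ l ≤ k, ∀ θ, ∀ z ∈ Ioo a b, |iteratedDeriv l (influence θ) z| ≤ C + 1 := by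
  have h1 : ∀ l ∈ Finset.range (k + 1), ∀ᶠ z in nhds z₀, ∀ θ ∈ Icc 0 (2 * Real.pi),
      |iteratedDeriv l (influence θ) z| ≤ C + 1 := by
    intro l hl
    refine isCompact_Icc.eventually_forall_of_forall_eventually fun θ _ => ?_
    have hca : ContinuousAt (fun p : ℝ × ℝ => |iteratedDeriv l (influence p.2) p.1|) (z₀, θ) := by
      have := (continuousOn_iteratedDeriv_influence l).continuousAt (x := (θ, z₀))
        ((isOpen_univ.prod isOpen_Ioi).mem_nhds ⟨mem_univ _, hz₀⟩)
      exact (ContinuousAt.comp (f := fun p : ℝ × ℝ => (p.2, p.1)) (x := (z₀, θ)) this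
        (by fun_prop)).abs
    have hlt : |iteratedDeriv l (influence θ) z₀| < C + 1 :=
      (hC l (by simpa [Nat.lt_succ_iff] using hl) θ).trans_lt (lt_add_one C)
    exact (hca.eventually_lt continuousAt_const hlt).mono fun p hp => hp.le
  have h2 : ∀ᶠ z in nhds z₀, 1 < z ∧ ∀ l ∈ Finset.range (k + 1), ∀ θ ∈ Icc 0 (2 * Real.pi),
      |iteratedDeriv l (influence θ) z| ≤ C + 1 :=
    (lt_mem_nhds hz₀).and ((Filter.eventually_all_finset _).2 h1)
  obtain ⟨δ, hδ, h⟩ := Metric.eventually_nhds_iff.1 h2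
  have hmem : ∀ z, |z - z₀| < δ → 1 < z := fun z hz => (h (by rwa [Real.dist_eq])).1
  refine ⟨z₀ - δ / 2, z₀ + δ / 2, hmem _ ?_, by linarith, by linarith, fun l hl θ z hz => ?_⟩
  · rw [abs_lt]; constructor <;> linarith
  · refine abs_iteratedDeriv_influence_le_of_Icc
      ((h ?_).2 l (by simpa [Nat.lt_succ_iff] using hl)) θ
    rw [Real.dist_eq, abs_lt]
    constructor <;> linarith [hz.1, hz.2]

/-! ### A discrete Gronwall inequality -/

theorem integral_exp_mul_le {a : ℝ} (ha : 0 < a) (s t : ℝ) :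
    ∫ r in s..t, Real.exp (a * r) ≤ Real.exp (a * t) / a := by
  have h : ∀ r ∈ uIcc s t, HasDerivAt (fun r => Real.exp (a * r) / a) (Real.exp (a * r)) r := by
    intro r _
    have := (((hasDerivAt_id r).const_mul a).exp).div_const a
    simpa [ha.ne'] using this
  rw [intervalIntegral.integral_eq_sub_of_hasDerivAt h
    (Continuous.intervalIntegrable (by fun_prop) _ _)]
  have := div_nonneg (Real.exp_pos (a * s)).le ha.le
  linarith

theorem integral_exp_mul_sub_le {a : ℝ} (ha : 0 < a) (s t : ℝ) :
    ∫ r in s..t, Real.exp (a * (t - r)) ≤ Real.exp (a * (t - s)) / a := by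
  have h : ∀ r ∈ uIcc s t, HasDerivAt (fun r => -(Real.exp (a * (t - r)) / a))
      (Real.exp (a * (t - r))) r := by
    intro r _
    have := ((((hasDerivAt_id r).const_sub t).const_mul a).exp.div_const a).neg
    convert! this using 1
    simp
    field_simp
  rw [intervalIntegral.integral_eq_sub_of_hasDerivAt h
    (Continuous.intervalIntegrable (by fun_prop) _ _)]
  have : 0 ≤ 1 / a := by positivity
  simp
  positivity

/-- A Gronwall inequality for an iteration that couples functions of `t` with functions of
`s ≤ t`, through integrals over `[s, t]`. -/
theorem iteration_bound {K T : ℝ} (hK : 1 ≤ K) (hT : 0 ≤ T) : ∃ L : ℝ, 1 ≤ L ∧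
    ∀ (a : ℕ → ℝ → ℝ) (b : ℕ → ℝ × ℝ → ℝ → ℝ → ℝ) (ε : ℕ → ℝ) (c₀ : ℝ), 0 ≤ c₀ → (∀ n, 0 ≤ ε n) →
      (∀ t ∈ Icc 0 T, a 0 t ≤ c₀) → (∀ i s t, 0 ≤ s → s ≤ t → t ≤ T → b 0 i s t ≤ c₀) →
      (∀ (n : ℕ) (α : ℝ → ℝ) (β : ℝ → ℝ → ℝ), Continuous α → (∀ t, Continuous fun r => β r t) →
        (∀ t, 0 ≤ α t) → (∀ s t, 0 ≤ β s t) →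
        (∀ t ∈ Icc 0 T, a n t ≤ α t) →
        (∀ i s t, 0 ≤ s → s ≤ t → t ≤ T → b n i s t ≤ β s t) →
        (∀ i s t, 0 ≤ s → s ≤ t → t ≤ T →
          b (n + 1) i s t ≤ K * ∫ r in s..t, (ε n + α r + β r t)) ∧
        ∀ t ∈ Icc 0 T,
          a (n + 1) t ≤ K * (ε n + β 0 t + ∫ r in (0 : ℝ)..t, (ε n + α r + β r t))) →
      ∃ c : ℕ → ℝ, c 0 = c₀ ∧ (∀ n, c (n + 1) = 3 / 4 * c n + L * ε n) ∧ ∀ n, 0 ≤ c n ∧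
        (∀ t ∈ Icc 0 T, a n t ≤ L * c n) ∧
        ∀ i s t, 0 ≤ s → s ≤ t → t ≤ T → b n i s t ≤ L * c n := by
  have hK0 : 0 < K := by linarith
  -- Weighted norms: `a n t` is compared with `A * exp (lam * t)` and `b n i s t` with `exp (lam *
  -- t) * exp (μ * (t - s))`. The choices of `μ` and `lam` make each integral contribute at most a
  -- quarter of the weight. The factor `A` absorbs the term `β 0 t`, which is not integrated and
  -- hence not small.
  set μ := 4 * K with hμ
  have hμ0 : 0 < μ := by positivity
  set B := Real.exp (μ * T) with hB
  have hB1 : 1 ≤ B := Real.one_le_exp (by positivity)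
  set A := 4 * K * B with hA
  have hA1 : 1 ≤ A := by nlinarith [mul_le_mul hK hB1 zero_le_one hK0.le]
  set lam := 4 * K * A with hlam
  have hlam0 : 0 < lam := by positivity
  set X := Real.exp (lam * T) with hX
  have hX1 : 1 ≤ X := Real.one_le_exp (by positivity)
  have hKT : K ≤ K * (1 + T) := by nlinarith
  -- `A * X` and `B * X` remove the weights at the end, and `K * (1 + T)` dominates the coefficient
  -- of `ε n`.
  refine ⟨A * X + B * X + K * (1 + T), by nlinarith, ?_⟩
  intro a b ε c₀ hc₀ hε ha0 hb0 step
  set L := A * X + B * X + K * (1 + T) with hL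
  let c : ℕ → ℝ := fun n => Nat.rec c₀ (fun n x => 3 / 4 * x + L * ε n) n
  have hL0 : 0 ≤ L := by positivity
  have hc : ∀ n, 0 ≤ c n := by
    intro n
    induction n with
    | zero => exact hc₀
    | succ n ih => exact add_nonneg (mul_nonneg (by norm_num) ih) (mul_nonneg hL0 (hε n))
  have hcs : ∀ n, c (n + 1) = 3 / 4 * c n + L * ε n := fun n => rfl
  have hexp1 : ∀ t, 0 ≤ t → 1 ≤ Real.exp (lam * t) := fun t ht => Real.one_le_exp (by positivity)
  have main : ∀ n, (∀ t ∈ Icc 0 T, a n t ≤ A * c n * Real.exp (lam * t)) ∧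
      ∀ i s t, 0 ≤ s → s ≤ t → t ≤ T →
        b n i s t ≤ c n * Real.exp (lam * t) * Real.exp (μ * (t - s)) := by
    intro n
    induction n with
    | zero =>
      refine ⟨fun t ht => (ha0 t ht).trans ?_, fun i s t hs hst ht => (hb0 i s t hs hst ht).trans ?_⟩
      · have h1 := hexp1 t ht.1
        change c₀ ≤ A * c₀ * _
        have : c₀ ≤ A * c₀ := le_mul_of_one_le_left hc₀ hA1
        exact this.trans (le_mul_of_one_le_right (by positivity) h1)
      · have h1 := hexp1 t (hs.trans hst)
        have h2 : 1 ≤ Real.exp (μ * (t - s)) :=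
          Real.one_le_exp (mul_nonneg hμ0.le (by linarith))
        change c₀ ≤ c₀ * _ * _
        rw [mul_assoc]
        exact le_mul_of_one_le_right hc₀ (one_le_mul_of_one_le_of_one_le h1 h2)
    | succ n ih =>
      obtain ⟨ih1, ih2⟩ := ih
      -- The recursion is fed with explicit continuous majorants, so no regularity of `a` and `b` in
      -- time is needed.
      obtain ⟨hb, ha⟩ := step n (fun t => A * c n * Real.exp (lam * t))
        (fun s t => c n * Real.exp (lam * t) * Real.exp (μ * (t - s))) (by fun_prop)
        (fun t => by fun_prop) (fun t => by have := hc n; positivity)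
        (fun s t => by have := hc n; positivity) ih1 ih2
      have hI : ∀ s t, s ≤ t → (∫ r in s..t, (ε n + A * c n * Real.exp (lam * r)
          + c n * Real.exp (lam * t) * Real.exp (μ * (t - r)))) ≤ ε n * (t - s)
          + A * c n * (Real.exp (lam * t) / lam)
          + c n * Real.exp (lam * t) * (Real.exp (μ * (t - s)) / μ) := by
        intro s t _
        rw [intervalIntegral.integral_add (Continuous.intervalIntegrable (by fun_prop) _ _)
          (Continuous.intervalIntegrable (by fun_prop) _ _),
          intervalIntegral.integral_add (Continuous.intervalIntegrable (by fun_prop) _ _)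
          (Continuous.intervalIntegrable (by fun_prop) _ _)]
        simp only [intervalIntegral.integral_const, intervalIntegral.integral_const_mul, smul_eq_mul]
        have h1 := integral_exp_mul_le hlam0 s t
        have h2 := integral_exp_mul_sub_le hμ0 s t
        have := hc n
        rw [mul_comm (t - s)]
        gcongr
      have hcn := hc n
      have hεn := hε n
      refine ⟨fun t ht => (ha t ht).trans ?_, fun i s t hs hst htT => (hb i s t hs hst htT).trans ?_⟩
      · have h1 := hI 0 t ht.1
        have h2 := hexp1 t ht.1
        have h3 : Real.exp (μ * (t - 0)) ≤ B := by
          rw [hB, sub_zero]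
          exact Real.exp_le_exp.2 (mul_le_mul_of_nonneg_left ht.2 hμ0.le)
        set y := Real.exp (lam * t)
        set w := Real.exp (μ * (t - 0))
        have e1 : A * c n * (y / lam) = c n * y / (4 * K) := by rw [hlam]; field_simp
        have e2 : c n * y * (w / μ) = c n * y * w / (4 * K) := by rw [hμ]; field_simp
        rw [e1, e2] at h1
        have hcy : 0 ≤ c n * y := by positivity
        have h5 : K * (ε n + c n * y * w + (∫ r in (0 : ℝ)..t, (ε n + A * c n * Real.exp (lam * r)
          + c n * Real.exp (lam * t) * Real.exp (μ * (t - r))))) ≤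
          K * (ε n + c n * y * w + (ε n * (t - 0) + c n * y / (4 * K) + c n * y * w / (4 * K))) := by
          gcongr
        refine h5.trans ?_
        have e3 : K * (ε n + c n * y * w + (ε n * (t - 0) + c n * y / (4 * K)
          + c n * y * w / (4 * K))) = K * (1 + t) * ε n + K * (c n * y * w) + c n * y / 4
          + c n * y * w / 4 := by field_simp; ring
        rw [e3, hcs]
        have h6 : c n * y * w ≤ c n * y * B := by gcongr
        have h7 : K * (1 + t) * ε n ≤ L * ε n * (A * y) := by
          have : K * (1 + t) ≤ L := by
            have : K * (1 + t) ≤ K * (1 + T) := by gcongr; exact ht.2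
            have : 0 ≤ A * X + B * X := by positivity
            linarith
          have h8 : 1 ≤ A * y := one_le_mul_of_one_le_of_one_le hA1 h2
          calc K * (1 + t) * ε n ≤ L * ε n := by gcongr
            _ ≤ L * ε n * (A * y) := le_mul_of_one_le_right (by positivity) h8
        have h9 : K * (c n * y * w) ≤ K * (c n * y * B) := by gcongr
        have h10 : c n * y ≤ K * (c n * y * B) := by
          have : 1 ≤ K * B := one_le_mul_of_one_le_of_one_le hK hB1
          calc c n * y ≤ (c n * y) * (K * B) := le_mul_of_one_le_right hcy this
            _ = _ := by ring
        have h11 : c n * y * B ≤ K * (c n * y * B) := le_mul_of_one_le_left (by positivity) hK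
        have e4 : A * (3 / 4 * c n + L * ε n) * y = 3 * (K * (c n * y * B)) + L * ε n * (A * y) := by
          rw [hA]; ring
        rw [e4]
        linarith
      · have h1 := hI s t hst
        have ht0 : 0 ≤ t := hs.trans hst
        have h2 := hexp1 t ht0
        have h4 : 1 ≤ Real.exp (μ * (t - s)) :=
          Real.one_le_exp (mul_nonneg hμ0.le (by linarith))
        set y := Real.exp (lam * t)
        set w := Real.exp (μ * (t - s))
        have e1 : A * c n * (y / lam) = c n * y / (4 * K) := by rw [hlam]; field_simp
        have e2 : c n * y * (w / μ) = c n * y * w / (4 * K) := by rw [hμ]; field_simp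
        rw [e1, e2] at h1
        have h5 := mul_le_mul_of_nonneg_left h1 hK0.le
        refine h5.trans ?_
        have e3 : K * (ε n * (t - s) + c n * y / (4 * K) + c n * y * w / (4 * K))
          = K * (t - s) * ε n + c n * y / 4 + c n * y * w / 4 := by field_simp
        rw [e3, hcs]
        have hcy : 0 ≤ c n * y := by positivity
        have h6 : c n * y ≤ c n * y * w := le_mul_of_one_le_right hcy h4
        have h7 : K * (t - s) * ε n ≤ L * ε n * (y * w) := by
          have : K * (t - s) ≤ L := by
            have : K * (t - s) ≤ K * (1 + T) := by gcongr; linarith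
            have : 0 ≤ A * X + B * X := by positivity
            linarith
          calc K * (t - s) * ε n ≤ L * ε n := by gcongr
            _ ≤ L * ε n * (y * w) :=
              le_mul_of_one_le_right (by positivity) (one_le_mul_of_one_le_of_one_le h2 h4)
        have h8 : 0 ≤ c n * y * w := by positivity
        have e4 : (3 / 4 * c n + L * ε n) * y * w = 3 / 4 * (c n * y * w) + L * ε n * (y * w) := by
          ring
        rw [e4]
        linarith
  refine ⟨c, rfl, hcs, fun n => ⟨hc n, fun t ht => ((main n).1 t ht).trans ?_,
    fun i s t hs hst htT => ((main n).2 i s t hs hst htT).trans ?_⟩⟩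
  · have h1 : Real.exp (lam * t) ≤ X := Real.exp_le_exp.2 (mul_le_mul_of_nonneg_left ht.2 hlam0.le)
    have h2 : A * X ≤ L := by
      have : 0 ≤ B * X + K * (1 + T) := by positivity
      linarith
    have := hc n
    calc A * c n * Real.exp (lam * t) ≤ A * c n * X := by gcongr
      _ = A * X * c n := by ring
      _ ≤ L * c n := by gcongr
  · have h1 : Real.exp (lam * t) ≤ X := Real.exp_le_exp.2 (mul_le_mul_of_nonneg_left htT hlam0.le)
    have h3 : Real.exp (μ * (t - s)) ≤ B :=
      Real.exp_le_exp.2 (mul_le_mul_of_nonneg_left (by linarith) hμ0.le)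
    have h2 : B * X ≤ L := by
      have : 0 ≤ A * X + K * (1 + T) := by positivity
      linarith
    have := hc n
    calc c n * Real.exp (lam * t) * Real.exp (μ * (t - s)) ≤ c n * X * B := by gcongr
      _ = B * X * c n := by ring
      _ ≤ L * c n := by gcongr

/-! ### An approximation scheme for the mean field and the backward characteristics -/

/-- The estimate is affine in the bounds `U` and `V` of the top derivatives, while lower orders
enter only the constant through `D`. The index `L` provides one constant for all orders up to `L`.
-/
theorem abs_iteratedDerivWithin_mul_comp_le {J : Set ℝ} (hJ : IsOpen J) {z : ℝ} (hz : z ∈ J)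
    {L j n : ℕ} (hjL : j ≤ L) (hjn : j ≤ n) {g u v : ℝ → ℝ} (hg : ContDiff ℝ n g)
    (hu : ContDiffOn ℝ n u J) (hv : ContDiffOn ℝ n v J) {G D U V : ℝ} (hG : 1 ≤ G) (hD : 1 ≤ D)
    (hV0 : 0 ≤ V) (hgG : ∀ i ≤ j, |iteratedDeriv i g (v z)| ≤ G)
    (huD : ∀ i < j, |iteratedDerivWithin i u J z| ≤ D)
    (hvD : ∀ i, 1 ≤ i → i < j → |iteratedDerivWithin i v J z| ≤ D)
    (hU : |iteratedDerivWithin j u J z| ≤ U)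
    (hV : 1 ≤ j → |iteratedDerivWithin j v J z| ≤ V) :
    |iteratedDerivWithin j (fun z => u z * g (v z)) J z|
      ≤ 2 ^ (L + 2) * (L.factorial * G * D ^ (L + 2)) * (1 + U + V) := by
  have hU0 : 0 ≤ U := (abs_nonneg _).trans hU
  have hf1 : (1 : ℝ) ≤ L.factorial := by exact_mod_cast L.factorial_pos
  have h2L : (1 : ℝ) ≤ 2 ^ L := one_le_pow₀ (by norm_num)
  set P : ℝ := L.factorial * G * D ^ L with hP
  have hDL : 1 ≤ D ^ L := one_le_pow₀ hD
  have hGP : G ≤ P := by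
    rw [hP]
    calc G = 1 * G * 1 := by ring
      _ ≤ L.factorial * G * D ^ L := by gcongr
  have hP1 : 1 ≤ P := hG.trans hGP
  have hK : (2 : ℝ) ^ (L + 2) * (L.factorial * G * D ^ (L + 2)) = 4 * 2 ^ L * P * D ^ 2 := by
    rw [hP]; ring
  rw [hK]
  have hD2 : 1 ≤ D ^ 2 := one_le_pow₀ hD
  rcases j with _ | j
  · simp only [iteratedDerivWithin_zero, abs_mul] at hU ⊢
    have h1 := hgG 0 le_rfl
    rw [iteratedDeriv_zero] at h1
    calc |u z| * |g (v z)| ≤ U * P := by gcongr; exact h1.trans hGP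
      _ = 1 * P * 1 * U := by ring
      _ ≤ (4 * 2 ^ L) * P * D ^ 2 * (1 + U + V) := by
        gcongr
        · linarith
        · linarith
  · have hPj : ∀ i, 1 ≤ i → i ≤ j → |iteratedDerivWithin i (fun z => g (v z)) J z| ≤ P := by
      intro i h1 hi
      refine (abs_iteratedDerivWithin_comp_le hJ hz (n := n) (by omega) hg hv hD
        (fun m hm => hgG m (by omega)) (fun m hm1 hm => hvD m hm1 (by omega))).trans ?_
      rw [hP]
      gcongr
      · omega
      · omega
    have h1 := abs_iteratedDerivWithin_mul_le hJ hz (n := n) (l := j) hjn hu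
      (hg.comp_contDiffOn hv) (P := D) (E := P) (by linarith)
      (fun i _ hi => huD i (by omega)) hPj
    have h2 := abs_iteratedDerivWithin_comp_succ_le hJ hz (n := n) (l := j) hjn hg hv (G := G)
      (D := D) (E := D) hD (by linarith) le_rfl hgG (fun i h1 hi => hvD i h1 (by omega))
    have h3 := huD 0 (by omega)
    rw [iteratedDerivWithin_zero] at h3
    have h4 := hgG 0 (by omega)
    rw [iteratedDeriv_zero] at h4
    have h5 : (2 : ℝ) ^ j * (j.factorial * G * D ^ j) * D ≤ 2 ^ L * P * D := by
      rw [hP]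
      gcongr
      · norm_num
      · omega
      · omega
      · omega
    have h6 : (2 : ℝ) ^ (j + 1) * |D| * P ≤ 2 ^ L * D * P := by
      rw [abs_of_pos (by linarith)]
      gcongr
      norm_num
    refine h1.trans ?_
    have h7 := hV (by omega)
    calc |u z| * |iteratedDerivWithin (j + 1) (fun z => g (v z)) J z|
          + |iteratedDerivWithin (j + 1) u J z| * |g (v z)| + 2 ^ (j + 1) * |D| * P
        ≤ D * (G * V + 2 ^ L * P * D) + U * G + 2 ^ L * D * P := by
          gcongr
          refine h2.trans (add_le_add ?_ h5)
          gcongr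
      _ = (D * 1 * 1) * G * V + 1 * 2 ^ L * P * D ^ 2 * 1 + 1 * 1 * 1 * G * 1 * U
          + 2 ^ L * P * (D * 1) := by ring
      _ ≤ (D * D * 2 ^ L) * P * V + 2 * 2 ^ L * P * D ^ 2 * 1 + 1 * 1 * 2 ^ L * P * D ^ 2 * U
          + 2 ^ L * P * (D * D) := by
          gcongr
          norm_num
      _ ≤ _ := by
        have a1 : 0 ≤ 2 ^ L * P * D ^ 2 := by positivity
        nlinarith [mul_nonneg a1 hU0, mul_nonneg a1 hV0]

/-- Moving the variable endpoints into an indicator reduces the claim to measurability of a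
parametric integral over the whole line. -/
theorem measurable_setIntegral_Ioc {X : Type*} [MeasurableSpace X] {F : X → ℝ → ℝ} {s t : X → ℝ}
    (hF : Measurable (Function.uncurry F)) (hs : Measurable s) (ht : Measurable t) :
    Measurable fun x => ∫ r in Ioc (s x) (t x), F x r := by
  have h1 : ∀ x, ∫ r in Ioc (s x) (t x), F x r
      = ∫ r, {p : X × ℝ | s p.1 < p.2 ∧ p.2 ≤ t p.1}.indicator (Function.uncurry F) (x, r) := by
    intro x
    rw [← integral_indicator measurableSet_Ioc]
    rfl
  simp only [h1]
  have hS : MeasurableSet {p : X × ℝ | s p.1 < p.2 ∧ p.2 ≤ t p.1} :=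
    (measurableSet_lt (hs.comp measurable_fst) measurable_snd).inter
      (measurableSet_le measurable_snd (ht.comp measurable_fst))
  exact ((hF.indicator hS).stronglyMeasurable.integral_prod_right').measurable

/-- The constant `B` serves only to differentiate under the integral. The quantitative bound uses a
majorant at the single point `z`. -/
theorem contDiffOn_setIntegral_Ioc {J : Set ℝ} (hJ : IsOpen J) {n : ℕ} {u : ℝ → ℝ → ℝ} {s t : ℝ}
    (hst : s ≤ t) (hmeas : ∀ z ∈ J, Measurable (u · z))
    (hu : ∀ r ∈ Ioc s t, ContDiffOn ℝ n (u r) J)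
    (hb : ∃ B, ∀ l ≤ n, ∀ r ∈ Ioc s t, ∀ z ∈ J, |iteratedDerivWithin l (u r) J z| ≤ B) :
    ContDiffOn ℝ n (fun z => ∫ r in Ioc s t, u r z) J ∧
    ∀ l ≤ n, ∀ z ∈ J, ∀ β : ℝ → ℝ, Continuous β →
      (∀ r ∈ Ioc s t, |iteratedDerivWithin l (u r) J z| ≤ β r) →
      |iteratedDerivWithin l (fun z => ∫ r in Ioc s t, u r z) J z| ≤ ∫ r in s..t, β r := by
  obtain ⟨B, hB⟩ := hb
  have h := contDiffOn_integral (μ := volume.restrict (Ioc s t)) hJ (n := n) (u := u)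
    (fun z hz => (hmeas z hz).aestronglyMeasurable)
    (ae_restrict_of_forall_mem measurableSet_Ioc hu)
    (fun l hl => ⟨B, ae_restrict_of_forall_mem measurableSet_Ioc (hB l hl)⟩)
  refine ⟨h.1, fun l hl z hz β hβ hle => ?_⟩
  rw [(h.2 l hl z hz).2, intervalIntegral.integral_of_le hst, ← Real.norm_eq_abs]
  refine norm_integral_le_of_norm_le ?_ (ae_restrict_of_forall_mem measurableSet_Ioc hle)
  exact (hβ.integrableOn_Icc).mono_set Ioc_subset_Icc_self

/-- The state of the scheme: a mean field `σ(t, z)`, and angles `Y(s, t, θ, ν, z)` at time `s` of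
the characteristics that pass through `θ` at time `t`. -/
structure IsState (k : ℕ) (T : ℝ) (J : Set ℝ) (σ : ℝ → ℝ → ℝ) (Y : ℝ → ℝ → ℝ → ℝ → ℝ → ℝ) :
    Prop where
  measurable_field : Measurable fun x : ℝ × ℝ => σ x.1 x.2
  measurable_angle :
    Measurable fun x : ℝ × ℝ × ℝ × ℝ × ℝ => Y x.1 x.2.1 x.2.2.1 x.2.2.2.1 x.2.2.2.2
  contDiffOn_field : ∀ t ∈ Icc 0 T, ContDiffOn ℝ k (σ t) J
  contDiffOn_angle : ∀ s t θ ν, 0 ≤ s → s ≤ t → t ≤ T → ContDiffOn ℝ k (Y s t θ ν) J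
  bound_field : ∃ B, ∀ j ≤ k, ∀ t ∈ Icc 0 T, ∀ z ∈ J, |iteratedDerivWithin j (σ t) J z| ≤ B
  bound_angle : ∃ B, ∀ j, 1 ≤ j → j ≤ k → ∀ s t θ ν, 0 ≤ s → s ≤ t → t ≤ T → ∀ z ∈ J,
    |iteratedDerivWithin j (Y s t θ ν) J z| ≤ B

/-- Bounds at the point `z` for the derivatives of order `< l` of a state. -/
def LowerBound (T : ℝ) (J : Set ℝ) (σ : ℝ → ℝ → ℝ) (Y : ℝ → ℝ → ℝ → ℝ → ℝ → ℝ) (l : ℕ) (D z : ℝ) :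
    Prop :=
  (∀ j < l, ∀ t ∈ Icc 0 T, |iteratedDerivWithin j (σ t) J z| ≤ D) ∧
  ∀ j, 1 ≤ j → j < l → ∀ s t θ ν, 0 ≤ s → s ≤ t → t ≤ T →
    |iteratedDerivWithin j (Y s t θ ν) J z| ≤ D

/-- The constant in the estimate for `∂^l (u · (g ∘ v))`. -/
noncomputable def mulCompConst (l : ℕ) (G D : ℝ) : ℝ :=
  2 ^ (l + 2) * (l.factorial * G * D ^ (l + 2))

theorem one_le_mulCompConst (l : ℕ) {G D : ℝ} (hG : 1 ≤ G) (hD : 1 ≤ D) :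
    1 ≤ mulCompConst l G D := by
  have hf1 : (1 : ℝ) ≤ l.factorial := by exact_mod_cast l.factorial_pos
  unfold mulCompConst
  have h1 : (1 : ℝ) ≤ 2 ^ (l + 2) := one_le_pow₀ (by norm_num)
  have h2 : 1 ≤ D ^ (l + 2) := one_le_pow₀ hD
  exact one_le_mul_of_one_le_of_one_le h1
    (one_le_mul_of_one_le_of_one_le (one_le_mul_of_one_le_of_one_le hf1 hG) h2)

/-- The time integral of `σ g(Y)` along characteristics. -/
noncomputable def charIntegral (g : ℝ → ℝ) (σ : ℝ → ℝ → ℝ) (Y : ℝ → ℝ → ℝ → ℝ → ℝ → ℝ)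
    (s t θ ν z : ℝ) : ℝ :=
  ∫ r in Ioc s t, σ r z * g (Y r t θ ν z)

/-! ### Time integrals along the characteristics of a state. -/

section State

variable {k : ℕ} {T : ℝ} {J : Set ℝ} {σ : ℝ → ℝ → ℝ} {Y : ℝ → ℝ → ℝ → ℝ → ℝ → ℝ} {g : ℝ → ℝ}

theorem IsState.abs_iteratedDerivWithin_mul_comp_le (h : IsState k T J σ Y) (hJ : IsOpen J)
    (hg : ContDiff ℝ k g) (hg1 : ∀ i x, |iteratedDeriv i g x| ≤ 1) {l L : ℕ} (hl : l ≤ k)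
    (hlL : l ≤ L) {D : ℝ} (hD : 1 ≤ D) {z : ℝ} (hz : z ∈ J) (hlow : LowerBound T J σ Y l D z)
    {r t θ ν U V : ℝ} (hr : 0 ≤ r) (hrt : r ≤ t) (ht : t ≤ T) (hV0 : 0 ≤ V)
    (hU : |iteratedDerivWithin l (σ r) J z| ≤ U)
    (hV : 1 ≤ l → |iteratedDerivWithin l (Y r t θ ν) J z| ≤ V) :
    |iteratedDerivWithin l (fun z => σ r z * g (Y r t θ ν z)) J z|
      ≤ mulCompConst L 1 D * (1 + U + V) :=
  Winfree.abs_iteratedDerivWithin_mul_comp_le hJ hz hlL hl hg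
    (h.contDiffOn_field r ⟨hr, hrt.trans ht⟩) (h.contDiffOn_angle r t θ ν hr hrt ht) le_rfl hD hV0
    (fun i _ => hg1 i _) (fun i hi => hlow.1 i hi r ⟨hr, hrt.trans ht⟩)
    (fun i h1 hi => hlow.2 i h1 hi r t θ ν hr hrt ht) hU hV

/-- This `D` depends on the state and serves only qualitative purposes. The uniform bounds come from
`exists_scheme_bound`. -/
theorem IsState.exists_lowerBound (h : IsState k T J σ Y) :
    ∃ D, 1 ≤ D ∧ ∀ z ∈ J, LowerBound T J σ Y (k + 1) D z := by
  obtain ⟨B₁, h₁⟩ := h.bound_field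
  obtain ⟨B₂, h₂⟩ := h.bound_angle
  refine ⟨1 + |B₁| + |B₂|, by linarith [abs_nonneg B₁, abs_nonneg B₂], fun z hz => ⟨?_, ?_⟩⟩
  · intro j hj t ht
    refine (h₁ j (by omega) t ht z hz).trans ?_
    linarith [le_abs_self B₁, abs_nonneg B₂]
  · intro j h1 hj s t θ ν hs hst ht
    refine (h₂ j h1 (by omega) s t θ ν hs hst ht z hz).trans ?_
    linarith [le_abs_self B₂, abs_nonneg B₁]

theorem LowerBound.mono {l l' : ℕ} {D z : ℝ} (h : LowerBound T J σ Y l D z) (hl : l' ≤ l) :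
    LowerBound T J σ Y l' D z :=
  ⟨fun j hj => h.1 j (by omega), fun j h1 hj => h.2 j h1 (by omega)⟩

theorem LowerBound.mono_right {l : ℕ} {D D' z : ℝ} (h : LowerBound T J σ Y l D z) (hD : D ≤ D') :
    LowerBound T J σ Y l D' z :=
  ⟨fun j hj t ht => (h.1 j hj t ht).trans hD,
    fun j h1 hj s t θ ν hs hst ht => (h.2 j h1 hj s t θ ν hs hst ht).trans hD⟩

theorem IsState.exists_bound_mul_comp (h : IsState k T J σ Y) (hJ : IsOpen J)
    (hg : ContDiff ℝ k g) (hg1 : ∀ i x, |iteratedDeriv i g x| ≤ 1) :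
    ∃ B, 0 ≤ B ∧ ∀ l ≤ k, ∀ r t θ ν, 0 ≤ r → r ≤ t → t ≤ T → ∀ z ∈ J,
      |iteratedDerivWithin l (fun z => σ r z * g (Y r t θ ν z)) J z| ≤ B := by
  obtain ⟨D, hD, hlow⟩ := h.exists_lowerBound
  have hK := one_le_mulCompConst k le_rfl hD
  refine ⟨mulCompConst k 1 D * (1 + D + D), mul_nonneg (by linarith) (by linarith),
    fun l hl r t θ ν hr hrt ht z hz => ?_⟩
  exact h.abs_iteratedDerivWithin_mul_comp_le hJ hg hg1 hl hl hD hz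
    ((hlow z hz).mono (by omega)) hr hrt ht (by linarith)
    ((hlow z hz).1 l (by omega) r ⟨hr, hrt.trans ht⟩)
    (fun h1 => (hlow z hz).2 l h1 (by omega) r t θ ν hr hrt ht)

theorem IsState.measurable_charIntegrand (h : IsState k T J σ Y) (hg : Continuous g) :
    Measurable (Function.uncurry fun (x : ℝ × ℝ × ℝ × ℝ × ℝ) (r : ℝ) =>
      σ r x.2.2.2.2 * g (Y r x.2.1 x.2.2.1 x.2.2.2.1 x.2.2.2.2)) := by
  refine Measurable.mul ?_ (hg.measurable.comp ?_)
  · exact h.measurable_field.comp (f := fun p : (ℝ × ℝ × ℝ × ℝ × ℝ) × ℝ => (p.2, p.1.2.2.2.2))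
      (by fun_prop)
  · exact h.measurable_angle.comp
      (f := fun p : (ℝ × ℝ × ℝ × ℝ × ℝ) × ℝ => (p.2, p.1.2)) (by fun_prop)

theorem IsState.measurable_charIntegral (h : IsState k T J σ Y) (hg : Continuous g) :
    Measurable fun x : ℝ × ℝ × ℝ × ℝ × ℝ =>
      charIntegral g σ Y x.1 x.2.1 x.2.2.1 x.2.2.2.1 x.2.2.2.2 :=
  measurable_setIntegral_Ioc (h.measurable_charIntegrand hg) measurable_fst
    (by fun_prop)

theorem IsState.contDiffOn_charIntegral (h : IsState k T J σ Y) (hJ : IsOpen J)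
    (hg : ContDiff ℝ k g) (hg1 : ∀ i x, |iteratedDeriv i g x| ≤ 1) {s t : ℝ} (hs : 0 ≤ s)
    (hst : s ≤ t) (ht : t ≤ T) (θ ν : ℝ) :
    ContDiffOn ℝ k (charIntegral g σ Y s t θ ν) J ∧
    ∀ l ≤ k, ∀ z ∈ J, ∀ β : ℝ → ℝ, Continuous β → (∀ r ∈ Ioc s t,
      |iteratedDerivWithin l (fun z => σ r z * g (Y r t θ ν z)) J z| ≤ β r) →
      |iteratedDerivWithin l (charIntegral g σ Y s t θ ν) J z| ≤ ∫ r in s..t, β r := by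
  obtain ⟨B, _, hB⟩ := h.exists_bound_mul_comp hJ hg hg1
  refine contDiffOn_setIntegral_Ioc hJ hst (fun z _ => ?_) (fun r hr => ?_)
    ⟨B, fun l hl r hr z hz => hB l hl r t θ ν (hs.trans hr.1.le) hr.2 ht z hz⟩
  · exact (h.measurable_charIntegrand hg.continuous).comp
      (f := fun r => ((s, t, θ, ν, z), r)) (by fun_prop)
  · exact (h.contDiffOn_field r ⟨hs.trans hr.1.le, hr.2.trans ht⟩).mul
      (hg.comp_contDiffOn (h.contDiffOn_angle r t θ ν (hs.trans hr.1.le) hr.2 ht))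

theorem IsState.exists_bound_charIntegral (h : IsState k T J σ Y) (hJ : IsOpen J) (hT : 0 ≤ T)
    (hg : ContDiff ℝ k g) (hg1 : ∀ i x, |iteratedDeriv i g x| ≤ 1) :
    ∃ B, 1 ≤ B ∧ ∀ l ≤ k, ∀ s t θ ν, 0 ≤ s → s ≤ t → t ≤ T → ∀ z ∈ J,
      |iteratedDerivWithin l (charIntegral g σ Y s t θ ν) J z| ≤ B := by
  obtain ⟨B, hB0, hB⟩ := h.exists_bound_mul_comp hJ hg hg1
  refine ⟨1 + B * T, by nlinarith, fun l hl s t θ ν hs hst ht z hz => ?_⟩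
  refine ((h.contDiffOn_charIntegral hJ hg hg1 hs hst ht θ ν).2 l hl z hz (fun _ => B)
    continuous_const fun r hr => hB l hl r t θ ν (hs.trans hr.1.le) hr.2 ht z hz).trans ?_
  rw [intervalIntegral.integral_const, smul_eq_mul]
  nlinarith

theorem IsState.abs_iteratedDerivWithin_charIntegral_le (h : IsState k T J σ Y) (hJ : IsOpen J)
    (hg : ContDiff ℝ k g) (hg1 : ∀ i x, |iteratedDeriv i g x| ≤ 1) {l L : ℕ} (hl : l ≤ k)
    (hlL : l ≤ L) {D : ℝ} (hD : 1 ≤ D) {z : ℝ} (hz : z ∈ J) (hlow : LowerBound T J σ Y l D z)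
    {α : ℝ → ℝ} {β : ℝ → ℝ → ℝ} (hα : Continuous α) (hβ : ∀ t, Continuous fun r => β r t)
    (hβ0 : ∀ r t, 0 ≤ β r t)
    (hU : ∀ t ∈ Icc 0 T, |iteratedDerivWithin l (σ t) J z| ≤ α t)
    (hV : 1 ≤ l → ∀ s t θ ν, 0 ≤ s → s ≤ t → t ≤ T →
      |iteratedDerivWithin l (Y s t θ ν) J z| ≤ β s t)
    {s t : ℝ} (hs : 0 ≤ s) (hst : s ≤ t) (ht : t ≤ T) (θ ν : ℝ) :
    |iteratedDerivWithin l (charIntegral g σ Y s t θ ν) J z|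
      ≤ mulCompConst L 1 D * ∫ r in s..t, (1 + α r + β r t) := by
  rw [← intervalIntegral.integral_const_mul]
  have := hβ t
  refine (h.contDiffOn_charIntegral hJ hg hg1 hs hst ht θ ν).2 l hl z hz _ (by fun_prop) ?_
  intro r hr
  exact h.abs_iteratedDerivWithin_mul_comp_le hJ hg hg1 hl hlL hD hz hlow (hs.trans hr.1.le) hr.2
    ht (hβ0 r t) (hU r ⟨hs.trans hr.1.le, hr.2.trans ht⟩)
    (fun h1 => hV h1 r t θ ν (hs.trans hr.1.le) hr.2 ht)

end State

instance : IsFiniteMeasure torus := by unfold torus; infer_instance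

/-- The number 7 replaces the length $2\pi$ of a period in all later constants. -/
theorem torus_real_univ_le : torus.real univ ≤ 7 := by
  have : torus.real univ = 2 * Real.pi := by
    simp [torus, Measure.real, Real.pi_pos.le]
  rw [this]
  linarith [Real.pi_lt_d2]

theorem IsProbDensity.isProbabilityMeasure {μ : Measure ℝ} {h : ℝ → ℝ} (hh : IsProbDensity μ h) :
    IsProbabilityMeasure (μ.withDensity fun x => ENNReal.ofReal (h x)) :=
  ⟨by rw [withDensity_apply _ MeasurableSet.univ, Measure.restrict_univ, hh.mass]⟩

/-- The density that is transported along the characteristics of a state, for the initial datum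
`φ` and the Jacobian factor `η(∫ σ cos Y)`. -/
noncomputable def density (φ : ℝ → ℝ → ℝ) (η : ℝ → ℝ) (σ : ℝ → ℝ → ℝ)
    (Y : ℝ → ℝ → ℝ → ℝ → ℝ → ℝ) (t θ ν z : ℝ) : ℝ :=
  φ (Y 0 t θ ν z) ν * η (charIntegral Real.cos σ Y 0 t θ ν z)

/-- The mean field that is generated by the density of a state. -/
noncomputable def nextField (κ : ℝ) (g : ℝ → ℝ) (φ : ℝ → ℝ → ℝ) (η : ℝ → ℝ) (σ : ℝ → ℝ → ℝ)
    (Y : ℝ → ℝ → ℝ → ℝ → ℝ → ℝ) (t z : ℝ) : ℝ :=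
  κ * ∫ x : ℝ × ℝ, influence x.1 (max z 1) * density φ η σ Y t x.1 x.2 z ∂(torus.prod (freqLaw g))

/-- One Picard step for the characteristic equation. -/
noncomputable def nextAngle (σ : ℝ → ℝ → ℝ) (Y : ℝ → ℝ → ℝ → ℝ → ℝ → ℝ)
    (s t θ ν z : ℝ) : ℝ :=
  θ - ν * (t - s) + charIntegral Real.sin σ Y s t θ ν z

/-- The data of the scheme, with all relevant quantities bounded by the constant `A`. -/
structure IsSchemeData (k : ℕ) (A T κ : ℝ) (g : ℝ → ℝ) (φ : ℕ → ℝ → ℝ → ℝ) (η : ℝ → ℝ)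
    (J : Set ℝ) : Prop where
  prob : IsProbDensity volume g
  isOpen : IsOpen J
  subset : J ⊆ Ioi 1
  one_le : 1 ≤ A
  time_nonneg : 0 ≤ T
  time_le : T ≤ A
  coupling_nonneg : 0 ≤ κ
  coupling_le : κ ≤ A
  influence_le : ∀ l ≤ k, ∀ θ, ∀ z ∈ J, |iteratedDeriv l (influence θ) z| ≤ A
  measurable_datum : ∀ n, Measurable fun x : ℝ × ℝ => φ n x.1 x.2
  contDiff_datum : ∀ n ν, ContDiff ℝ k fun θ => φ n θ ν
  datum_le : ∀ n ν, ∀ j ≤ k, ∀ θ, |iteratedDeriv j (fun θ => φ n θ ν) θ| ≤ A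
  contDiff_cutoff : ContDiff ℝ k η
  cutoff_le : ∀ j ≤ k, ∀ x, |iteratedDeriv j η x| ≤ A

/-- The constant in the estimate of the integrand of the mean field. -/
noncomputable def fieldConst (l : ℕ) (A D : ℝ) : ℝ :=
  mulCompConst l A (mulCompConst l A D * (1 + A + D) + mulCompConst l 1 D * (A * (1 + D + D)))
    * (1 + mulCompConst l A D * (1 + A) + mulCompConst l 1 D)

theorem one_le_fieldConst (l : ℕ) {A D : ℝ} (hA : 1 ≤ A) (hD : 1 ≤ D) : 1 ≤ fieldConst l A D := by
  have h1 := one_le_mulCompConst l hA hD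
  have h2 := one_le_mulCompConst l le_rfl hD
  have h3 := one_le_mul_of_one_le_of_one_le h1 (by linarith : 1 ≤ 1 + A + D)
  have h4 := one_le_mul_of_one_le_of_one_le h2
    (one_le_mul_of_one_le_of_one_le hA (by linarith : 1 ≤ 1 + D + D))
  have h5 := one_le_mul_of_one_le_of_one_le h1 (by linarith : 1 ≤ 1 + A)
  exact one_le_mul_of_one_le_of_one_le (one_le_mulCompConst l hA (by linarith)) (by linarith)

/-! ### One step of the scheme. -/

section Step

variable {k : ℕ} {A T κ : ℝ} {g : ℝ → ℝ} {φ : ℕ → ℝ → ℝ → ℝ} {η : ℝ → ℝ} {J : Set ℝ}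
  {σ : ℝ → ℝ → ℝ} {Y : ℝ → ℝ → ℝ → ℝ → ℝ → ℝ}

theorem IsSchemeData.iteratedDerivWithin_influence (d : IsSchemeData k A T κ g φ η J) (l : ℕ)
    (θ : ℝ) {z : ℝ} (hz : z ∈ J) :
    iteratedDerivWithin l (fun z => influence θ (max z 1)) J z = iteratedDeriv l (influence θ) z := by
  have h : EqOn (fun z => influence θ (max z 1)) (influence θ) J := fun y hy => by
    simp only [max_eq_left (mem_Ioi.1 (d.subset hy)).le]
  rw [iteratedDerivWithin_congr h hz, iteratedDerivWithin_of_isOpen d.isOpen hz]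

theorem IsSchemeData.contDiffOn_influence (d : IsSchemeData k A T κ g φ η J) (θ : ℝ) :
    ContDiffOn ℝ k (fun z => influence θ (max z 1)) J := by
  have h : EqOn (fun z => influence θ (max z 1)) (influence θ) J := fun y hy => by
    simp only [max_eq_left (mem_Ioi.1 (d.subset hy)).le]
  refine ContDiffOn.congr ?_ h
  exact ((Winfree.contDiffOn_influence θ).of_le (by exact_mod_cast le_top)).mono fun y hy =>
    lt_trans one_pos (mem_Ioi.1 (d.subset hy))

/-- The integrand is the product of $I\,\varphi(Y)$ and $\eta(Q)$ with $Q=\int\sigma\cos Y$, and the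
product–composition estimate is applied to each layer. The datum at the foot of the characteristic
produces `β 0 t`, outside any integral, and the Jacobian factor produces the time integral. -/
theorem IsState.abs_iteratedDerivWithin_integrand_le (h : IsState k T J σ Y)
    (d : IsSchemeData k A T κ g φ η J) (n : ℕ) {l L : ℕ} (hl : l ≤ k) (hlL : l ≤ L) {D : ℝ}
    (hAD : A ≤ D) {z : ℝ} (hz : z ∈ J) (hlow : LowerBound T J σ Y l D z)
    {α : ℝ → ℝ} {β : ℝ → ℝ → ℝ} (hα : Continuous α) (hβ : ∀ t, Continuous fun r => β r t)
    (hα0 : ∀ t, 0 ≤ α t) (hβ0 : ∀ r t, 0 ≤ β r t)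
    (hU : ∀ t ∈ Icc 0 T, |iteratedDerivWithin l (σ t) J z| ≤ α t)
    (hV : 1 ≤ l → ∀ s t θ ν, 0 ≤ s → s ≤ t → t ≤ T →
      |iteratedDerivWithin l (Y s t θ ν) J z| ≤ β s t)
    {t : ℝ} (ht : t ∈ Icc 0 T) (θ ν : ℝ) :
    |iteratedDerivWithin l (fun z => influence θ (max z 1) * density (φ n) η σ Y t θ ν z) J z|
      ≤ fieldConst L A D * (1 + β 0 t + ∫ r in (0 : ℝ)..t, (1 + α r + β r t)) := by
  have hcos : ∀ i x, |iteratedDeriv i Real.cos x| ≤ 1 := Real.abs_iteratedDeriv_cos_le_one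
  have hA := d.one_le
  have hD := hA.trans hAD
  have hYc := h.contDiffOn_angle 0 t θ ν le_rfl ht.1 ht.2
  set K₁ := mulCompConst L 1 D with hK₁
  set K₂ := mulCompConst L A D with hK₂
  have h1K₁ : 1 ≤ K₁ := one_le_mulCompConst L le_rfl hD
  have h1K₂ : 1 ≤ K₂ := one_le_mulCompConst L hA hD
  set D₃ := K₂ * (1 + A + D) + K₁ * (A * (1 + D + D)) with hD₃
  have ha1 : 1 ≤ K₂ * (1 + A + D) := one_le_mul_of_one_le_of_one_le h1K₂ (by linarith)
  have ha2 : 1 ≤ K₁ * (A * (1 + D + D)) := one_le_mul_of_one_le_of_one_le h1K₁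
    (one_le_mul_of_one_le_of_one_le hA (by linarith))
  have hD₃1 : 1 ≤ D₃ := by linarith
  -- the product of the influence function and the datum
  have hu : ∀ j ≤ l, ∀ V, 0 ≤ V → (1 ≤ j → |iteratedDerivWithin j (Y 0 t θ ν) J z| ≤ V) →
      |iteratedDerivWithin j (fun z => influence θ (max z 1) * φ n (Y 0 t θ ν z) ν) J z|
        ≤ K₂ * (1 + A + V) := by
    intro j hj V hV0 hjV
    refine Winfree.abs_iteratedDerivWithin_mul_comp_le d.isOpen hz (hj.trans hlL) (hj.trans hl)
      (d.contDiff_datum n ν) (d.contDiffOn_influence θ) hYc hA hD hV0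
      (fun i hi => d.datum_le n ν i (by omega) _) ?_
      (fun i h1 hi => hlow.2 i h1 (by omega) 0 t θ ν le_rfl ht.1 ht.2) ?_ hjV
    · intro i hi
      rw [d.iteratedDerivWithin_influence i θ hz]
      exact (d.influence_le i (by omega) θ z hz).trans hAD
    · rw [d.iteratedDerivWithin_influence j θ hz]
      exact d.influence_le j (by omega) θ z hz
  have huc : ContDiffOn ℝ k (fun z => influence θ (max z 1) * φ n (Y 0 t θ ν z) ν) J :=
    (d.contDiffOn_influence θ).mul ((d.contDiff_datum n ν).comp_contDiffOn hYc)
  -- Below the top order the exponent is bounded by a constant, because the time horizon is at most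
  -- `A`.
  have hQ : ∀ j < l, |iteratedDerivWithin j (charIntegral Real.cos σ Y 0 t θ ν) J z| ≤ D₃ := by
    intro j hj
    refine (h.abs_iteratedDerivWithin_charIntegral_le d.isOpen Real.contDiff_cos hcos
      (by omega) (by omega : j ≤ L) hD hz (hlow.mono hj.le) (α := fun _ => D) (β := fun _ _ => D)
      continuous_const (fun _ => continuous_const) (fun _ _ => by linarith)
      (fun t ht => hlow.1 j hj t ht) (fun h1 s t θ ν hs hst ht => hlow.2 j h1 hj s t θ ν hs hst ht)
      le_rfl ht.1 ht.2 θ ν).trans ?_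
    rw [intervalIntegral.integral_const, smul_eq_mul, sub_zero]
    have : t * (1 + D + D) ≤ A * (1 + D + D) := by
      have := ht.2.trans d.time_le
      gcongr
    have h3 : K₁ * (t * (1 + D + D)) ≤ K₁ * (A * (1 + D + D)) := by gcongr
    linarith
  have hfin := Winfree.abs_iteratedDerivWithin_mul_comp_le d.isOpen hz hlL hl d.contDiff_cutoff huc
    (h.contDiffOn_charIntegral d.isOpen Real.contDiff_cos hcos le_rfl ht.1 ht.2 θ ν).1 hA hD₃1
    (U := K₂ * (1 + A + β 0 t)) (V := K₁ * ∫ r in (0 : ℝ)..t, (1 + α r + β r t)) ?_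
    (fun i hi => d.cutoff_le i (by omega) _)
    (fun i hi => (hu i hi.le D (by linarith)
      (fun h1 => hlow.2 i h1 hi 0 t θ ν le_rfl ht.1 ht.2)).trans (by linarith))
    (fun i _ hi => hQ i hi)
    (hu l le_rfl _ (hβ0 0 t) (fun h1 => hV h1 0 t θ ν le_rfl ht.1 ht.2))
    (fun h1 => h.abs_iteratedDerivWithin_charIntegral_le d.isOpen Real.contDiff_cos hcos hl
      hlL hD hz hlow hα hβ hβ0 hU hV le_rfl ht.1 ht.2 θ ν)
  · have e : (fun z => influence θ (max z 1) * density (φ n) η σ Y t θ ν z) = fun z =>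
        influence θ (max z 1) * φ n (Y 0 t θ ν z) ν * η (charIntegral Real.cos σ Y 0 t θ ν z) := by
      funext z
      unfold density
      ring
    rw [e]
    refine hfin.trans ?_
    have hI : 0 ≤ ∫ r in (0 : ℝ)..t, (1 + α r + β r t) :=
      intervalIntegral.integral_nonneg ht.1 fun r _ => by linarith [hα0 r, hβ0 r t]
    set I := ∫ r in (0 : ℝ)..t, (1 + α r + β r t)
    have hK₃ : 1 ≤ mulCompConst L A D₃ := one_le_mulCompConst L hA hD₃1
    rw [fieldConst, ← hK₁, ← hK₂, ← hD₃, mul_assoc (mulCompConst L A D₃)]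
    change mulCompConst L A D₃ * _ ≤ _
    have hb := hβ0 0 t
    refine mul_le_mul_of_nonneg_left ?_ (by linarith)
    have : 0 ≤ K₂ * A * β 0 t := by positivity
    have : 0 ≤ K₂ * (1 + A) * I := by positivity
    have : 0 ≤ K₁ * β 0 t := by positivity
    have : 0 ≤ K₁ * I := by positivity
    nlinarith
  · exact mul_nonneg (by linarith) (intervalIntegral.integral_nonneg ht.1 fun r _ => by
      linarith [hα0 r, hβ0 r t])

theorem IsState.measurable_density (h : IsState k T J σ Y) (d : IsSchemeData k A T κ g φ η J)
    (n : ℕ) : Measurable fun x : ℝ × ℝ × ℝ × ℝ => density (φ n) η σ Y x.1 x.2.1 x.2.2.1 x.2.2.2 := by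
  refine Measurable.mul ?_ (d.contDiff_cutoff.continuous.measurable.comp ?_)
  · exact (d.measurable_datum n).comp (f := fun x : ℝ × ℝ × ℝ × ℝ =>
      (Y 0 x.1 x.2.1 x.2.2.1 x.2.2.2, x.2.2.1)) ((h.measurable_angle.comp
      (f := fun x : ℝ × ℝ × ℝ × ℝ => (0, x)) (by fun_prop)).prodMk (by fun_prop))
  · exact (h.measurable_charIntegral Real.continuous_cos).comp
      (f := fun x : ℝ × ℝ × ℝ × ℝ => (0, x)) (by fun_prop)

theorem IsState.measurable_integrand (h : IsState k T J σ Y) (d : IsSchemeData k A T κ g φ η J)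
    (n : ℕ) : Measurable (Function.uncurry fun (y : ℝ × ℝ) (x : ℝ × ℝ) =>
      influence x.1 (max y.2 1) * density (φ n) η σ Y y.1 x.1 x.2 y.2) := by
  refine Measurable.mul ?_ ?_
  · exact continuous_influence_max.measurable.comp
      (f := fun p : (ℝ × ℝ) × (ℝ × ℝ) => (p.2.1, p.1.2)) (by fun_prop)
  · exact (h.measurable_density d n).comp
      (f := fun p : (ℝ × ℝ) × (ℝ × ℝ) => (p.1.1, p.2.1, p.2.2, p.1.2)) (by fun_prop)

theorem IsSchemeData.abs_density_le (d : IsSchemeData k A T κ g φ η J) (n : ℕ) (t θ ν z : ℝ) :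
    |density (φ n) η σ Y t θ ν z| ≤ A * A := by
  have h1 := d.datum_le n ν 0 (Nat.zero_le _) (Y 0 t θ ν z)
  have h2 := d.cutoff_le 0 (Nat.zero_le _) (charIntegral Real.cos σ Y 0 t θ ν z)
  have := d.one_le
  rw [iteratedDeriv_zero] at h1 h2
  rw [density, abs_mul]
  gcongr

theorem torus_prod_freqLaw_real_univ_le {g : ℝ → ℝ} (hg : IsProbDensity volume g) :
    (torus.prod (freqLaw g)).real univ ≤ 7 := by
  have : IsProbabilityMeasure (freqLaw g) := hg.isProbabilityMeasure
  rw [← univ_prod_univ, measureReal_prod_prod, probReal_univ (μ := freqLaw g), mul_one]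
  exact torus_real_univ_le

/-- Data and cut-off are bounded, so the new field is bounded whatever the previous state was. This
starts the induction on the order, without Gronwall. -/
theorem IsSchemeData.abs_nextField_le (d : IsSchemeData k A T κ g φ η J) (n : ℕ) (t : ℝ) {z : ℝ}
    (hz : z ∈ J) : |nextField κ g (φ n) η σ Y t z| ≤ 7 * A ^ 4 := by
  have : IsProbabilityMeasure (freqLaw g) := d.prob.isProbabilityMeasure
  have hA := d.one_le
  have h1 := norm_integral_le_of_norm_le_const (μ := torus.prod (freqLaw g)) (C := A * (A * A))
    (f := fun x : ℝ × ℝ => influence x.1 (max z 1) * density (φ n) η σ Y t x.1 x.2 z)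
    (Filter.Eventually.of_forall fun x => by
      rw [Real.norm_eq_abs, abs_mul]
      have h2 := d.influence_le 0 (Nat.zero_le _) x.1 z hz
      rw [← d.iteratedDerivWithin_influence 0 x.1 hz, iteratedDerivWithin_zero] at h2
      have := d.abs_density_le (σ := σ) (Y := Y) n t x.1 x.2 z
      gcongr)
  rw [Real.norm_eq_abs] at h1
  rw [nextField, abs_mul, abs_of_nonneg d.coupling_nonneg]
  have h3 := torus_prod_freqLaw_real_univ_le d.prob
  calc _ ≤ A * (A * (A * A) * 7) := by
        refine mul_le_mul d.coupling_le (h1.trans ?_) (abs_nonneg _) (by linarith)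
        gcongr
    _ = 7 * A ^ 4 := by ring

/-- Differentiation under the integral. The factor `7 * A` collects the mass of the angle and
frequency space and the coupling. -/
theorem IsState.nextField_aux (h : IsState k T J σ Y) (d : IsSchemeData k A T κ g φ η J)
    (n : ℕ) {t : ℝ} (ht : t ∈ Icc 0 T) :
    ContDiffOn ℝ k (nextField κ g (φ n) η σ Y t) J ∧ ∀ l ≤ k, ∀ z ∈ J, ∀ B, (∀ θ ν,
      |iteratedDerivWithin l (fun z => influence θ (max z 1) * density (φ n) η σ Y t θ ν z) J z|
        ≤ B) → |iteratedDerivWithin l (nextField κ g (φ n) η σ Y t) J z| ≤ 7 * A * B := by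
  have : IsProbabilityMeasure (freqLaw g) := d.prob.isProbabilityMeasure
  have hA := d.one_le
  obtain ⟨D₀, hD₀, hlow₀⟩ := h.exists_lowerBound
  obtain ⟨D, hAD, hlow⟩ : ∃ D, A ≤ D ∧ ∀ z ∈ J, LowerBound T J σ Y (k + 1) D z :=
    ⟨max A D₀, le_max_left _ _, fun z hz => (hlow₀ z hz).mono_right (le_max_right _ _)⟩
  have hD : 0 ≤ D := by linarith
  have hcd : ∀ x : ℝ × ℝ, ContDiffOn ℝ k
      (fun z => influence x.1 (max z 1) * density (φ n) η σ Y t x.1 x.2 z) J := fun x =>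
    (d.contDiffOn_influence x.1).mul
      (((d.contDiff_datum n x.2).comp_contDiffOn (h.contDiffOn_angle 0 t x.1 x.2 le_rfl ht.1 ht.2)).mul
      (d.contDiff_cutoff.comp_contDiffOn (h.contDiffOn_charIntegral d.isOpen Real.contDiff_cos
        Real.abs_iteratedDeriv_cos_le_one le_rfl ht.1 ht.2 x.1 x.2).1))
  obtain ⟨h1, h2⟩ := contDiffOn_integral (μ := torus.prod (freqLaw g)) d.isOpen (n := k)
    (u := fun x z => influence x.1 (max z 1) * density (φ n) η σ Y t x.1 x.2 z)
    (fun z _ => ((h.measurable_integrand d n).comp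
      (f := fun x => ((t, z), x)) (by fun_prop)).aestronglyMeasurable)
    (Filter.Eventually.of_forall hcd)
    (fun l hl => ⟨_, Filter.Eventually.of_forall fun x z hz =>
      h.abs_iteratedDerivWithin_integrand_le d n hl hl hAD hz ((hlow z hz).mono (by omega))
        (α := fun _ => D) (β := fun _ _ => D) continuous_const (fun _ => continuous_const)
        (fun _ => hD) (fun _ _ => hD) (fun t ht => (hlow z hz).1 l (by omega) t ht)
        (fun h1 s t θ ν hs hst ht => (hlow z hz).2 l h1 (by omega) s t θ ν hs hst ht) ht x.1 x.2⟩)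
  refine ⟨contDiffOn_const.mul h1, fun l hl z hz B hB => ?_⟩
  have hB0 : 0 ≤ B := (abs_nonneg _).trans (hB 0 0)
  change |iteratedDerivWithin l (fun z => κ * ∫ x : ℝ × ℝ, influence x.1 (max z 1)
    * density (φ n) η σ Y t x.1 x.2 z ∂(torus.prod (freqLaw g))) J z| ≤ _
  rw [iteratedDerivWithin_const_mul_field, (h2 l hl z hz).2, abs_mul,
    abs_of_nonneg d.coupling_nonneg]
  have h3 := norm_integral_le_of_norm_le_const (μ := torus.prod (freqLaw g)) (C := B)
    (f := fun x : ℝ × ℝ => iteratedDerivWithin l (fun z => influence x.1 (max z 1)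
      * density (φ n) η σ Y t x.1 x.2 z) J z) (Filter.Eventually.of_forall fun x => hB x.1 x.2)
  rw [Real.norm_eq_abs] at h3
  have h4 := torus_prod_freqLaw_real_univ_le d.prob
  calc _ ≤ A * (B * 7) := by
        refine mul_le_mul d.coupling_le (h3.trans ?_) (abs_nonneg _) (by linarith)
        gcongr
    _ = 7 * A * B := by ring

theorem iteratedDerivWithin_nextAngle {l : ℕ} (hl : 1 ≤ l) (s t θ ν z : ℝ) :
    iteratedDerivWithin l (nextAngle σ Y s t θ ν) J z
      = iteratedDerivWithin l (charIntegral Real.sin σ Y s t θ ν) J z :=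
  iteratedDerivWithin_const_add hl _

theorem IsState.next (h : IsState k T J σ Y) (d : IsSchemeData k A T κ g φ η J) (n : ℕ) :
    IsState k T J (nextField κ g (φ n) η σ Y) (nextAngle σ Y) := by
  have : IsProbabilityMeasure (freqLaw g) := d.prob.isProbabilityMeasure
  have hA := d.one_le
  have hsin : ∀ i x, |iteratedDeriv i Real.sin x| ≤ 1 := Real.abs_iteratedDeriv_sin_le_one
  refine ⟨?_, ?_, fun t ht => (h.nextField_aux d n ht).1, fun s t θ ν hs hst ht =>
    contDiffOn_const.add (h.contDiffOn_charIntegral d.isOpen Real.contDiff_sin hsin hs hst ht θ ν).1,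
    ?_, ?_⟩
  · exact ((h.measurable_integrand d n).stronglyMeasurable.integral_prod_right').measurable.const_mul _
  · have := h.measurable_charIntegral Real.continuous_sin
    unfold nextAngle
    fun_prop
  · obtain ⟨D₀, hD₀, hlow₀⟩ := h.exists_lowerBound
    obtain ⟨D, hAD, hlow⟩ : ∃ D, A ≤ D ∧ ∀ z ∈ J, LowerBound T J σ Y (k + 1) D z :=
      ⟨max A D₀, le_max_left _ _, fun z hz => (hlow₀ z hz).mono_right (le_max_right _ _)⟩
    have hD : 0 ≤ D := by linarith
    refine ⟨7 * A * (fieldConst k A D * (1 + D + A * (1 + D + D))), fun l hl t ht z hz => ?_⟩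
    refine (h.nextField_aux d n ht).2 l hl z hz _ fun θ ν => ?_
    refine (h.abs_iteratedDerivWithin_integrand_le d n hl hl hAD hz ((hlow z hz).mono (by omega))
        (α := fun _ => D) (β := fun _ _ => D) continuous_const (fun _ => continuous_const)
        (fun _ => hD) (fun _ _ => hD) (fun t ht => (hlow z hz).1 l (by omega) t ht)
        (fun h1 s t θ ν hs hst ht => (hlow z hz).2 l h1 (by omega) s t θ ν hs hst ht)
        ht θ ν).trans ?_
    have h1 := one_le_fieldConst k hA (hA.trans hAD)
    rw [intervalIntegral.integral_const, smul_eq_mul, sub_zero]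
    have := ht.2.trans d.time_le
    gcongr
  · obtain ⟨B, _, hB⟩ := h.exists_bound_charIntegral d.isOpen d.time_nonneg Real.contDiff_sin hsin
    refine ⟨B, fun j h1 hj s t θ ν hs hst ht z hz => ?_⟩
    rw [iteratedDerivWithin_nextAngle h1]
    exact hB j hj s t θ ν hs hst ht z hz

end Step

/-- The scheme: it starts from the free flow, and each step recomputes the mean field and the
characteristics from the previous ones. -/
noncomputable def scheme (κ : ℝ) (g : ℝ → ℝ) (φ : ℕ → ℝ → ℝ → ℝ) (η : ℝ → ℝ) :
    ℕ → (ℝ → ℝ → ℝ) × (ℝ → ℝ → ℝ → ℝ → ℝ → ℝ)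
  | 0 => (fun _ _ => 0, fun s t θ ν _ => θ - ν * (t - s))
  | n + 1 => (nextField κ g (φ n) η (scheme κ g φ η n).1 (scheme κ g φ η n).2,
      nextAngle (scheme κ g φ η n).1 (scheme κ g φ η n).2)

/-! ### Bounds for the iterates that are uniform in the step. -/

section Scheme

variable {k : ℕ} {A T κ : ℝ} {g : ℝ → ℝ} {φ : ℕ → ℝ → ℝ → ℝ} {η : ℝ → ℝ} {J : Set ℝ}

theorem IsSchemeData.isState (d : IsSchemeData k A T κ g φ η J) (n : ℕ) :
    IsState k T J (scheme κ g φ η n).1 (scheme κ g φ η n).2 := by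
  induction n with
  | zero =>
    refine ⟨measurable_const, ?_, fun _ _ => contDiffOn_const, fun _ _ _ _ _ _ _ =>
      contDiffOn_const, ⟨0, fun j _ t _ z _ => ?_⟩, ⟨0, fun j hj _ s t θ ν _ _ _ z _ => ?_⟩⟩
    · change Measurable fun x : ℝ × ℝ × ℝ × ℝ × ℝ => x.2.2.1 - x.2.2.2.1 * (x.2.1 - x.1)
      fun_prop
    · simp [scheme]
    · simp only [scheme, iteratedDerivWithin_const, if_neg (show ¬ j = 0 by omega), abs_zero, le_refl]
  | succ n ih => exact ih.next d n

/-- Bounds for the `z`-derivatives of the scheme that depend only on the bound `A` of the data. -/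
theorem exists_scheme_bound (k : ℕ) {A T : ℝ} (hA : 1 ≤ A) (hT : 0 ≤ T) : ∀ l ≤ k + 1, ∃ D, A ≤ D ∧
    ∀ {κ : ℝ} {g : ℝ → ℝ} {φ : ℕ → ℝ → ℝ → ℝ} {η : ℝ → ℝ} {J : Set ℝ},
      IsSchemeData k A T κ g φ η J → ∀ n, ∀ z ∈ J,
        LowerBound T J (scheme κ g φ η n).1 (scheme κ g φ η n).2 l D z := by
  -- Induction on the order: once all orders below `l` are bounded by `D`, the derivatives of order
  -- `l` along the scheme obey an affine recursion, to which `iteration_bound` applies.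
  intro l
  induction l with
  | zero => exact fun _ => ⟨A, le_rfl, fun d n z hz =>
      ⟨fun j hj => absurd hj (by omega), fun j _ hj => absurd hj (by omega)⟩⟩
  | succ l ih =>
    intro hl
    obtain ⟨D, hAD, hD⟩ := ih (by omega)
    have hD1 := hA.trans hAD
    rcases Nat.eq_zero_or_pos l with rfl | hpos
    · refine ⟨7 * A ^ 4, ?_, fun d n z hz => ⟨fun j hj t ht => ?_, fun j h1 hj => absurd hj (by omega)⟩⟩
      · have : 1 ≤ A ^ 3 := one_le_pow₀ hA
        nlinarith
      · obtain rfl : j = 0 := by omega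
        rw [iteratedDerivWithin_zero]
        rcases n with _ | n
        · simp only [scheme, abs_zero]; positivity
        · exact d.abs_nextField_le n t hz
    · set K := mulCompConst l 1 D + 7 * A * fieldConst l A D with hK
      have hk1 := one_le_mulCompConst l le_rfl hD1
      have hk2 := one_le_fieldConst l hA hD1
      have hk3 : 1 ≤ 7 * A * fieldConst l A D :=
        one_le_mul_of_one_le_of_one_le (by linarith) hk2
      have hK1 : 1 ≤ K := by linarith
      obtain ⟨L, hL1, hL⟩ := iteration_bound hK1 hT
      refine ⟨D + L * (4 * L), by nlinarith, fun {κ g φ η J} d n z hz => ?_⟩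
      have hsin : ∀ i x, |iteratedDeriv i Real.sin x| ≤ 1 := Real.abs_iteratedDeriv_sin_le_one
      -- The source `ε` is 1, from the inhomogeneous terms of the estimates. The initial constant is
      -- 0, because the starting field and angles do not depend on `z`.
      have hstep := hL
        (fun n t => |iteratedDerivWithin l ((scheme κ g φ η n).1 t) J z|)
        (fun n x s t => |iteratedDerivWithin l ((scheme κ g φ η n).2 s t x.1 x.2) J z|)
        (fun _ => 1) 0 le_rfl (fun _ => zero_le_one) (fun t _ => by simp [scheme])
        (fun i s t _ _ _ => by simp [scheme, iteratedDerivWithin_const, show l ≠ 0 by omega])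
      obtain ⟨c, hc0, hcs, hc⟩ := hstep (by
        intro n α β hα hβ hα0 hβ0 ha hb
        have hst := d.isState n
        have hV : 1 ≤ l → ∀ s t θ ν, 0 ≤ s → s ≤ t → t ≤ T →
            |iteratedDerivWithin l ((scheme κ g φ η n).2 s t θ ν) J z| ≤ β s t :=
          fun _ s t θ ν hs hst ht => hb (θ, ν) s t hs hst ht
        have hI : ∀ s t, s ≤ t → 0 ≤ ∫ r in s..t, (1 + α r + β r t) := fun s t hs =>
          intervalIntegral.integral_nonneg hs fun r _ => by linarith [hα0 r, hβ0 r t]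
        refine ⟨fun i s t hs hs' ht => ?_, fun t ht => ?_⟩
        · simp only [scheme, iteratedDerivWithin_nextAngle hpos]
          refine (hst.abs_iteratedDerivWithin_charIntegral_le d.isOpen Real.contDiff_sin hsin
            (by omega) le_rfl hD1 hz (hD d n z hz) hα hβ hβ0 ha hV hs hs' ht i.1 i.2).trans ?_
          exact mul_le_mul_of_nonneg_right (by linarith) (hI s t hs')
        · refine ((hst.nextField_aux d n ht).2 l (by omega) z hz _ fun θ ν =>
            hst.abs_iteratedDerivWithin_integrand_le d n (by omega) le_rfl hAD hz (hD d n z hz)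
              hα hβ hα0 hβ0 ha hV ht θ ν).trans ?_
          rw [← mul_assoc]
          exact mul_le_mul_of_nonneg_right (by linarith) (by linarith [hI 0 t ht.1, hβ0 0 t]))
      -- `4 * L` is the fixed point of the recursion $c\mapsto\frac34c+L$.
      have hcn : ∀ n, c n ≤ 4 * L := by
        intro n
        induction n with
        | zero => rw [hc0]; linarith
        | succ n ih => rw [hcs]; linarith
      have hDL : L * c n ≤ D + L * (4 * L) := by
        have := mul_le_mul_of_nonneg_left (hcn n) (zero_le_one.trans hL1)
        linarith
      have hDD : D ≤ D + L * (4 * L) := by nlinarith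
      refine ⟨fun j hj t ht => ?_, fun j h1 hj s t θ ν hs hst ht => ?_⟩
      · rcases (Nat.lt_succ_iff_lt_or_eq.1 hj) with hj | rfl
        · exact ((hD d n z hz).1 j hj t ht).trans hDD
        · exact ((hc n).2.1 t ht).trans hDL
      · rcases (Nat.lt_succ_iff_lt_or_eq.1 hj) with hj | rfl
        · exact ((hD d n z hz).2 j h1 hj s t θ ν hs hst ht).trans hDD
        · exact ((hc n).2.2 (θ, ν) s t hs hst ht).trans hDL

end Scheme

/-- One factor `E` is kept and all further derivatives of `u` are absorbed into `D`. With `E`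
proportional to time the whole derivative is so too. -/
theorem abs_iteratedDerivWithin_comp_le_of_small {J : Set ℝ} (hJ : IsOpen J) {z : ℝ} (hz : z ∈ J)
    {n l : ℕ} (h1 : 1 ≤ l) (hl : l ≤ n) {g u : ℝ → ℝ} (hg : ContDiff ℝ n g)
    (hu : ContDiffOn ℝ n u J) {G D E : ℝ} (hD : 1 ≤ D) (hE0 : 0 ≤ E) (hED : E ≤ D)
    (hG : ∀ i ≤ n, |iteratedDeriv i g (u z)| ≤ G)
    (hu' : ∀ i, 1 ≤ i → i ≤ n → |iteratedDerivWithin i u J z| ≤ E) :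
    |iteratedDerivWithin l (fun z => g (u z)) J z|
      ≤ (G + 2 ^ n * (n.factorial * G * D ^ n)) * E := by
  obtain ⟨l, rfl⟩ := Nat.exists_eq_succ_of_ne_zero (show l ≠ 0 by omega)
  have hG0 : 0 ≤ G := (abs_nonneg _).trans (hG 0 (Nat.zero_le _))
  refine (abs_iteratedDerivWithin_comp_succ_le hJ hz hl hg hu hD hE0 hED
    (fun i hi => hG i (by omega)) (fun i h1 hi => hu' i h1 (by omega))).trans ?_
  rw [add_mul]
  have := hu' (l + 1) h1 hl
  gcongr <;> first | omega | norm_num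

/-! ### Smoothness and derivative bounds of the approximating densities. -/

section

variable {k : ℕ} {A T κ : ℝ} {g : ℝ → ℝ} {φ : ℕ → ℝ → ℝ → ℝ} {η : ℝ → ℝ} {J : Set ℝ}

theorem IsSchemeData.contDiffOn_density (d : IsSchemeData k A T κ g φ η J) (n : ℕ) {t : ℝ}
    (ht : t ∈ Icc 0 T) (θ ν : ℝ) : ContDiffOn ℝ k
      (density (φ n) η (scheme κ g φ η n).1 (scheme κ g φ η n).2 t θ ν) J :=
  ((d.contDiff_datum n ν).comp_contDiffOn
    ((d.isState n).contDiffOn_angle 0 t θ ν le_rfl ht.1 ht.2)).mul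
    (d.contDiff_cutoff.comp_contDiffOn ((d.isState n).contDiffOn_charIntegral d.isOpen
      Real.contDiff_cos Real.abs_iteratedDeriv_cos_le_one le_rfl ht.1 ht.2 θ ν).1)

/-- The `z`-derivatives of the approximating densities are bounded by a multiple of `t`. -/
theorem exists_density_bound (k : ℕ) {A T : ℝ} (hA : 1 ≤ A) (hT : 0 ≤ T) : ∃ K, 0 ≤ K ∧
    ∀ {κ : ℝ} {g : ℝ → ℝ} {φ : ℕ → ℝ → ℝ → ℝ} {η : ℝ → ℝ} {J : Set ℝ},
      IsSchemeData k A T κ g φ η J → ∀ n, ∀ t ∈ Icc 0 T, ∀ θ ν, ∀ l, 1 ≤ l → l ≤ k → ∀ z ∈ J,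
        |iteratedDerivWithin l
          (density (φ n) η (scheme κ g φ η n).1 (scheme κ g φ η n).2 t θ ν) J z| ≤ K * t := by
  obtain ⟨D, hAD, hD⟩ := exists_scheme_bound k hA hT (k + 1) le_rfl
  have hD1 := hA.trans hAD
  set K₀ := mulCompConst k 1 D * (1 + D + D) with hK₀
  have hm := one_le_mulCompConst k le_rfl hD1
  have hK₀1 : 1 ≤ K₀ := one_le_mul_of_one_le_of_one_le hm (by linarith)
  set D' := K₀ * A with hD'
  have hD'1 : 1 ≤ D' := one_le_mul_of_one_le_of_one_le hK₀1 hA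
  set K₄ := (A + 2 ^ k * (k.factorial * A * D' ^ k)) * K₀ with hK₄
  have hK₄0 : 0 ≤ K₄ := by positivity
  refine ⟨A * K₄ + K₄ * A + 2 ^ k * (K₄ * A) * K₄, by positivity, ?_⟩
  intro κ g φ η J d n t ht θ ν l h1 hl z hz
  have hcos : ∀ i x, |iteratedDeriv i Real.cos x| ≤ 1 := Real.abs_iteratedDeriv_cos_le_one
  have hsin : ∀ i x, |iteratedDeriv i Real.sin x| ≤ 1 := Real.abs_iteratedDeriv_sin_le_one
  have htA : t ≤ A := ht.2.trans d.time_le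
  have ht0 := ht.1
  -- An integral over `[0, t]` of a uniformly bounded integrand yields the factor `t`. The claim
  -- covers every step, since the angles of step `n + 1` come from the integral of step `n`.
  have hchar : ∀ n, ∀ f : ℝ → ℝ, ContDiff ℝ k f → (∀ i x, |iteratedDeriv i f x| ≤ 1) →
      ∀ i ≤ k, |iteratedDerivWithin i
        (charIntegral f (scheme κ g φ η n).1 (scheme κ g φ η n).2 0 t θ ν) J z| ≤ K₀ * t := by
    intro n f hf hf1 i hi
    have hlow := hD d n z hz
    refine ((d.isState n).abs_iteratedDerivWithin_charIntegral_le d.isOpen hf hf1 hi hi hD1 hz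
      (hlow.mono (by omega)) (α := fun _ => D) (β := fun _ _ => D) continuous_const
      (fun _ => continuous_const) (fun _ _ => by linarith) (fun t ht => hlow.1 i (by omega) t ht)
      (fun h1 s t θ ν hs hst ht => hlow.2 i h1 (by omega) s t θ ν hs hst ht)
      le_rfl ht.1 ht.2 θ ν).trans ?_
    rw [intervalIntegral.integral_const, smul_eq_mul, sub_zero, hK₀]
    have hmono : mulCompConst i 1 D ≤ mulCompConst k 1 D := by
      unfold mulCompConst
      gcongr
      all_goals first | omega | norm_num
    calc _ ≤ mulCompConst k 1 D * (t * (1 + D + D)) := by gcongr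
      _ = _ := by ring
  have hY : ∀ i, 1 ≤ i → i ≤ k →
      |iteratedDerivWithin i ((scheme κ g φ η n).2 0 t θ ν) J z| ≤ K₀ * t := by
    intro i h1 hi
    rcases n with _ | n
    · simp only [scheme, iteratedDerivWithin_const, if_neg (show ¬ i = 0 by omega), abs_zero]
      positivity
    · simp only [scheme, iteratedDerivWithin_nextAngle h1]
      exact hchar n _ Real.contDiff_sin hsin i hi
  have hE0 : 0 ≤ K₀ * t := by positivity
  have hED : K₀ * t ≤ D' := by rw [hD']; gcongr
  have hYc := (d.isState n).contDiffOn_angle 0 t θ ν le_rfl ht.1 ht.2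
  have hQc := ((d.isState n).contDiffOn_charIntegral d.isOpen
      Real.contDiff_cos hcos le_rfl ht.1 ht.2 θ ν).1
  have hu : ∀ i, 1 ≤ i → i ≤ k → |iteratedDerivWithin i
      (fun z => φ n ((scheme κ g φ η n).2 0 t θ ν z) ν) J z| ≤ K₄ * t := by
    intro i h1 hi
    refine (abs_iteratedDerivWithin_comp_le_of_small d.isOpen hz h1 hi (d.contDiff_datum n ν) hYc
      hD'1 hE0 hED (fun j hj => d.datum_le n ν j hj _) hY).trans (le_of_eq ?_)
    rw [hK₄]; ring
  have hv : ∀ i, 1 ≤ i → i ≤ k → |iteratedDerivWithin i (fun z => η (charIntegral Real.cos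
      (scheme κ g φ η n).1 (scheme κ g φ η n).2 0 t θ ν z)) J z| ≤ K₄ * t := by
    intro i h1 hi
    refine (abs_iteratedDerivWithin_comp_le_of_small d.isOpen hz h1 hi d.contDiff_cutoff hQc
      hD'1 hE0 hED (fun j hj => d.cutoff_le j hj _)
      (fun j _ hj => hchar n _ Real.contDiff_cos hcos j hj)).trans (le_of_eq ?_)
    rw [hK₄]; ring
  obtain ⟨l, rfl⟩ := Nat.exists_eq_succ_of_ne_zero (show l ≠ 0 by omega)
  refine (abs_iteratedDerivWithin_mul_le d.isOpen hz hl ((d.contDiff_datum n ν).comp_contDiffOn hYc)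
    (d.contDiff_cutoff.comp_contDiffOn hQc) (P := K₄ * A) (E := K₄ * t) (by positivity)
    (fun i h1 hi => (hu i h1 (by omega)).trans (by gcongr))
    (fun i h1 hi => hv i h1 (by omega))).trans ?_
  have e1 := d.datum_le n ν 0 (Nat.zero_le _) ((scheme κ g φ η n).2 0 t θ ν z)
  have e2 := d.cutoff_le 0 (Nat.zero_le _) (charIntegral Real.cos
      (scheme κ g φ η n).1 (scheme κ g φ η n).2 0 t θ ν z)
  rw [iteratedDeriv_zero] at e1 e2
  have e3 := hu (l + 1) h1 hl
  have e4 := hv (l + 1) h1 hl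
  rw [abs_of_nonneg (show 0 ≤ K₄ * A by positivity)]
  calc _ ≤ A * (K₄ * t) + (K₄ * t) * A + 2 ^ k * (K₄ * A) * (K₄ * t) := by
        gcongr <;> first | assumption | omega | norm_num
    _ = _ := by ring

end

/-! ### Mollification on the torus -/

/-- The `2π`-periodic function that agrees with `β` on `(-π, π]`. -/
noncomputable def periodize (β : ℝ → ℝ) (y : ℝ) : ℝ :=
  β (toIocMod Real.two_pi_pos (-Real.pi) y)

theorem periodize_periodic (β : ℝ → ℝ) : Function.Periodic (periodize β) (2 * Real.pi) := by
  intro y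
  simp only [periodize, toIocMod_periodic Real.two_pi_pos (-Real.pi) y]

theorem periodize_eq {β : ℝ → ℝ} {y : ℝ} (hy : y ∈ Ioc (-Real.pi) Real.pi) :
    periodize β y = β y := by
  rw [periodize, (toIocMod_eq_self Real.two_pi_pos).2]
  rwa [show -Real.pi + 2 * Real.pi = Real.pi by ring]

/-- The only delicate points are the seams at odd multiples of $\pi$. There the function vanishes on
both sides, because `β` is zero outside $(-1,1)$ and $\pi>3$. -/
theorem contDiff_periodize {β : ℝ → ℝ} (hβ : ContDiff ℝ ∞ β) (hβ0 : ∀ y, 1 ≤ |y| → β y = 0) :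
    ContDiff ℝ ∞ (periodize β) := by
  rw [contDiff_iff_contDiffAt]
  intro y₀
  have hpi := Real.pi_gt_three
  set m : ℤ := toIocDiv Real.two_pi_pos (-Real.pi) y₀ with hm
  set c : ℝ := m • (2 * Real.pi) with hc
  have hper : ∀ y, periodize β y = periodize β (y - c) := by
    intro y
    simp only [periodize, hc, toIocMod_sub_zsmul]
  have h0 : y₀ - c ∈ Ioc (-Real.pi) Real.pi := by
    have := toIocMod_mem_Ioc Real.two_pi_pos (-Real.pi) y₀
    rw [← self_sub_toIocDiv_zsmul, show -Real.pi + 2 * Real.pi = Real.pi by ring] at this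
    exact this
  rcases h0.2.lt_or_eq with hlt | heq
  · have h1 : ∀ᶠ y in nhds y₀, periodize β y = β (y - c) := by
      have h2 : ∀ᶠ y in nhds y₀, y - c ∈ Ioo (-Real.pi) Real.pi :=
        (continuous_id.sub continuous_const).continuousAt.eventually
          (isOpen_Ioo.mem_nhds ⟨h0.1, hlt⟩)
      filter_upwards [h2] with y hy
      rw [hper, periodize_eq ⟨hy.1, hy.2.le⟩]
    exact ContDiffAt.congr_of_eventuallyEq
      (hβ.comp (contDiff_id.sub contDiff_const)).contDiffAt h1
  · have h1 : ∀ᶠ y in nhds y₀, periodize β y = 0 := by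
      have h2 : ∀ᶠ y in nhds y₀, y - c ∈ Ioo (Real.pi - 1) (Real.pi + 1) :=
        (continuous_id.sub continuous_const).continuousAt.eventually
          (isOpen_Ioo.mem_nhds ⟨by change _ < y₀ - c; linarith, by change y₀ - c < _; linarith⟩)
      filter_upwards [h2] with y hy
      rw [hper]
      rcases le_or_gt (y - c) Real.pi with hle | hgt
      · rw [periodize_eq ⟨by linarith [hy.1], hle⟩]
        exact hβ0 _ (by rw [abs_of_pos] <;> linarith [hy.1])
      · have h3 := periodize_periodic β (y - c - 2 * Real.pi)
        rw [sub_add_cancel] at h3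
        rw [h3, periodize_eq ⟨by linarith, by linarith [hy.2]⟩]
        exact hβ0 _ (by rw [abs_of_neg] <;> linarith [hy.2])
    exact contDiffAt_const.congr_of_eventuallyEq h1

/-- A bump function with support of radius `1 / (n + 1)`. -/
noncomputable def bump (n : ℕ) : ContDiffBump (0 : ℝ) where
  rIn := 1 / (2 * ((n : ℝ) + 1))
  rOut := 1 / ((n : ℝ) + 1)
  rIn_pos := by positivity
  rIn_lt_rOut := by
    have : (0 : ℝ) < (n : ℝ) + 1 := by positivity
    gcongr
    linarith

/-- The periodic mollifier. -/
noncomputable def mollifier (n : ℕ) : ℝ → ℝ := periodize ((bump n).normed volume)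

theorem bump_normed_eq_zero {n : ℕ} {y : ℝ} (hy : 1 / ((n : ℝ) + 1) ≤ |y|) :
    (bump n).normed volume y = 0 := by
  by_contra h
  have h1 : y ∈ Function.support ((bump n).normed volume) := h
  rw [ContDiffBump.support_normed_eq] at h1
  have h2 : |y| < 1 / ((n : ℝ) + 1) := by simpa [bump] using h1
  linarith

theorem one_div_le_one_nat (n : ℕ) : 1 / ((n : ℝ) + 1) ≤ 1 :=
  (div_le_one (by positivity)).2 (by linarith [Nat.cast_nonneg (α := ℝ) n])

theorem contDiff_mollifier (n : ℕ) : ContDiff ℝ ∞ (mollifier n) :=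
  contDiff_periodize (ContDiffBump.contDiff_normed _) fun _ hy =>
    bump_normed_eq_zero ((one_div_le_one_nat n).trans hy)

theorem mollifier_nonneg (n : ℕ) (y : ℝ) : 0 ≤ mollifier n y := ContDiffBump.nonneg_normed _ _

theorem mollifier_periodic (n : ℕ) : Function.Periodic (mollifier n) (2 * Real.pi) :=
  periodize_periodic _

theorem exists_int_of_mollifier_ne_zero {n : ℕ} {y : ℝ} (hy : mollifier n y ≠ 0) :
    ∃ m : ℤ, |y - m * (2 * Real.pi)| < 1 / ((n : ℝ) + 1) := by
  refine ⟨toIocDiv Real.two_pi_pos (-Real.pi) y, ?_⟩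
  by_contra h
  refine hy (bump_normed_eq_zero ?_)
  rw [← self_sub_toIocDiv_zsmul, zsmul_eq_mul]
  exact not_lt.1 h

theorem integral_torus_eq (f : ℝ → ℝ) : ∫ θ, f θ ∂torus = ∫ θ in (0 : ℝ)..(2 * Real.pi), f θ := by
  rw [torus, intervalIntegral.integral_of_le Real.two_pi_pos.le]

theorem integral_mollifier (n : ℕ) (x : ℝ) : ∫ θ, mollifier n (x - θ) ∂torus = 1 := by
  rw [integral_torus_eq, intervalIntegral.integral_comp_sub_left]
  have h1 := (mollifier_periodic n).intervalIntegral_add_eq (x - 2 * Real.pi) (-Real.pi)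
  rw [sub_add_cancel, show -Real.pi + 2 * Real.pi = Real.pi by ring] at h1
  rw [sub_zero, h1, intervalIntegral.integral_of_le (by linarith [Real.pi_pos])]
  have h2 : ∫ y in Ioc (-Real.pi) Real.pi, mollifier n y
      = ∫ y in Ioc (-Real.pi) Real.pi, (bump n).normed volume y :=
    setIntegral_congr_fun measurableSet_Ioc fun _ hy => periodize_eq hy
  rw [h2, setIntegral_eq_integral_of_forall_compl_eq_zero, ContDiffBump.integral_normed]
  intro y hy
  refine bump_normed_eq_zero ((one_div_le_one_nat n).trans ?_)
  by_contra h
  rw [not_le, abs_lt] at h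
  exact hy ⟨by linarith [Real.pi_gt_three], by linarith [Real.pi_gt_three]⟩

theorem exists_bound_iteratedDeriv_of_periodic {K : ℝ → ℝ} (hK : ContDiff ℝ ∞ K)
    (hp : Function.Periodic K (2 * Real.pi)) (j : ℕ) : ∃ B, ∀ y, |iteratedDeriv j K y| ≤ B := by
  have hper : Function.Periodic (iteratedDeriv j K) (2 * Real.pi) := by
    intro y
    have h := iteratedDeriv_comp_add_const j K (2 * Real.pi)
    rw [show (fun z => K (z + 2 * Real.pi)) = K from funext hp] at h
    exact (congrFun h y).symm
  obtain ⟨B, hB⟩ := isCompact_Icc.exists_bound_of_continuousOn (s := Icc 0 (2 * Real.pi))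
    (hK.continuous_iteratedDeriv j (by exact_mod_cast le_top)).continuousOn
  refine ⟨B, fun y => ?_⟩
  obtain ⟨x, hx, hyx⟩ := hper.exists_mem_Ico₀ Real.two_pi_pos y
  rw [hyx]
  exact hB x ⟨hx.1, hx.2.le⟩

theorem iteratedDeriv_integral_kernel {K u : ℝ → ℝ} (hK : ContDiff ℝ ∞ K)
    (hp : Function.Periodic K (2 * Real.pi)) (hu : Integrable u torus) {M : ℝ}
    (hM : ∀ᵐ θ ∂torus, |u θ| ≤ M) (n : ℕ) :
    ContDiff ℝ n (fun x => ∫ θ, u θ * K (x - θ) ∂torus) ∧ ∀ j ≤ n, ∀ x,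
      iteratedDeriv j (fun x => ∫ θ, u θ * K (x - θ) ∂torus) x
        = ∫ θ, u θ * iteratedDeriv j K (x - θ) ∂torus := by
  have hid : ∀ θ j x, iteratedDerivWithin j (fun x => u θ * K (x - θ)) univ x
      = u θ * iteratedDeriv j K (x - θ) := by
    intro θ j x
    rw [iteratedDerivWithin_const_mul_field, iteratedDerivWithin_univ,
      iteratedDeriv_comp_sub_const]
  have hKn : ContDiff ℝ n K := hK.of_le (by exact_mod_cast le_top)
  have h := contDiffOn_integral (μ := torus) isOpen_univ (n := n) (u := fun θ x => u θ * K (x - θ))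
    (fun x _ => hu.aestronglyMeasurable.mul
      (hK.continuous.comp (by fun_prop : Continuous fun θ => x - θ)).aestronglyMeasurable)
    (Filter.Eventually.of_forall fun θ => (contDiff_const.mul
      (hKn.comp (contDiff_id.sub contDiff_const))).contDiffOn)
    (fun l _ => by
      obtain ⟨B, hB⟩ := exists_bound_iteratedDeriv_of_periodic hK hp l
      refine ⟨M * B, ?_⟩
      filter_upwards [hM] with θ hθ x _
      rw [hid, abs_mul]
      exact mul_le_mul hθ (hB _) (abs_nonneg _) ((abs_nonneg _).trans hθ))
  refine ⟨contDiffOn_univ.1 h.1, fun j hj x => ?_⟩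
  have h2 := (h.2 j hj x (mem_univ _)).2
  simp only [hid] at h2
  rw [← h2, iteratedDerivWithin_univ]

/-- Away from the nonzero multiples of $2\pi$ no other copy of the bump is visible. For interior
points of a period, periodic mollification thus becomes convolution on the line. -/
theorem mollifier_eq {n : ℕ} {y : ℝ} (hy : |y| ≤ 2 * Real.pi - 1 / ((n : ℝ) + 1)) :
    mollifier n y = (bump n).normed volume y := by
  have hpi := Real.pi_gt_three
  have h1 := one_div_le_one_nat n
  by_cases hmem : y ∈ Ioc (-Real.pi) Real.pi
  · exact periodize_eq hmem
  have hlarge : Real.pi ≤ |y| := by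
    by_contra h
    rw [not_le, abs_lt] at h
    exact hmem ⟨h.1, h.2.le⟩
  rw [bump_normed_eq_zero (by linarith)]
  by_contra hne
  obtain ⟨m, hm⟩ := exists_int_of_mollifier_ne_zero hne
  rcases eq_or_ne m 0 with rfl | hm0
  · simp only [Int.cast_zero, zero_mul, sub_zero] at hm
    linarith
  · have h2 : (1 : ℝ) ≤ |(m : ℝ)| := by exact_mod_cast Int.one_le_abs hm0
    have h3 := abs_sub_abs_le_abs_sub ((m : ℝ) * (2 * Real.pi)) y
    rw [abs_sub_comm, abs_mul, abs_of_pos Real.two_pi_pos] at h3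
    nlinarith

/-- The mollification of a function on the torus. -/
noncomputable def mollify (n : ℕ) (w : ℝ → ℝ) (x : ℝ) : ℝ := ∫ θ, w θ * mollifier n (x - θ) ∂torus

theorem mollify_periodic (n : ℕ) (w : ℝ → ℝ) : Function.Periodic (mollify n w) (2 * Real.pi) := by
  intro x
  refine integral_congr_ae (Filter.Eventually.of_forall fun θ => ?_)
  simp only
  rw [show x + 2 * Real.pi - θ = x - θ + 2 * Real.pi by ring, mollifier_periodic]

/-- Extend `w` by zero to the line and apply Lebesgue differentiation for convolutions with bumps.
Once the bump is narrower than the distance of `x` to both ends of the period, `mollify n w x`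
equals this convolution. -/
theorem ae_tendsto_mollify {w : ℝ → ℝ} (hw : Integrable w torus) :
    ∀ᵐ x ∂torus, Filter.Tendsto (fun n => mollify n w x) Filter.atTop (nhds (w x)) := by
  have hloc : LocallyIntegrable ((Ioc 0 (2 * Real.pi)).indicator w) volume :=
    ((integrable_indicator_iff measurableSet_Ioc).2 hw).locallyIntegrable
  have hr : Filter.Tendsto (fun n => (bump n).rOut) Filter.atTop (nhds 0) :=
    tendsto_one_div_add_atTop_nhds_zero_nat
  have h := ContDiffBump.ae_convolution_tendsto_right_of_locallyIntegrable (φ := bump)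
    (K := 2) hr (Filter.Eventually.of_forall fun n => by
      change 1 / ((n : ℝ) + 1) ≤ 2 * (1 / (2 * ((n : ℝ) + 1)))
      rw [one_div, one_div, mul_inv]
      apply le_of_eq
      ring) hloc
  have h2 : ∀ᵐ x ∂torus, x ∈ Ioc 0 (2 * Real.pi) := ae_restrict_mem measurableSet_Ioc
  have h3 : ∀ᵐ x ∂torus, x ≠ 2 * Real.pi :=
    ae_restrict_of_ae (Measure.ae_ne volume _)
  filter_upwards [ae_restrict_of_ae h, h2, h3] with x hx hx2 hx3
  rw [indicator_of_mem hx2] at hx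
  refine hx.congr' ?_
  have hlt : x < 2 * Real.pi := lt_of_le_of_ne hx2.2 hx3
  have h4 := tendsto_one_div_add_atTop_nhds_zero_nat.eventually
    (gt_mem_nhds (lt_min hx2.1 (sub_pos.2 hlt)))
  filter_upwards [h4] with n hn
  rw [convolution_lsmul_swap, mollify, torus, ← integral_indicator measurableSet_Ioc]
  refine integral_congr_ae (Filter.Eventually.of_forall fun θ => ?_)
  by_cases hθ : θ ∈ Ioc 0 (2 * Real.pi)
  · simp only [indicator_of_mem hθ, smul_eq_mul]
    rw [mollifier_eq, mul_comm]
    have h5 := hn.trans_le (min_le_left _ _)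
    have h6 := hn.trans_le (min_le_right _ _)
    rw [abs_le]
    constructor <;> linarith [hθ.1, hθ.2]
  · simp [indicator_of_notMem hθ]

theorem abs_integral_mul_mollifier_le {u : ℝ → ℝ} {M : ℝ} (n : ℕ) (x : ℝ)
    (hM : ∀ᵐ θ ∂torus, mollifier n (x - θ) ≠ 0 → |u θ| ≤ M) :
    |∫ θ, u θ * mollifier n (x - θ) ∂torus| ≤ M := by
  have hc : Continuous fun θ => mollifier n (x - θ) :=
    (contDiff_mollifier n).continuous.comp (by fun_prop)
  obtain ⟨B, hB⟩ := exists_bound_iteratedDeriv_of_periodic (contDiff_mollifier n)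
    (mollifier_periodic n) 0
  have hi : Integrable (fun θ => mollifier n (x - θ)) torus :=
    Integrable.of_bound hc.aestronglyMeasurable B (Filter.Eventually.of_forall fun θ => by
      simpa using hB (x - θ))
  calc |∫ θ, u θ * mollifier n (x - θ) ∂torus|
      ≤ ∫ θ, M * mollifier n (x - θ) ∂torus := by
        rw [← Real.norm_eq_abs]
        refine norm_integral_le_of_norm_le (hi.const_mul M) ?_
        filter_upwards [hM] with θ hθ
        rw [Real.norm_eq_abs, abs_mul, abs_of_nonneg (mollifier_nonneg n _)]
        by_cases h0 : mollifier n (x - θ) = 0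
        · simp [h0]
        · exact mul_le_mul_of_nonneg_right (hθ h0) (mollifier_nonneg n _)
    _ = M := by rw [integral_const_mul, integral_mollifier, mul_one]

/-- The derivatives fall on the kernel, which is an admissible test function, so they can be moved
to the weak derivative `u`. The kernel is nonnegative with integral 1, hence the bound `M` survives.
-/
theorem mollify_contDiff_and_bound {k : ℕ} {w : ℝ → ℝ} {M : ℝ}
    (hwk : ∀ j ≤ k, ∃ u : ℝ → ℝ, Integrable u torus ∧ (∀ᵐ θ ∂torus, |u θ| ≤ M) ∧
      ∀ ψ : ℝ → ℝ, ContDiff ℝ ∞ ψ → Function.Periodic ψ (2 * Real.pi) →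
        ∫ θ, w θ * iteratedDeriv j ψ θ ∂torus = (-1) ^ j * ∫ θ, u θ * ψ θ ∂torus) (n : ℕ) :
    ContDiff ℝ k (mollify n w) ∧ ∀ j ≤ k, ∀ x, |iteratedDeriv j (mollify n w) x| ≤ M := by
  obtain ⟨u₀, hu₀, hM₀, hψ₀⟩ := hwk 0 (Nat.zero_le _)
  have hK := contDiff_mollifier n
  have hp := mollifier_periodic n
  have hcomp : ∀ (L : ℝ → ℝ) (x : ℝ), ContDiff ℝ ∞ L → Function.Periodic L (2 * Real.pi) →
      ContDiff ℝ ∞ (fun θ => L (x - θ)) ∧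
        Function.Periodic (fun θ => L (x - θ)) (2 * Real.pi) := by
    intro L x hL hLp
    refine ⟨hL.comp (contDiff_const.sub contDiff_id), fun θ => ?_⟩
    simp only
    rw [← hLp, sub_add_eq_sub_sub, sub_add_cancel]
  have h0 : mollify n w = fun x => ∫ θ, u₀ θ * mollifier n (x - θ) ∂torus := by
    funext x
    obtain ⟨h1, h2⟩ := hcomp _ x hK hp
    simpa [mollify] using hψ₀ _ h1 h2
  obtain ⟨hC, hD⟩ := iteratedDeriv_integral_kernel hK hp hu₀ hM₀ k
  rw [h0]
  refine ⟨hC, fun j hj x => ?_⟩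
  obtain ⟨u, hu, hM, hψ⟩ := hwk j hj
  have hper : Function.Periodic (iteratedDeriv j (mollifier n)) (2 * Real.pi) := by
    intro y
    have h := iteratedDeriv_comp_add_const j (mollifier n) (2 * Real.pi)
    rw [show (fun z => mollifier n (z + 2 * Real.pi)) = mollifier n from funext hp] at h
    exact (congrFun h y).symm
  have hKj : ContDiff ℝ ∞ (iteratedDeriv j (mollifier n)) := by
    rw [iteratedDeriv_eq_iterate]
    exact hK.iterate_deriv j
  obtain ⟨h1, h2⟩ := hcomp _ x hK hp
  obtain ⟨h3, h4⟩ := hcomp _ x hKj hper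
  have h5 : iteratedDeriv j (fun θ => mollifier n (x - θ))
      = fun θ => (-1) ^ j * iteratedDeriv j (mollifier n) (x - θ) := by
    funext θ
    rw [iteratedDeriv_comp_const_sub]
    rfl
  have h6 := hψ _ h1 h2
  -- The identity of order zero replaces `u₀` by `w` when tested with the differentiated kernel.
  have h7 := hψ₀ _ h3 h4
  simp only [iteratedDeriv_zero, pow_zero, one_mul] at h7
  rw [h5] at h6
  simp only [mul_left_comm _ ((-1 : ℝ) ^ j)] at h6
  rw [integral_const_mul] at h6
  have h8 := mul_left_cancel₀ (pow_ne_zero j (by norm_num : (-1 : ℝ) ≠ 0)) h6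
  rw [hD j hj x, ← h7, h8]
  exact abs_integral_mul_mollifier_le n x (hM.mono fun θ hθ _ => hθ)

/-- The mollifications converge almost everywhere and are equi-Lipschitz, so they converge at every
point. The limit is a Lipschitz representative of `w`. -/
theorem exists_lipschitz_of_mollify {w : ℝ → ℝ} {M : ℝ} (hw : Integrable w torus)
    (hlip : ∀ n x y, |mollify n w x - mollify n w y| ≤ M * |x - y|) :
    ∃ F : ℝ → ℝ, (∀ x y, |F x - F y| ≤ M * |x - y|) ∧ Function.Periodic F (2 * Real.pi) ∧
      (∀ n x, |mollify n w x - F x| ≤ M / ((n : ℝ) + 1)) ∧ ∀ᵐ θ ∂torus, F θ = w θ := by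
  have hM : 0 ≤ M := by
    have := (abs_nonneg _).trans (hlip 0 1 0)
    simpa using this
  have hae := ae_tendsto_mollify hw
  have hc : ∀ x, CauchySeq fun n => mollify n w x := by
    intro x
    obtain ⟨x', hx', hxx⟩ : ∃ x' ∈ Ico 0 (2 * Real.pi), ∀ n, mollify n w x = mollify n w x' := by
      refine ⟨toIcoMod Real.two_pi_pos 0 x, by simpa using toIcoMod_mem_Ico Real.two_pi_pos 0 x,
        fun n => ?_⟩
      rw [← self_sub_toIcoDiv_zsmul]
      exact ((mollify_periodic n w).sub_zsmul_eq _).symm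
    simp only [hxx]
    rw [Metric.cauchySeq_iff']
    intro ε hε
    set δ := ε / (4 * (M + 1)) with hδ
    have hδ0 : 0 < δ := by positivity
    -- The exceptional set is null and cannot contain an interval to the right of `x'`, so points of
    -- convergence lie arbitrarily close.
    obtain ⟨y, hy, hyx⟩ : ∃ y, Filter.Tendsto (fun n => mollify n w y) Filter.atTop (nhds (w y)) ∧
        |x' - y| ≤ δ := by
      by_contra! hcon
      have hsub : Ioo x' (min (x' + δ) (2 * Real.pi)) ⊆ {y | ¬ Filter.Tendsto
          (fun n => mollify n w y) Filter.atTop (nhds (w y))} ∩ Ioc 0 (2 * Real.pi) := by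
        intro y hy
        have h1 := hy.2.trans_le (min_le_left _ _)
        have h2 := hy.2.trans_le (min_le_right _ _)
        refine ⟨fun ht => ?_, hx'.1.trans_lt hy.1, h2.le⟩
        have h3 := hcon y ht
        rw [abs_of_neg (by linarith [hy.1])] at h3
        linarith
      have h4 : volume ({y | ¬ Filter.Tendsto
          (fun n => mollify n w y) Filter.atTop (nhds (w y))} ∩ Ioc 0 (2 * Real.pi)) = 0 := by
        rw [← Measure.restrict_apply₀' measurableSet_Ioc.nullMeasurableSet]
        exact hae
      have h5 := measure_mono_null hsub h4
      rw [Real.volume_Ioo, ENNReal.ofReal_eq_zero] at h5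
      have h6 : x' < min (x' + δ) (2 * Real.pi) := lt_min (by linarith) hx'.2
      linarith
    obtain ⟨N, hN⟩ := Metric.cauchySeq_iff'.1 hy.cauchySeq (ε / 2) (half_pos hε)
    refine ⟨N, fun n hn => ?_⟩
    have h1 := hN n hn
    rw [Real.dist_eq] at h1 ⊢
    have h2 := hlip n x' y
    have h3 := hlip N y x'
    rw [abs_sub_comm y x'] at h3
    have h4 : M * |x' - y| ≤ ε / 4 := by
      calc M * |x' - y| ≤ (M + 1) * δ := by gcongr; linarith
        _ = ε / 4 := by rw [hδ]; field_simp
    have h5 : mollify n w x' - mollify N w x' = (mollify n w x' - mollify n w y)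
      + (mollify n w y - mollify N w y) + (mollify N w y - mollify N w x') := by ring
    rw [h5]
    refine (abs_add_three _ _ _).trans_lt ?_
    linarith
  choose F hF using fun x => cauchySeq_tendsto_of_complete (hc x)
  have hFl : ∀ x y, |F x - F y| ≤ M * |x - y| := fun x y =>
    le_of_tendsto ((hF x).sub (hF y)).abs (Filter.Eventually.of_forall fun n => hlip n x y)
  have hFp : Function.Periodic F (2 * Real.pi) := fun x => by
    refine tendsto_nhds_unique (hF _) ?_
    simp only [mollify_periodic _ w x]
    exact hF x
  have hFw : ∀ᵐ θ ∂torus, F θ = w θ := by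
    filter_upwards [hae] with θ hθ
    exact tendsto_nhds_unique (hF θ) hθ
  refine ⟨F, hFl, hFp, fun n x => ?_, hFw⟩
  have hFc : Continuous F := by
    refine (LipschitzWith.of_dist_le_mul (K := M.toNNReal) fun x y => ?_).continuous
    rw [Real.coe_toNNReal _ hM]
    exact hFl x y
  obtain ⟨B, hB⟩ := exists_bound_iteratedDeriv_of_periodic (contDiff_mollifier n)
    (mollifier_periodic n) 0
  have hc : Continuous fun θ => mollifier n (x - θ) :=
    (contDiff_mollifier n).continuous.comp (by fun_prop)
  have hi : ∀ G : ℝ → ℝ, Continuous G → Integrable (fun θ => G θ * mollifier n (x - θ)) torus :=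
    fun G hG => ((hG.mul hc).continuousOn.integrableOn_Icc).mono_set Ioc_subset_Icc_self
  -- The error is an average of `F θ - F x` over angles within `1 / (n + 1)` of `x` modulo a period.
  have h1 : mollify n w x - F x = ∫ θ, (F θ - F x) * mollifier n (x - θ) ∂torus := by
    have h2 : mollify n w x = ∫ θ, F θ * mollifier n (x - θ) ∂torus := by
      refine integral_congr_ae ?_
      filter_upwards [hFw] with θ hθ
      rw [hθ]
    simp only [sub_mul]
    rw [h2, integral_sub (hi F hFc) (hi _ continuous_const), integral_const_mul,
      integral_mollifier, mul_one]
  rw [h1]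
  refine abs_integral_mul_mollifier_le n x (Filter.Eventually.of_forall fun θ hθ => ?_)
  obtain ⟨m, hm⟩ := exists_int_of_mollifier_ne_zero hθ
  have h3 : F θ = F (θ + m * (2 * Real.pi)) := by
    have := (hFp.zsmul m) θ
    rw [zsmul_eq_mul] at this
    exact this.symm
  rw [h3]
  refine (hFl _ _).trans ?_
  rw [div_eq_mul_one_div]
  gcongr
  rw [abs_sub_comm, show x - (θ + m * (2 * Real.pi)) = x - θ - m * (2 * Real.pi) by ring]
  exact hm.le

/-! ### Regularization of the initial datum -/

/-- The data `φ n` are regularizations of the datum `F`, which is periodic and Lipschitz. -/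
structure IsRegularization (k : ℕ) (M : ℝ) (φ : ℕ → ℝ → ℝ → ℝ) (F : ℝ → ℝ → ℝ) : Prop where
  measurable_approx : ∀ n, Measurable fun x : ℝ × ℝ => φ n x.1 x.2
  contDiff_approx : ∀ n ν, ContDiff ℝ k fun θ => φ n θ ν
  approx_le : ∀ n ν, ∀ j ≤ k, ∀ θ, |iteratedDeriv j (fun θ => φ n θ ν) θ| ≤ M
  lipschitz : ∀ ν x y, |F x ν - F y ν| ≤ M * |x - y|
  periodic : ∀ ν, Function.Periodic (fun θ => F θ ν) (2 * Real.pi)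
  dist_le : ∀ n ν x, |φ n x ν - F x ν| ≤ M / ((n : ℝ) + 1)

theorem measurable_mollify {fin : ℝ → ℝ → ℝ} (hfin : Measurable fun x : ℝ × ℝ => fin x.1 x.2)
    (n : ℕ) : Measurable fun x : ℝ × ℝ => mollify n (fun θ => fin θ x.2) x.1 := by
  have h : Measurable fun x : (ℝ × ℝ) × ℝ => fin x.2 x.1.2 * mollifier n (x.1.1 - x.2) :=
    (hfin.comp (by fun_prop : Measurable fun x : (ℝ × ℝ) × ℝ => (x.2, x.1.2))).mul
      ((contDiff_mollifier n).continuous.measurable.comp (by fun_prop))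
  exact (h.stronglyMeasurable.integral_prod_right (ν := torus)).measurable

/-- The first weak derivative gives the Lipschitz bound. Setting everything to zero off a measurable
set `N` of good frequencies makes the properties hold for every frequency and keeps `φ n` jointly
measurable. -/
theorem exists_regularization {k : ℕ} (hk : 1 ≤ k) {g : ℝ → ℝ} {fin : ℝ → ℝ → ℝ} {M : ℝ}
    (hM : 0 ≤ M) (hfin : Measurable fun x : ℝ × ℝ => fin x.1 x.2)
    (h : ∀ j ≤ k, ∃ u : ℝ → ℝ → ℝ, IsWeakThetaDeriv g j fin u ∧
      ∀ᵐ ν ∂(freqLaw g), ∀ᵐ θ ∂torus, |u θ ν| ≤ M) :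
    ∃ φ F, IsRegularization k M φ F ∧ ∀ᵐ ν ∂(freqLaw g), ∀ᵐ θ ∂torus, F θ ν = fin θ ν := by
  choose! u hu huM using h
  have hgood : ∀ᵐ ν ∂(freqLaw g), Integrable (fun θ => fin θ ν) torus ∧
      ∀ j ≤ k, ∃ u : ℝ → ℝ, Integrable u torus ∧ (∀ᵐ θ ∂torus, |u θ| ≤ M) ∧
      ∀ ψ : ℝ → ℝ, ContDiff ℝ ∞ ψ → Function.Periodic ψ (2 * Real.pi) →
        ∫ θ, fin θ ν * iteratedDeriv j ψ θ ∂torus = (-1) ^ j * ∫ θ, u θ * ψ θ ∂torus := by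
    have h1 : ∀ᵐ ν ∂(freqLaw g), ∀ j ≤ k, ∃ u : ℝ → ℝ, Integrable u torus ∧
        (∀ᵐ θ ∂torus, |u θ| ≤ M) ∧
        ∀ ψ : ℝ → ℝ, ContDiff ℝ ∞ ψ → Function.Periodic ψ (2 * Real.pi) →
        ∫ θ, fin θ ν * iteratedDeriv j ψ θ ∂torus = (-1) ^ j * ∫ θ, u θ * ψ θ ∂torus := by
      rw [ae_all_iff]
      intro j
      by_cases hj : j ≤ k
      · filter_upwards [(hu j hj).weak, huM j hj] with ν h1 h2 _
        exact ⟨fun θ => u j θ ν, h1.2.1, h2, h1.2.2⟩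
      · exact Filter.Eventually.of_forall fun ν h => absurd h hj
    filter_upwards [(hu 0 (Nat.zero_le _)).weak, h1] with ν h2 h3
    exact ⟨h2.1, h3⟩
  obtain ⟨N, hN, hNm, hNg⟩ := hgood.exists_measurable_mem
  classical
  have hb : ∀ ν ∈ N, ∀ n, ContDiff ℝ k (mollify n fun θ => fin θ ν) ∧
      ∀ j ≤ k, ∀ x, |iteratedDeriv j (mollify n fun θ => fin θ ν) x| ≤ M := fun ν hν =>
    mollify_contDiff_and_bound (hNg ν hν).2
  have hF : ∀ ν ∈ N, ∃ F : ℝ → ℝ, (∀ x y, |F x - F y| ≤ M * |x - y|) ∧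
      Function.Periodic F (2 * Real.pi) ∧
      (∀ n x, |mollify n (fun θ => fin θ ν) x - F x| ≤ M / ((n : ℝ) + 1)) ∧
      ∀ᵐ θ ∂torus, F θ = fin θ ν := by
    intro ν hν
    refine exists_lipschitz_of_mollify (hNg ν hν).1 fun n x y => ?_
    have hd : Differentiable ℝ (mollify n fun θ => fin θ ν) :=
      (hb ν hν n).1.differentiable (by exact_mod_cast (by omega : k ≠ 0))
    have := convex_univ.norm_image_sub_le_of_norm_deriv_le (𝕜 := ℝ) (C := M)
      (fun z _ => hd z) (fun z _ => by
        have := (hb ν hν n).2 1 hk z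
        rwa [iteratedDeriv_one] at this) (mem_univ y) (mem_univ x)
    simpa using this
  choose! F hFl hFp hFd hFe using hF
  refine ⟨fun n θ ν => if ν ∈ N then mollify n (fun θ => fin θ ν) θ else 0,
    fun θ ν => if ν ∈ N then F ν θ else 0, ⟨fun n => ?_, fun n ν => ?_, fun n ν j hj θ => ?_,
    fun ν x y => ?_, fun ν x => ?_, fun n ν x => ?_⟩, ?_⟩
  · exact Measurable.ite (measurable_snd hNm) (measurable_mollify hfin n) measurable_const
  · by_cases hν : ν ∈ N
    · simpa only [if_pos hν] using (hb ν hν n).1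
    · simpa only [if_neg hν] using contDiff_const
  · by_cases hν : ν ∈ N
    · simpa only [if_pos hν] using (hb ν hν n).2 j hj θ
    · simp only [if_neg hν]
      rw [show (fun _ : ℝ => (0 : ℝ)) = 0 from rfl]
      simpa [iteratedDeriv_const] using hM
  · by_cases hν : ν ∈ N
    · simpa only [if_pos hν] using hFl ν hν x y
    · simp only [if_neg hν, sub_self, abs_zero]
      positivity
  · by_cases hν : ν ∈ N
    · simpa only [if_pos hν] using hFp ν hν x
    · simp only [if_neg hν]
  · by_cases hν : ν ∈ N
    · simpa only [if_pos hν] using hFd ν hν n x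
    · simp only [if_neg hν, sub_self, abs_zero]
      positivity
  · filter_upwards [hN] with ν hν
    simpa only [if_pos hν] using hFe ν hν

namespace IsRegularization

variable {k : ℕ} {M : ℝ} {φ : ℕ → ℝ → ℝ → ℝ} {F : ℝ → ℝ → ℝ}

theorem tendsto (h : IsRegularization k M φ F) (ν x : ℝ) :
    Filter.Tendsto (fun n => φ n x ν) Filter.atTop (nhds (F x ν)) := by
  rw [tendsto_iff_dist_tendsto_zero]
  refine squeeze_zero (fun _ => dist_nonneg) (fun n => h.dist_le n ν x) ?_
  have := (tendsto_one_div_add_atTop_nhds_zero_nat (𝕜 := ℝ)).const_mul M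
  simpa only [mul_zero, mul_one_div] using this

theorem continuous (h : IsRegularization k M φ F) (ν : ℝ) : Continuous fun x => F x ν := by
  have hM : 0 ≤ M := by
    have := (abs_nonneg _).trans (h.lipschitz 0 1 0)
    simpa using this
  refine (LipschitzWith.of_dist_le_mul (K := M.toNNReal) fun x y => ?_).continuous
  rw [Real.coe_toNNReal _ hM]
  exact h.lipschitz ν x y

theorem abs_le (h : IsRegularization k M φ F) (ν x : ℝ) : |F x ν| ≤ M :=
  le_of_tendsto (h.tendsto ν x).abs (Filter.Eventually.of_forall fun n => by
    simpa using h.approx_le n ν 0 (Nat.zero_le _) x)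

end IsRegularization

/-! ### The characteristic flow -/

/-- Difference quotients of the sine become a continuous function bounded by 1. Differences of two
characteristics then solve a linear equation exactly. -/
theorem sin_sub_sin_eq_sinc (a b : ℝ) :
    Real.sin a - Real.sin b = (a - b) * (Real.sinc ((a - b) / 2) * Real.cos ((a + b) / 2)) := by
  rw [Real.sin_sub_sin]
  rcases eq_or_ne a b with rfl | h
  · simp
  · rw [Real.sinc_of_ne_zero (div_ne_zero (sub_ne_zero.2 h) two_ne_zero)]
    field_simp [sub_ne_zero.2 h]

/-- `X s t θ` is the value at time `t` of the solution of `y' = ν - σ(t) sin y`, `y(s) = θ`. -/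
structure IsFlow (ν : ℝ) (σ : ℝ → ℝ) (X : ℝ → ℝ → ℝ → ℝ) : Prop where
  self : ∀ s θ, X s s θ = θ
  hasDerivAt : ∀ s θ t, HasDerivAt (fun t => X s t θ) (ν - σ t * Real.sin (X s t θ)) t

theorem lipschitzWith_velocity {ν c S : ℝ} (hS : |c| ≤ S) :
    LipschitzWith S.toNNReal fun y => ν - c * Real.sin y := by
  refine LipschitzWith.of_dist_le_mul fun x y => ?_
  rw [Real.coe_toNNReal _ ((abs_nonneg _).trans hS), Real.dist_eq, Real.dist_eq,
    sub_sub_sub_cancel_left, ← mul_sub, abs_mul, sin_sub_sin_eq_sinc, abs_mul, abs_mul,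
    abs_sub_comm y x]
  refine mul_le_mul hS ?_ (by positivity) ((abs_nonneg _).trans hS)
  refine mul_le_of_le_one_right (abs_nonneg _) ?_
  exact mul_le_one₀ (Real.abs_sinc_le_one _) (abs_nonneg _) (Real.abs_cos_le_one _)

theorem abs_velocity_le {ν c S : ℝ} (hS : |c| ≤ S) (y : ℝ) :
    |ν - c * Real.sin y| ≤ |ν| + S := by
  refine (abs_sub _ _).trans (add_le_add le_rfl ?_)
  rw [abs_mul]
  exact (mul_le_of_le_one_right (abs_nonneg _) (Real.abs_sin_le_one _)).trans hS

/-- Solutions on the intervals $(s-N,s+N)$ are glued by uniqueness. At time $t$ the index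
$\lfloor|t-s|\rfloor+1$ is large enough. -/
theorem exists_solution {ν S : ℝ} {σ : ℝ → ℝ} (hσ : Continuous σ) (hS : ∀ t, |σ t| ≤ S) (s θ : ℝ) :
    ∃ y : ℝ → ℝ, y s = θ ∧ ∀ t, HasDerivAt y (ν - σ t * Real.sin (y t)) t := by
  have hS0 : 0 ≤ S := (abs_nonneg _).trans (hS 0)
  have hloc : ∀ N : ℕ, ∃ y : ℝ → ℝ, y s = θ ∧
      ∀ t ∈ Ioo (s - N) (s + N), HasDerivAt y (ν - σ t * Real.sin (y t)) t := by
    intro N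
    have hN : (0 : ℝ) ≤ N := N.cast_nonneg
    let t₀ : Icc (s - N) (s + N) := ⟨s, by constructor <;> linarith⟩
    -- The speed is at most `|ν| + S`, so within time `N` no solution leaves this ball, and `N` is
    -- not restricted.
    have hP : IsPicardLindelof (fun t y => ν - σ t * Real.sin y) t₀ θ
        ((|ν| + S).toNNReal * N) 0 (|ν| + S).toNNReal S.toNNReal := by
      refine ⟨fun t _ => (lipschitzWith_velocity (hS t)).lipschitzOnWith, fun y _ => by fun_prop,
        fun t _ y _ => ?_, ?_⟩
      · rw [Real.coe_toNNReal _ (by positivity)]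
        exact abs_velocity_le (hS t) y
      · simp [t₀]
    obtain ⟨y, hy, hyd⟩ := hP.exists_eq_forall_mem_Icc_hasDerivWithinAt₀
    exact ⟨y, hy, fun t ht => (hyd t (Ioo_subset_Icc_self ht)).hasDerivAt (Icc_mem_nhds ht.1 ht.2)⟩
  choose y hy hyd using hloc
  have hcons : ∀ N M : ℕ, N ≤ M → ∀ t, |t - s| < N → y N t = y M t := by
    intro N M hNM t ht
    have hNM' : (N : ℝ) ≤ M := by exact_mod_cast hNM
    rw [abs_lt] at ht
    have hN : (0 : ℝ) < N := by linarith
    exact ODE_solution_unique_of_mem_Ioo (v := fun t y => ν - σ t * Real.sin y) (s := fun _ => univ)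
      (K := S.toNNReal) (a := s - N) (b := s + N) (t₀ := s)
      (fun t _ => (lipschitzWith_velocity (hS t)).lipschitzOnWith)
      ⟨by linarith, by linarith⟩ (fun t ht => ⟨hyd N t ht, mem_univ _⟩)
      (fun t ht => ⟨hyd M t ⟨by linarith [ht.1], by linarith [ht.2]⟩, mem_univ _⟩)
      ((hy N).trans (hy M).symm) ⟨by linarith, by linarith⟩
  have hglob : ∀ (M : ℕ) t, |t - s| < M → y (⌊|t - s|⌋₊ + 1) t = y M t := fun M t ht =>
    hcons _ M ((Nat.floor_lt (abs_nonneg _)).2 ht) t (by exact_mod_cast Nat.lt_floor_add_one _)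
  refine ⟨fun t => y (⌊|t - s|⌋₊ + 1) t, hy _, fun t => ?_⟩
  obtain ⟨M, hM⟩ := exists_nat_gt |t - s|
  have hev : ∀ᶠ t' in nhds t, |t' - s| < M :=
    (by fun_prop : Continuous fun t' => |t' - s|).continuousAt.eventually (gt_mem_nhds hM)
  simp only
  rw [hglob M t hM]
  have hM' := abs_lt.1 hM
  exact (hyd M t ⟨by linarith, by linarith⟩).congr_of_eventuallyEq (hev.mono fun t' => hglob M t')

theorem exists_isFlow {ν S : ℝ} {σ : ℝ → ℝ} (hσ : Continuous σ) (hS : ∀ t, |σ t| ≤ S) :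
    ∃ X, IsFlow ν σ X := by
  choose y hy hyd using fun s θ => exists_solution (ν := ν) hσ hS s θ
  exact ⟨fun s t θ => y s θ t, hy, fun s θ => hyd s θ⟩

/-! ### Dependence of the flow on time and on the initial angle. -/

section Flow

variable {ν S : ℝ} {σ : ℝ → ℝ} {X : ℝ → ℝ → ℝ → ℝ}

/-- The factor in `σ(r) (sin y₁ - sin y₂) = rate * (y₁ - y₂)`. -/
noncomputable def sinRate (σ : ℝ → ℝ) (y₁ y₂ : ℝ → ℝ) (r : ℝ) : ℝ :=
  σ r * (Real.sinc ((y₁ r - y₂ r) / 2) * Real.cos ((y₁ r + y₂ r) / 2))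

theorem continuous_sinRate (hσ : Continuous σ) {y₁ y₂ : ℝ → ℝ} (h₁ : Continuous y₁)
    (h₂ : Continuous y₂) : Continuous (sinRate σ y₁ y₂) :=
  hσ.mul ((Real.continuous_sinc.comp (by fun_prop)).mul (by fun_prop))

theorem abs_sinRate_le (hS : ∀ t, |σ t| ≤ S) (y₁ y₂ : ℝ → ℝ) (r : ℝ) :
    |sinRate σ y₁ y₂ r| ≤ S := by
  rw [sinRate, abs_mul, abs_mul]
  exact (mul_le_of_le_one_right (abs_nonneg _) (mul_le_one₀ (Real.abs_sinc_le_one _)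
    (abs_nonneg _) (Real.abs_cos_le_one _))).trans (hS r)

/-- The difference $u$ of two solutions satisfies $u'=-\mathrm{rate}\cdot u$, so multiplying by the
integrating factor gives a constant. Uniqueness, Lipschitz dependence and differentiability in the
angle all follow from this formula. -/
theorem sub_eq_mul_exp_integral (hσ : Continuous σ) {y₁ y₂ : ℝ → ℝ}
    (h₁ : ∀ t, HasDerivAt y₁ (ν - σ t * Real.sin (y₁ t)) t)
    (h₂ : ∀ t, HasDerivAt y₂ (ν - σ t * Real.sin (y₂ t)) t) (s t : ℝ) :
    y₁ t - y₂ t = (y₁ s - y₂ s) * Real.exp (-∫ r in s..t, sinRate σ y₁ y₂ r) := by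
  have hc : Continuous (sinRate σ y₁ y₂) := continuous_sinRate hσ
    (continuous_iff_continuousAt.2 fun t => (h₁ t).continuousAt)
    (continuous_iff_continuousAt.2 fun t => (h₂ t).continuousAt)
  have hI : ∀ r, HasDerivAt (fun r => ∫ u in s..r, sinRate σ y₁ y₂ u) (sinRate σ y₁ y₂ r) r :=
    fun r => intervalIntegral.integral_hasDerivAt_right (hc.intervalIntegrable _ _)
      (hc.stronglyMeasurableAtFilter _ _) hc.continuousAt
  have hH : ∀ r, HasDerivAt (fun r => (y₁ r - y₂ r) * Real.exp (∫ u in s..r, sinRate σ y₁ y₂ u))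
      0 r := by
    intro r
    refine (((h₁ r).sub (h₂ r)).mul (hI r).exp).congr_deriv ?_
    have h3 := sin_sub_sin_eq_sinc (y₁ r) (y₂ r)
    rw [show sinRate σ y₁ y₂ r = σ r * (Real.sinc ((y₁ r - y₂ r) / 2)
      * Real.cos ((y₁ r + y₂ r) / 2)) from rfl]
    simp only [Pi.sub_apply]
    linear_combination (-σ r * Real.exp (∫ u in s..r, sinRate σ y₁ y₂ u)) * h3
  have h4 := is_const_of_deriv_eq_zero (fun r => (hH r).differentiableAt)
    (fun r => (hH r).deriv) t s
  simp only [intervalIntegral.integral_same, Real.exp_zero, mul_one] at h4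
  rw [← h4, mul_assoc, ← Real.exp_add, add_neg_cancel, Real.exp_zero, mul_one]

theorem IsFlow.eq_of_solution (hX : IsFlow ν σ X) (hσ : Continuous σ) {y : ℝ → ℝ}
    (hy : ∀ t, HasDerivAt y (ν - σ t * Real.sin (y t)) t) (s t : ℝ) : X s t (y s) = y t := by
  have h := sub_eq_mul_exp_integral hσ (hX.hasDerivAt s (y s)) hy s t
  rwa [hX.self, sub_self, zero_mul, sub_eq_zero] at h

theorem IsFlow.comp (hX : IsFlow ν σ X) (hσ : Continuous σ) (s r t θ : ℝ) :
    X r t (X s r θ) = X s t θ :=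
  hX.eq_of_solution hσ (hX.hasDerivAt s θ) r t

theorem IsFlow.add_two_pi (hX : IsFlow ν σ X) (hσ : Continuous σ) (s t θ : ℝ) :
    X s t (θ + 2 * Real.pi) = X s t θ + 2 * Real.pi := by
  have h := hX.eq_of_solution hσ (y := fun t => X s t θ + 2 * Real.pi) (fun t => by
    rw [Real.sin_add_two_pi]
    exact (hX.hasDerivAt s θ t).add_const _) s t
  simpa only [hX.self] using h

theorem IsFlow.continuous (hX : IsFlow ν σ X) (s θ : ℝ) : Continuous fun t => X s t θ :=
  continuous_iff_continuousAt.2 fun t => (hX.hasDerivAt s θ t).continuousAt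

theorem IsFlow.abs_sub_time_le (hX : IsFlow ν σ X) (hS : ∀ t, |σ t| ≤ S) (s t t' θ : ℝ) :
    |X s t θ - X s t' θ| ≤ (|ν| + S) * |t - t'| := by
  have := convex_univ.norm_image_sub_le_of_norm_hasDerivWithin_le (C := |ν| + S)
    (fun r _ => (hX.hasDerivAt s θ r).hasDerivWithinAt) (fun r _ => abs_velocity_le (hS r) _)
    (mem_univ t') (mem_univ t)
  simpa using this

theorem IsFlow.sub_eq (hX : IsFlow ν σ X) (hσ : Continuous σ) (s t θ θ' : ℝ) :
    X s t θ - X s t θ' = (θ - θ') *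
      Real.exp (-∫ r in s..t, sinRate σ (fun r => X s r θ) (fun r => X s r θ') r) := by
  have := sub_eq_mul_exp_integral hσ (hX.hasDerivAt s θ) (hX.hasDerivAt s θ') s t
  simpa only [hX.self] using this

theorem IsFlow.abs_sub_le (hX : IsFlow ν σ X) (hσ : Continuous σ) (hS : ∀ t, |σ t| ≤ S)
    (s t θ θ' : ℝ) : |X s t θ - X s t θ'| ≤ |θ - θ'| * Real.exp (S * |t - s|) := by
  rw [hX.sub_eq hσ, abs_mul, Real.abs_exp]
  gcongr
  refine (neg_le_abs _).trans ?_
  rw [← Real.norm_eq_abs]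
  exact intervalIntegral.norm_integral_le_of_norm_le_const fun r _ => abs_sinRate_le hS _ _ r

theorem IsFlow.continuous_left (hX : IsFlow ν σ X) (hσ : Continuous σ) (hS : ∀ t, |σ t| ≤ S)
    (s t : ℝ) : Continuous (X s t) := by
  refine (LipschitzWith.of_dist_le_mul (K := (Real.exp (S * |t - s|)).toNNReal)
    fun x y => ?_).continuous
  rw [Real.coe_toNNReal _ (Real.exp_nonneg _), Real.dist_eq, Real.dist_eq, mul_comm]
  exact hX.abs_sub_le hσ hS s t x y

/-- The derivative of the flow with respect to the initial angle. -/
noncomputable def flowDeriv (σ : ℝ → ℝ) (X : ℝ → ℝ → ℝ → ℝ) (s t θ : ℝ) : ℝ :=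
  Real.exp (-∫ r in s..t, σ r * Real.cos (X s r θ))

/-- The difference quotient is exactly an exponential of the integrated rate. Dominated convergence
turns the rate into $\sigma\cos X$. -/
theorem IsFlow.hasDerivAt_left (hX : IsFlow ν σ X) (hσ : Continuous σ) (hS : ∀ t, |σ t| ≤ S)
    (s t θ : ℝ) : HasDerivAt (X s t) (flowDeriv σ X s t θ) θ := by
  rw [hasDerivAt_iff_tendsto_slope]
  have hc : ContinuousAt (fun θ' => ∫ r in s..t,
      sinRate σ (fun r => X s r θ') (fun r => X s r θ) r) θ := by
    refine intervalIntegral.continuousAt_of_dominated_interval (bound := fun _ => S)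
      (Filter.Eventually.of_forall fun θ' => (continuous_sinRate hσ (hX.continuous s θ')
        (hX.continuous s θ)).aestronglyMeasurable)
      (Filter.Eventually.of_forall fun θ' => Filter.Eventually.of_forall fun r _ =>
        abs_sinRate_le hS _ _ r) intervalIntegrable_const
      (Filter.Eventually.of_forall fun r _ => ?_)
    have h1 : Continuous fun θ' => X s r θ' := hX.continuous_left hσ hS s r
    exact (continuous_const.mul ((Real.continuous_sinc.comp (by fun_prop)).mul
      (Real.continuous_cos.comp (by fun_prop)))).continuousAt
  have hE : Filter.Tendsto (fun θ' => Real.exp (-∫ r in s..t,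
      sinRate σ (fun r => X s r θ') (fun r => X s r θ) r)) (nhdsWithin θ {θ}ᶜ)
      (nhds (flowDeriv σ X s t θ)) := by
    have h2 := (Real.continuous_exp.continuousAt.comp hc.neg).tendsto.mono_left
      (nhdsWithin_le_nhds (s := {θ}ᶜ))
    convert! h2 using 2
    simp [flowDeriv, sinRate]
  refine hE.congr' ?_
  filter_upwards [self_mem_nhdsWithin] with θ' hθ'
  have h3 : θ' - θ ≠ 0 := sub_ne_zero.2 hθ'
  rw [slope_def_field, hX.sub_eq hσ, mul_div_cancel_left₀ _ h3]

theorem flowDeriv_pos (s t θ : ℝ) : 0 < flowDeriv σ X s t θ := Real.exp_pos _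

theorem flowDeriv_le (hS : ∀ t, |σ t| ≤ S) (s t θ : ℝ) :
    flowDeriv σ X s t θ ≤ Real.exp (S * |t - s|) := by
  unfold flowDeriv
  gcongr
  refine (neg_le_abs _).trans ?_
  rw [← Real.norm_eq_abs]
  refine intervalIntegral.norm_integral_le_of_norm_le_const fun r _ => ?_
  rw [Real.norm_eq_abs, abs_mul]
  exact (mul_le_of_le_one_right (abs_nonneg _) (Real.abs_cos_le_one _)).trans (hS r)

theorem IsFlow.continuous_flowDeriv (hX : IsFlow ν σ X) (hσ : Continuous σ)
    (hS : ∀ t, |σ t| ≤ S) (s t : ℝ) : Continuous (flowDeriv σ X s t) := by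
  refine Real.continuous_exp.comp (Continuous.neg ?_)
  refine intervalIntegral.continuous_of_dominated_interval (bound := fun _ => S)
    (fun θ => ?_) (fun θ => Filter.Eventually.of_forall fun r _ => ?_) intervalIntegrable_const
    (Filter.Eventually.of_forall fun r _ => ?_)
  · have := hX.continuous s θ
    exact (by fun_prop : Continuous fun r => σ r * Real.cos (X s r θ)).aestronglyMeasurable
  · rw [Real.norm_eq_abs, abs_mul]
    exact (mul_le_of_le_one_right (abs_nonneg _) (Real.abs_cos_le_one _)).trans (hS r)
  · have : Continuous fun θ' => X s r θ' := hX.continuous_left hσ hS s r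
    fun_prop

theorem IsFlow.contDiff_one (hX : IsFlow ν σ X) (hσ : Continuous σ) (hS : ∀ t, |σ t| ≤ S)
    (s t : ℝ) : ContDiff ℝ 1 (X s t) := by
  rw [contDiff_one_iff_deriv]
  refine ⟨fun θ => (hX.hasDerivAt_left hσ hS s t θ).differentiableAt, ?_⟩
  rw [show deriv (X s t) = flowDeriv σ X s t from
    funext fun θ => (hX.hasDerivAt_left hσ hS s t θ).deriv]
  exact hX.continuous_flowDeriv hσ hS s t

/-- The field is only continuous in time, but smoothness in the angle survives integration. The
second derivative of the flow is needed for test functions composed with it. -/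
theorem IsFlow.contDiff_flowDeriv (hX : IsFlow ν σ X) (hσ : Continuous σ) (hS : ∀ t, |σ t| ≤ S)
    {s t : ℝ} (hst : s ≤ t) : ContDiff ℝ 1 (flowDeriv σ X s t) ∧ ∀ θ,
      |deriv (flowDeriv σ X s t) θ|
        ≤ Real.exp (S * (t - s)) * (S * Real.exp (S * (t - s)) * (t - s)) := by
  have hS0 : 0 ≤ S := (abs_nonneg _).trans (hS 0)
  have hd : ∀ r θ, HasDerivAt (fun θ => σ r * Real.cos (X s r θ))
      (σ r * (-Real.sin (X s r θ) * flowDeriv σ X s r θ)) θ := fun r θ =>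
    ((hX.hasDerivAt_left hσ hS s r θ).cos).const_mul (σ r)
  have hd1 : ∀ r ∈ Ioc s t, ∀ θ, |σ r * (-Real.sin (X s r θ) * flowDeriv σ X s r θ)|
      ≤ S * Real.exp (S * (t - s)) := by
    intro r hr θ
    rw [abs_mul, abs_mul, abs_neg, abs_of_pos (flowDeriv_pos _ _ _)]
    refine mul_le_mul (hS r) ?_ (by positivity [flowDeriv_pos (σ := σ) (X := X) s r θ]) hS0
    refine (mul_le_of_le_one_left (flowDeriv_pos _ _ _).le (Real.abs_sin_le_one _)).trans ?_
    refine (flowDeriv_le hS s r θ).trans ?_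
    rw [abs_of_nonneg (by linarith [hr.1])]
    gcongr
    exact hr.2
  have hb : ∀ l ≤ 1, ∀ r ∈ Ioc s t, ∀ θ ∈ univ, |iteratedDerivWithin l
      (fun θ => σ r * Real.cos (X s r θ)) univ θ| ≤ S * Real.exp (S * (t - s)) := by
    intro l hl r hr θ _
    rw [iteratedDerivWithin_univ]
    interval_cases l
    · rw [iteratedDeriv_zero, abs_mul]
      refine mul_le_mul (hS r) ((Real.abs_cos_le_one _).trans ?_) (abs_nonneg _) hS0
      exact Real.one_le_exp (mul_nonneg hS0 (by linarith))
    · rw [iteratedDeriv_one, (hd r θ).deriv]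
      exact hd1 r hr θ
  have h := contDiffOn_setIntegral_Ioc isOpen_univ (n := 1)
    (u := fun r θ => σ r * Real.cos (X s r θ)) hst (fun θ _ => by
      have := hX.continuous s θ
      exact (by fun_prop : Continuous fun r => σ r * Real.cos (X s r θ)).measurable)
    (fun r _ => (contDiff_const.mul
      (Real.contDiff_cos.comp (hX.contDiff_one hσ hS s r))).contDiffOn)
    ⟨_, hb⟩
  have hEq : flowDeriv σ X s t
      = fun θ => Real.exp (-∫ r in Ioc s t, σ r * Real.cos (X s r θ)) := by
    funext θ
    rw [flowDeriv, intervalIntegral.integral_of_le hst]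
  have hI := contDiffOn_univ.1 h.1
  refine ⟨?_, fun θ => ?_⟩
  · rw [hEq]
    exact hI.neg.exp
  have h2 := h.2 1 le_rfl θ (mem_univ _) (fun _ => S * Real.exp (S * (t - s))) continuous_const
    (fun r hr => hb 1 le_rfl r hr θ (mem_univ _))
  rw [iteratedDerivWithin_univ, iteratedDeriv_one, intervalIntegral.integral_const,
    smul_eq_mul, mul_comm (t - s)] at h2
  have h3 := ((hI.differentiable (by norm_num)) θ).hasDerivAt.neg.exp
  have h4 := flowDeriv_le (X := X) hS s t θ
  rw [abs_of_nonneg (sub_nonneg.2 hst)] at h4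
  have h5 : flowDeriv σ X s t θ = Real.exp (-∫ r in Ioc s t, σ r * Real.cos (X s r θ)) :=
    congrFun hEq θ
  rw [hEq]
  rw [show deriv (fun θ => Real.exp (-∫ r in Ioc s t, σ r * Real.cos (X s r θ))) θ = _ from
    h3.deriv, abs_mul, abs_neg]
  rw [h5] at h4
  refine mul_le_mul ?_ h2 (abs_nonneg _) (Real.exp_nonneg _)
  rw [abs_of_pos (Real.exp_pos _)]
  exact h4

end Flow

/-! ### Representation of weak solutions by characteristics -/

/-- `h` is a weak solution of `∂_t h + ∂_θ (h (ν - σ(t) sin θ)) = 0` with initial datum `w`. -/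
structure IsWeakSolution (ν S : ℝ) (σ : ℝ → ℝ) (w : ℝ → ℝ) (h : ℝ → ℝ → ℝ) : Prop where
  measurable : Measurable fun x : ℝ × ℝ => h x.1 x.2
  measurable_field : Measurable σ
  field_le : ∀ t, 0 ≤ t → |σ t| ≤ S
  nonneg : ∀ t, 0 ≤ t → ∀ᵐ θ ∂torus, 0 ≤ h t θ
  integrable : ∀ t, 0 ≤ t → Integrable (h t) torus
  weak : ∀ t, 0 ≤ t → ∀ ψ : ℝ → ℝ, ContDiff ℝ 1 ψ → Function.Periodic ψ (2 * Real.pi) →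
    ∫ θ, h t θ * ψ θ ∂torus = (∫ θ, w θ * ψ θ ∂torus)
      + ∫ s in (0 : ℝ)..t, ∫ θ, h s θ * (ν - σ s * Real.sin θ) * deriv ψ θ ∂torus

namespace IsWeakSolution

variable {ν S : ℝ} {σ w : ℝ → ℝ} {h : ℝ → ℝ → ℝ}

theorem mass (H : IsWeakSolution ν S σ w h) {t : ℝ} (ht : 0 ≤ t) :
    ∫ θ, h t θ ∂torus = ∫ θ, w θ ∂torus := by
  have := H.weak t ht (fun _ => 1) contDiff_const (fun _ => rfl)
  simpa using this

theorem mass_nonneg (H : IsWeakSolution ν S σ w h) : 0 ≤ ∫ θ, w θ ∂torus := by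
  rw [← H.mass le_rfl]
  exact integral_nonneg_of_ae (H.nonneg 0 le_rfl)

theorem integrable_mul (H : IsWeakSolution ν S σ w h) {t : ℝ} (ht : 0 ≤ t) {χ : ℝ → ℝ}
    (hχ : Continuous χ) {B : ℝ} (hB : ∀ θ, |χ θ| ≤ B) :
    Integrable (fun θ => h t θ * χ θ) torus :=
  (H.integrable t ht).mul_bdd (c := B) hχ.aestronglyMeasurable (Filter.Eventually.of_forall hB)

theorem abs_integral_le (H : IsWeakSolution ν S σ w h) {t : ℝ} (ht : 0 ≤ t) {χ : ℝ → ℝ}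
    {B : ℝ} (hB : ∀ θ, |χ θ| ≤ B) :
    |∫ θ, h t θ * χ θ ∂torus| ≤ B * ∫ θ, w θ ∂torus := by
  rw [← H.mass ht, ← integral_const_mul, ← Real.norm_eq_abs]
  refine norm_integral_le_of_norm_le ((H.integrable t ht).const_mul B) ?_
  filter_upwards [H.nonneg t ht] with θ hθ
  rw [Real.norm_eq_abs, abs_mul, abs_of_nonneg hθ, mul_comm]
  exact mul_le_mul_of_nonneg_right (hB θ) hθ

theorem measurable_integral (H : IsWeakSolution ν S σ w h) {χ : ℝ → ℝ} (hχ : Measurable χ) :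
    Measurable fun t => ∫ θ, h t θ * χ θ ∂torus := by
  have h1 : Measurable fun x : ℝ × ℝ => h x.1 x.2 * χ x.2 :=
    H.measurable.mul (hχ.comp measurable_snd)
  exact (h1.stronglyMeasurable.integral_prod_right (ν := torus)).measurable

theorem flux_eq (H : IsWeakSolution ν S σ w h) {t : ℝ} (ht : 0 ≤ t) {χ : ℝ → ℝ}
    (hχ : Continuous χ) {B : ℝ} (hB : ∀ θ, |χ θ| ≤ B) :
    ∫ θ, h t θ * (ν - σ t * Real.sin θ) * χ θ ∂torus
      = ν * (∫ θ, h t θ * χ θ ∂torus) - σ t * ∫ θ, h t θ * (Real.sin θ * χ θ) ∂torus := by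
  have hB2 : ∀ θ, |Real.sin θ * χ θ| ≤ B := fun θ => by
    rw [abs_mul]
    exact (mul_le_of_le_one_left (abs_nonneg _) (Real.abs_sin_le_one _)).trans (hB θ)
  rw [← integral_const_mul, ← integral_const_mul, ← integral_sub
    ((H.integrable_mul ht hχ hB).const_mul _)
    ((H.integrable_mul ht (χ := fun θ => Real.sin θ * χ θ) (Real.continuous_sin.mul hχ)
      hB2).const_mul _)]
  refine integral_congr_ae (Filter.Eventually.of_forall fun θ => ?_)
  simp only
  ring

theorem increment (H : IsWeakSolution ν S σ w h) {ψ χ : ℝ → ℝ} (hψ : ∀ θ, HasDerivAt ψ (χ θ) θ)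
    (hp : Function.Periodic ψ (2 * Real.pi)) (hχ : Continuous χ) {B : ℝ} (hB : ∀ θ, |χ θ| ≤ B)
    {a b : ℝ} (ha : 0 ≤ a) (hab : a ≤ b) :
    IntervalIntegrable (fun t => ν * (∫ θ, h t θ * χ θ ∂torus)
        - σ t * ∫ θ, h t θ * (Real.sin θ * χ θ) ∂torus) volume a b ∧
    (∫ θ, h b θ * ψ θ ∂torus) - ∫ θ, h a θ * ψ θ ∂torus
      = ∫ t in a..b, (ν * (∫ θ, h t θ * χ θ ∂torus)
        - σ t * ∫ θ, h t θ * (Real.sin θ * χ θ) ∂torus) := by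
  have hd : deriv ψ = χ := funext fun θ => (hψ θ).deriv
  have hC1 : ContDiff ℝ 1 ψ := by
    rw [contDiff_one_iff_deriv, hd]
    exact ⟨fun θ => (hψ θ).differentiableAt, hχ⟩
  have hB2 : ∀ θ, |Real.sin θ * χ θ| ≤ B := fun θ => by
    rw [abs_mul]
    exact (mul_le_of_le_one_left (abs_nonneg _) (Real.abs_sin_le_one _)).trans (hB θ)
  set G : ℝ → ℝ := fun t => ν * (∫ θ, h t θ * χ θ ∂torus)
        - σ t * ∫ θ, h t θ * (Real.sin θ * χ θ) ∂torus with hG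
  have hGm : Measurable G := ((H.measurable_integral hχ.measurable).const_mul ν).sub
    (H.measurable_field.mul (H.measurable_integral (Real.continuous_sin.mul hχ).measurable))
  have hm := H.mass_nonneg
  have hGb : ∀ t, 0 ≤ t → |G t| ≤ |ν| * (B * ∫ θ, w θ ∂torus) + S * (B * ∫ θ, w θ ∂torus) := by
    intro t ht
    refine (abs_sub _ _).trans (add_le_add ?_ ?_)
    · rw [abs_mul]
      exact mul_le_mul_of_nonneg_left (H.abs_integral_le ht hB) (abs_nonneg _)
    · rw [abs_mul]
      exact mul_le_mul (H.field_le t ht) (H.abs_integral_le ht hB2) (abs_nonneg _)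
        ((abs_nonneg _).trans (H.field_le t ht))
  have hint : ∀ x y, 0 ≤ x → 0 ≤ y → IntervalIntegrable G volume x y := by
    intro x y hx hy
    refine (intervalIntegrable_const (c := |ν| * (B * ∫ θ, w θ ∂torus)
      + S * (B * ∫ θ, w θ ∂torus))).mono_fun' hGm.aestronglyMeasurable ?_
    filter_upwards [ae_restrict_mem measurableSet_uIoc] with t ht
    exact hGb t ((le_min hx hy).trans ht.1.le)
  refine ⟨hint a b ha (ha.trans hab), ?_⟩
  have hflux : ∀ t, 0 ≤ t → ∫ s in (0 : ℝ)..t, ∫ θ, h s θ * (ν - σ s * Real.sin θ)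
      * deriv ψ θ ∂torus = ∫ s in (0 : ℝ)..t, G s := by
    intro t ht
    refine intervalIntegral.integral_congr fun s hs => ?_
    rw [uIcc_of_le ht] at hs
    simp only [hd]
    exact H.flux_eq hs.1 hχ hB
  rw [H.weak b (ha.trans hab) ψ hC1 hp, H.weak a ha ψ hC1 hp, hflux a ha,
    hflux b (ha.trans hab), add_sub_add_left_eq_sub,
    intervalIntegral.integral_interval_sub_left (hint _ _ le_rfl (ha.trans hab))
      (hint _ _ le_rfl ha)]

theorem abs_increment_le (H : IsWeakSolution ν S σ w h) {ψ χ : ℝ → ℝ}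
    (hψ : ∀ θ, HasDerivAt ψ (χ θ) θ)
    (hp : Function.Periodic ψ (2 * Real.pi)) (hχ : Continuous χ) {B : ℝ} (hB : ∀ θ, |χ θ| ≤ B)
    {a b : ℝ} (ha : 0 ≤ a) (hab : a ≤ b) :
    |(∫ θ, h b θ * ψ θ ∂torus) - ∫ θ, h a θ * ψ θ ∂torus|
      ≤ (|ν| + S) * (B * ∫ θ, w θ ∂torus) * (b - a) := by
  have hB2 : ∀ θ, |Real.sin θ * χ θ| ≤ B := fun θ => by
    rw [abs_mul]
    exact (mul_le_of_le_one_left (abs_nonneg _) (Real.abs_sin_le_one _)).trans (hB θ)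
  rw [(H.increment hψ hp hχ hB ha hab).2, ← abs_of_nonneg (sub_nonneg.2 hab),
    ← Real.norm_eq_abs]
  refine intervalIntegral.norm_integral_le_of_norm_le_const fun t ht => ?_
  rw [uIoc_of_le hab] at ht
  have ht0 : 0 ≤ t := ha.trans ht.1.le
  rw [Real.norm_eq_abs, add_mul]
  refine (abs_sub _ _).trans (add_le_add ?_ ?_)
  · rw [abs_mul]
    exact mul_le_mul_of_nonneg_left (H.abs_integral_le ht0 hB) (abs_nonneg _)
  · rw [abs_mul]
    exact mul_le_mul (H.field_le t ht0) (H.abs_integral_le ht0 hB2) (abs_nonneg _)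
      ((abs_nonneg _).trans (H.field_le t ht0))

end IsWeakSolution

theorem abs_sub_le_of_hasDerivAt {χ χ' : ℝ → ℝ} (h : ∀ θ, HasDerivAt χ (χ' θ) θ) {B : ℝ}
    (hB : ∀ θ, |χ' θ| ≤ B) (x y : ℝ) : |χ x - χ y| ≤ B * |x - y| := by
  have := convex_univ.norm_image_sub_le_of_norm_hasDerivWithin_le (C := B)
    (fun r _ => (h r).hasDerivWithinAt) (fun r _ => hB r) (mem_univ y) (mem_univ x)
  simpa using this

theorem periodic_of_hasDerivAt {ψ χ : ℝ → ℝ} {c : ℝ} (h : ∀ θ, HasDerivAt ψ (χ θ) θ)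
    (hp : Function.Periodic ψ c) : Function.Periodic χ c := by
  intro θ
  have h1 := (h (θ + c)).comp_add_const θ c
  rw [show (fun x => ψ (x + c)) = ψ from funext hp] at h1
  exact h1.unique (h θ)

/-- Over a short interval the weak solution and the transported test function have the same first
order term $\nu(b-a)P(a)-WQ(a)$, with $W=\int_a^b\sigma$. Each remainder is at most
$2B(|\nu|+S)^2m(b-a)^2$, where $m$ is the mass. Only test functions independent of time are used. -/
theorem IsWeakSolution.abs_transport_le {ν S : ℝ} {σ w : ℝ → ℝ} {h : ℝ → ℝ → ℝ}
    {X : ℝ → ℝ → ℝ → ℝ} (H : IsWeakSolution ν S σ w h) (hX : IsFlow ν σ X) (hσ : Continuous σ)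
    (hS : ∀ t, |σ t| ≤ S) {ψ χ χ' : ℝ → ℝ}
    (hψ : ∀ θ, HasDerivAt ψ (χ θ) θ) (hχ : ∀ θ, HasDerivAt χ (χ' θ) θ) (hχ' : Continuous χ')
    (hp : Function.Periodic ψ (2 * Real.pi)) {B : ℝ} (hB : ∀ θ, |χ θ| ≤ B)
    (hB' : ∀ θ, |χ' θ| ≤ B) {a b : ℝ} (ha : 0 ≤ a) (hab : a ≤ b) :
    |(∫ θ, h b θ * ψ θ ∂torus) - ∫ θ, h a θ * ψ (X a b θ) ∂torus|
      ≤ 4 * B * (|ν| + S) ^ 2 * (∫ θ, w θ ∂torus) * (b - a) ^ 2 := by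
  set m := ∫ θ, w θ ∂torus with hm
  have hm0 : 0 ≤ m := H.mass_nonneg
  have hB0 : 0 ≤ B := (abs_nonneg _).trans (hB 0)
  have hS0 : 0 ≤ S := (abs_nonneg _).trans (hS 0)
  have hba : 0 ≤ b - a := sub_nonneg.2 hab
  have hψc : Continuous ψ := continuous_iff_continuousAt.2 fun θ => (hψ θ).continuousAt
  have hχc : Continuous χ := continuous_iff_continuousAt.2 fun θ => (hχ θ).continuousAt
  have hχp := periodic_of_hasDerivAt hψ hp
  set ζ : ℝ → ℝ := fun θ => Real.sin θ * χ θ with hζ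
  set ζ' : ℝ → ℝ := fun θ => Real.cos θ * χ θ + Real.sin θ * χ' θ with hζ'
  have hζd : ∀ θ, HasDerivAt ζ (ζ' θ) θ := fun θ => (Real.hasDerivAt_sin θ).mul (hχ θ)
  have hζp : Function.Periodic ζ (2 * Real.pi) := fun θ => by
    simp only [hζ, hχp θ, Real.sin_add_two_pi]
  have hζb : ∀ θ, |ζ θ| ≤ B := fun θ => by
    rw [abs_mul]
    exact (mul_le_of_le_one_left (abs_nonneg _) (Real.abs_sin_le_one _)).trans (hB θ)
  have hζb' : ∀ θ, |ζ' θ| ≤ 2 * B := fun θ => by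
    refine (abs_add_le _ _).trans ?_
    rw [abs_mul, abs_mul, two_mul]
    exact add_le_add
      ((mul_le_of_le_one_left (abs_nonneg _) (Real.abs_cos_le_one _)).trans (hB θ))
      ((mul_le_of_le_one_left (abs_nonneg _) (Real.abs_sin_le_one _)).trans (hB' θ))
  have hζc : Continuous ζ := continuous_iff_continuousAt.2 fun θ => (hζd θ).continuousAt
  have hζc' : Continuous ζ' := by fun_prop
  have hB2 : ∀ θ, |χ' θ| ≤ 2 * B := fun θ => (hB' θ).trans (by linarith)
  set P : ℝ → ℝ := fun t => ∫ θ, h t θ * χ θ ∂torus with hP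
  set Q : ℝ → ℝ := fun t => ∫ θ, h t θ * ζ θ ∂torus with hQ
  set W : ℝ := ∫ t in a..b, σ t with hW
  -- the increment in time
  obtain ⟨hint, hinc⟩ := H.increment hψ hp hχc hB ha hab
  have hlin : ∫ t in a..b, (ν * P a - σ t * Q a) = ν * (b - a) * P a - W * Q a := by
    rw [intervalIntegral.integral_sub intervalIntegrable_const
      ((by fun_prop : Continuous fun t => σ t * Q a).intervalIntegrable _ _),
        intervalIntegral.integral_const,
      intervalIntegral.integral_mul_const, smul_eq_mul]
    ring
  have h1 : |(∫ θ, h b θ * ψ θ ∂torus) - (∫ θ, h a θ * ψ θ ∂torus)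
      - (ν * (b - a) * P a - W * Q a)| ≤ 2 * B * (|ν| + S) ^ 2 * m * (b - a) ^ 2 := by
    rw [hinc, ← hlin, ← intervalIntegral.integral_sub hint ((by fun_prop :
      Continuous fun t => ν * P a - σ t * Q a).intervalIntegrable _ _)]
    have h2 : ∀ t ∈ uIoc a b, ‖(ν * P t - σ t * Q t) - (ν * P a - σ t * Q a)‖
        ≤ (|ν| + S) * ((|ν| + S) * (2 * B * m) * (b - a)) := by
      intro t ht
      rw [uIoc_of_le hab] at ht
      have hta : t - a ≤ b - a := by linarith [ht.2]
      have hp1 := H.abs_increment_le hχ hχp hχ' hB2 ha ht.1.le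
      have hq1 := H.abs_increment_le hζd hζp hζc' hζb' ha ht.1.le
      have hle : (|ν| + S) * (2 * B * m) * (t - a) ≤ (|ν| + S) * (2 * B * m) * (b - a) := by
        gcongr
      rw [show (ν * P t - σ t * Q t) - (ν * P a - σ t * Q a)
        = ν * (P t - P a) - σ t * (Q t - Q a) by ring, Real.norm_eq_abs, add_mul]
      refine (abs_sub _ _).trans (add_le_add ?_ ?_)
      · rw [abs_mul]
        exact mul_le_mul_of_nonneg_left (hp1.trans hle) (abs_nonneg _)
      · rw [abs_mul]
        exact mul_le_mul (hS t) (hq1.trans hle) (abs_nonneg _) hS0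
    refine (intervalIntegral.norm_integral_le_of_norm_le_const h2).trans (le_of_eq ?_)
    rw [abs_of_nonneg hba]
    ring
  -- the increment along the flow
  have h3 : ∀ θ, |ψ (X a b θ) - ψ θ - (ν * (b - a) * χ θ - W * ζ θ)|
      ≤ 2 * B * (|ν| + S) ^ 2 * (b - a) ^ 2 := by
    intro θ
    set u : ℝ → ℝ := fun r => ψ (X a r θ) - (ν * (r - a) * χ θ - (∫ t in a..r, σ t) * ζ θ) with hu
    have hI : ∀ r, HasDerivAt (fun r => ∫ t in a..r, σ t) (σ r) r := fun r =>
      intervalIntegral.integral_hasDerivAt_right (hσ.intervalIntegrable _ _)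
        (hσ.stronglyMeasurableAtFilter _ _) hσ.continuousAt
    have hud : ∀ r, HasDerivAt u (χ (X a r θ) * (ν - σ r * Real.sin (X a r θ))
        - (ν * χ θ - σ r * ζ θ)) r := by
      intro r
      have e1 := (hψ (X a r θ)).comp r (hX.hasDerivAt a θ r)
      have e2 := ((((hasDerivAt_id r).sub_const a).const_mul ν).mul_const (χ θ)).sub
        ((hI r).mul_const (ζ θ))
      refine (e1.sub e2).congr_deriv ?_
      ring
    have hub : ∀ r ∈ Ico a b, ‖χ (X a r θ) * (ν - σ r * Real.sin (X a r θ))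
        - (ν * χ θ - σ r * ζ θ)‖ ≤ (|ν| + S) * (2 * B * ((|ν| + S) * (b - a))) := by
      intro r hr
      have e1 := hX.abs_sub_time_le hS a r a θ
      rw [hX.self, abs_of_nonneg (sub_nonneg.2 hr.1)] at e1
      have e2 : 2 * B * |X a r θ - θ| ≤ 2 * B * ((|ν| + S) * (b - a)) := by
        refine mul_le_mul_of_nonneg_left (e1.trans ?_) (by positivity)
        gcongr
        exact hr.2.le
      have e3 := (abs_sub_le_of_hasDerivAt hχ hB2 (X a r θ) θ).trans e2
      have e4 := (abs_sub_le_of_hasDerivAt hζd hζb' (X a r θ) θ).trans e2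
      rw [show χ (X a r θ) * (ν - σ r * Real.sin (X a r θ)) - (ν * χ θ - σ r * ζ θ)
        = ν * (χ (X a r θ) - χ θ) - σ r * (ζ (X a r θ) - ζ θ) by simp only [hζ]; ring,
        Real.norm_eq_abs, add_mul]
      refine (abs_sub _ _).trans (add_le_add ?_ ?_)
      · rw [abs_mul]
        exact mul_le_mul_of_nonneg_left e3 (abs_nonneg _)
      · rw [abs_mul]
        exact mul_le_mul (hS r) e4 (abs_nonneg _) hS0
    have h4 := norm_image_sub_le_of_norm_deriv_right_le_segment (f := u) (a := a) (b := b)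
      (HasDerivAt.continuousOn fun r _ => hud r) (fun r _ => (hud r).hasDerivWithinAt) hub b
      ⟨hab, le_rfl⟩
    have h5 : u b - u a = ψ (X a b θ) - ψ θ - (ν * (b - a) * χ θ - W * ζ θ) := by
      simp only [hu, hX.self, intervalIntegral.integral_same, hW]
      ring
    rw [h5, Real.norm_eq_abs] at h4
    refine h4.trans (le_of_eq ?_)
    ring
  obtain ⟨Bψ, hBψ⟩ : ∃ B, ∀ θ, |ψ θ| ≤ B := by
    obtain ⟨B, hB⟩ := isCompact_Icc.exists_bound_of_continuousOn (s := Icc 0 (2 * Real.pi))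
      hψc.continuousOn
    refine ⟨B, fun y => ?_⟩
    obtain ⟨x, hx, hyx⟩ := hp.exists_mem_Ico₀ Real.two_pi_pos y
    rw [hyx]
    exact hB x ⟨hx.1, hx.2.le⟩
  have hXc : Continuous (X a b) := hX.continuous_left hσ hS a b
  have i1 := H.integrable_mul ha (χ := fun θ => ψ (X a b θ)) (hψc.comp hXc) (B := Bψ) fun θ => hBψ _
  have i2 := H.integrable_mul ha hψc hBψ
  have i3 := H.integrable_mul ha hχc hB
  have i4 := H.integrable_mul ha hζc hζb
  have h6 : (∫ θ, h a θ * ψ (X a b θ) ∂torus) - (∫ θ, h a θ * ψ θ ∂torus)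
      - (ν * (b - a) * P a - W * Q a)
      = ∫ θ, h a θ * (ψ (X a b θ) - ψ θ - (ν * (b - a) * χ θ - W * ζ θ)) ∂torus := by
    simp only [hP, hQ]
    have j1 : Integrable (fun θ => h a θ * ψ (X a b θ) - h a θ * ψ θ) torus := i1.sub i2
    have j2 : Integrable (fun θ => ν * (b - a) * (h a θ * χ θ) - W * (h a θ * ζ θ)) torus :=
      (i3.const_mul _).sub (i4.const_mul _)
    rw [← integral_const_mul, ← integral_const_mul, ← integral_sub (i3.const_mul _)
      (i4.const_mul _), ← integral_sub i1 i2, ← integral_sub j1 j2]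
    refine integral_congr_ae (Filter.Eventually.of_forall fun θ => ?_)
    ring
  have h7 := H.abs_integral_le ha h3
  rw [← h6] at h7
  rw [show (∫ θ, h b θ * ψ θ ∂torus) - ∫ θ, h a θ * ψ (X a b θ) ∂torus
    = ((∫ θ, h b θ * ψ θ ∂torus) - (∫ θ, h a θ * ψ θ ∂torus)
      - (ν * (b - a) * P a - W * Q a)) - ((∫ θ, h a θ * ψ (X a b θ) ∂torus)
      - (∫ θ, h a θ * ψ θ ∂torus) - (ν * (b - a) * P a - W * Q a)) by ring]
  refine (abs_sub _ _).trans ?_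
  linarith

/-- Splitting `[0, t]` into `n + 1` equal pieces bounds the total increment by a constant over `n +
1`. -/
theorem eq_of_abs_sub_le_sq {G : ℝ → ℝ} {K t : ℝ} (ht : 0 ≤ t)
    (h : ∀ a b, 0 ≤ a → a ≤ b → b ≤ t → |G b - G a| ≤ K * (b - a) ^ 2) : G t = G 0 := by
  have h1 : ∀ n : ℕ, |G t - G 0| ≤ K * t ^ 2 * (1 / ((n : ℝ) + 1)) := by
    intro n
    have hn : (0 : ℝ) < (n : ℝ) + 1 := by positivity
    have h2 := Finset.sum_range_sub (fun i : ℕ => G (i * (t / (n + 1)))) (n + 1)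
    simp only [Nat.cast_zero, zero_mul, Nat.cast_add, Nat.cast_one] at h2
    rw [mul_div_cancel₀ _ hn.ne'] at h2
    rw [← h2]
    refine (Finset.abs_sum_le_sum_abs _ _).trans ?_
    refine (Finset.sum_le_sum (g := fun _ => K * (t / (n + 1)) ^ 2) fun i hi => ?_).trans
      (le_of_eq ?_)
    · have hi' : (i : ℝ) + 1 ≤ n + 1 := by
        exact_mod_cast Finset.mem_range.1 hi
      have hd : 0 ≤ t / (n + 1) := by positivity
      have h3 := h (i * (t / (n + 1))) ((i + 1) * (t / (n + 1))) (by positivity) (by linarith) (by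
        calc ((i : ℝ) + 1) * (t / (n + 1)) ≤ (n + 1) * (t / (n + 1)) := by gcongr
          _ = t := mul_div_cancel₀ _ hn.ne')
      refine h3.trans (le_of_eq ?_)
      ring
    · rw [Finset.sum_const, Finset.card_range, nsmul_eq_mul]
      push_cast
      field_simp
  have h4 := (tendsto_one_div_add_atTop_nhds_zero_nat (𝕜 := ℝ)).const_mul (K * t ^ 2)
  rw [mul_zero] at h4
  have h5 := ge_of_tendsto' h4 h1
  exact sub_eq_zero.1 (abs_nonpos_iff.1 h5)

/-- The flow commutes with translation by $2\pi$, so it maps a period onto an interval of length one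
period, over which `Φ` has the same integral. -/
theorem IsFlow.integral_comp_mul_flowDeriv {ν S : ℝ} {σ : ℝ → ℝ} {X : ℝ → ℝ → ℝ → ℝ}
    (hX : IsFlow ν σ X) (hσ : Continuous σ) (hS : ∀ t, |σ t| ≤ S) (s t : ℝ) {Φ : ℝ → ℝ}
    (hΦ : Continuous Φ) (hp : Function.Periodic Φ (2 * Real.pi)) :
    ∫ θ, Φ (X s t θ) * flowDeriv σ X s t θ ∂torus = ∫ θ, Φ θ ∂torus := by
  rw [integral_torus_eq, integral_torus_eq]
  have h := intervalIntegral.integral_comp_mul_deriv (a := 0) (b := 2 * Real.pi) (f := X s t)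
    (f' := flowDeriv σ X s t) (g := Φ) (fun θ _ => hX.hasDerivAt_left hσ hS s t θ)
    (hX.continuous_flowDeriv hσ hS s t).continuousOn hΦ
  simp only [Function.comp_apply] at h
  rw [h]
  have h2 := hX.add_two_pi hσ s t 0
  rw [zero_add] at h2
  rw [h2]
  have h3 := hp.intervalIntegral_add_eq (X s t 0) 0
  rwa [zero_add] at h3

theorem ae_eq_zero_of_forall_smooth {w : ℝ → ℝ} (hw : Integrable w torus)
    (h : ∀ ψ : ℝ → ℝ, ContDiff ℝ ∞ ψ → Function.Periodic ψ (2 * Real.pi) →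
      ∫ θ, w θ * ψ θ ∂torus = 0) : ∀ᵐ θ ∂torus, w θ = 0 := by
  filter_upwards [ae_tendsto_mollify hw] with x hx
  have h0 : ∀ n, mollify n w x = 0 := fun n =>
    h _ ((contDiff_mollifier n).comp (contDiff_const.sub contDiff_id)) fun θ => by
      rw [← mollifier_periodic n, sub_add_eq_sub_sub, sub_add_cancel]
  simp only [h0] at hx
  exact tendsto_nhds_unique hx tendsto_const_nhds

/-- For a smooth test function $\varphi$, the integral of $h(s)\,\varphi(X_{s\to t})$ has increments
of second order in the time step, hence is constant in $s$. Comparing $s=t$ with $s=0$ and changing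
variables identifies $h(t)$. -/
theorem IsWeakSolution.eq_flow {ν S : ℝ} {σ w F : ℝ → ℝ} {h : ℝ → ℝ → ℝ}
    {X : ℝ → ℝ → ℝ → ℝ} (H : IsWeakSolution ν S σ w h) (hX : IsFlow ν σ X) (hσ : Continuous σ)
    (hS : ∀ t, |σ t| ≤ S) (hF : Continuous F) (hFp : Function.Periodic F (2 * Real.pi))
    (hFw : ∀ᵐ θ ∂torus, F θ = w θ) {t : ℝ} (ht : 0 ≤ t) :
    ∀ᵐ θ ∂torus, h t θ = F (X t 0 θ) * flowDeriv σ X t 0 θ := by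
  have hS0 : 0 ≤ S := (abs_nonneg _).trans (hS 0)
  have hcE := hX.continuous_flowDeriv hσ hS t 0
  have hcX := hX.continuous_left hσ hS t 0
  have hcX' := hX.continuous_left hσ hS 0 t
  have hcont : ∀ Φ : ℝ → ℝ, Continuous Φ → Integrable Φ torus := fun Φ hΦ =>
    hΦ.continuousOn.integrableOn_Icc.mono_set Ioc_subset_Icc_self
  have hrep : ∀ φ : ℝ → ℝ, ContDiff ℝ ∞ φ → Function.Periodic φ (2 * Real.pi) →
      ∫ θ, h t θ * φ θ ∂torus = ∫ θ, F (X t 0 θ) * flowDeriv σ X t 0 θ * φ θ ∂torus := by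
    intro φ hφ hφp
    have hsmooth : ∀ b, ContDiff ℝ 1 (fun θ => φ (X b t θ)) := fun b =>
      (hφ.of_le (by exact_mod_cast le_top)).comp (hX.contDiff_one hσ hS b t)
    have hper : ∀ b, Function.Periodic (fun θ => φ (X b t θ)) (2 * Real.pi) := fun b θ => by
      simp only [hX.add_two_pi hσ, hφp (X b t θ)]
    obtain ⟨B₁, hB₁⟩ := exists_bound_iteratedDeriv_of_periodic hφ hφp 1
    obtain ⟨B₂, hB₂⟩ := exists_bound_iteratedDeriv_of_periodic hφ hφp 2
    have hB₁0 : 0 ≤ B₁ := (abs_nonneg _).trans (hB₁ 0)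
    have hB₂0 : 0 ≤ B₂ := (abs_nonneg _).trans (hB₂ 0)
    have hd1 : ∀ x, HasDerivAt φ (deriv φ x) x := fun x =>
      (hφ.differentiable (by simp) x).hasDerivAt
    have hφ1 : ContDiff ℝ ∞ (deriv φ) := by
      have := hφ.iterate_deriv 1
      simpa using this
    have hd2 : ∀ x, HasDerivAt (deriv φ) (deriv (deriv φ) x) x := fun x =>
      (hφ1.differentiable (by simp) x).hasDerivAt
    have hφ2 : Continuous (deriv (deriv φ)) := by
      have := hφ.iterate_deriv 2
      exact (by simpa using this : ContDiff ℝ ∞ (deriv (deriv φ))).continuous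
    rw [iteratedDeriv_one] at hB₁
    rw [iteratedDeriv_succ, iteratedDeriv_one] at hB₂
    set e := Real.exp (S * t) with he
    have he1 : 1 ≤ e := Real.one_le_exp (mul_nonneg hS0 ht)
    set G : ℝ → ℝ := fun s => ∫ θ, h s θ * φ (X s t θ) ∂torus with hG
    have hGG : G t = G 0 := by
      refine eq_of_abs_sub_le_sq (K := 4 * (B₁ * e + (B₂ * e * e + B₁ * (e * (S * e * t))))
        * (|ν| + S) ^ 2 * (∫ θ, w θ ∂torus)) ht fun a b ha hab hbt => ?_
      have hb0 : 0 ≤ b := ha.trans hab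
      have hE : ∀ θ, HasDerivAt (X b t) (flowDeriv σ X b t θ) θ := hX.hasDerivAt_left hσ hS b t
      obtain ⟨hE1, hE2⟩ := hX.contDiff_flowDeriv hσ hS hbt
      have hEd : ∀ θ, HasDerivAt (flowDeriv σ X b t) (deriv (flowDeriv σ X b t) θ) θ := fun θ =>
        (hE1.differentiable (by norm_num) θ).hasDerivAt
      have hEle : ∀ θ, |flowDeriv σ X b t θ| ≤ e := fun θ => by
        rw [abs_of_pos (flowDeriv_pos _ _ _)]
        refine (flowDeriv_le hS b t θ).trans ?_
        rw [abs_of_nonneg (sub_nonneg.2 hbt), he]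
        gcongr
        linarith
      have hEle' : ∀ θ, |deriv (flowDeriv σ X b t) θ| ≤ e * (S * e * t) := fun θ => by
        refine (hE2 θ).trans ?_
        rw [he]
        have : t - b ≤ t := by linarith
        have : 0 ≤ t - b := by linarith
        gcongr
      have hcXb := hX.continuous_left hσ hS b t
      have hE0 : Continuous (flowDeriv σ X b t) := hE1.continuous
      have hE1c : Continuous (deriv (flowDeriv σ X b t)) := hE1.continuous_deriv le_rfl
      have key := H.abs_transport_le hX hσ hS (ψ := fun θ => φ (X b t θ))
        (χ := fun θ => deriv φ (X b t θ) * flowDeriv σ X b t θ)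
        (χ' := fun θ => deriv (deriv φ) (X b t θ) * flowDeriv σ X b t θ * flowDeriv σ X b t θ
          + deriv φ (X b t θ) * deriv (flowDeriv σ X b t) θ)
        (B := B₁ * e + (B₂ * e * e + B₁ * (e * (S * e * t))))
        (fun θ => (hd1 _).comp θ (hE θ))
        (fun θ => ((hd2 _).comp θ (hE θ)).mul (hEd θ))
        (by
          have := hφ1.continuous
          fun_prop) (hper b)
        (fun θ => by
          rw [abs_mul]
          have := mul_le_mul (hB₁ (X b t θ)) (hEle θ) (abs_nonneg _) hB₁0
          have : 0 ≤ B₂ * e * e + B₁ * (e * (S * e * t)) := by positivity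
          linarith)
        (fun θ => by
          have e1 := mul_le_mul (mul_le_mul (hB₂ (X b t θ)) (hEle θ) (abs_nonneg _) hB₂0)
            (hEle θ) (abs_nonneg _) (by positivity)
          have e2 := mul_le_mul (hB₁ (X b t θ)) (hEle' θ) (abs_nonneg _) hB₁0
          refine (abs_add_le _ _).trans ?_
          rw [abs_mul, abs_mul, abs_mul]
          have : 0 ≤ B₁ * e := by positivity
          linarith) ha hab
      simp only [hX.comp hσ] at key
      exact key
    have h1 : G t = ∫ θ, h t θ * φ θ ∂torus := by simp only [hG, hX.self]
    have h2 : G 0 = ∫ θ, F θ * φ (X 0 t θ) ∂torus := by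
      have := H.weak 0 le_rfl _ (hsmooth 0) (hper 0)
      rw [intervalIntegral.integral_same, add_zero] at this
      simp only [hG]
      rw [this]
      refine integral_congr_ae ?_
      filter_upwards [hFw] with θ hθ
      rw [hθ]
    rw [← h1, hGG, h2, ← hX.integral_comp_mul_flowDeriv hσ hS t 0
      (Φ := fun θ => F θ * φ (X 0 t θ)) (hF.mul (hφ.continuous.comp hcX'))
      (fun θ => by
        simp only
        rw [hFp, hX.add_two_pi hσ, hφp])]
    refine integral_congr_ae (Filter.Eventually.of_forall fun θ => ?_)
    simp only [hX.comp hσ, hX.self]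
    ring
  have hi : Integrable (fun θ => F (X t 0 θ) * flowDeriv σ X t 0 θ) torus :=
    hcont _ ((hF.comp hcX).mul hcE)
  have h3 := ae_eq_zero_of_forall_smooth ((H.integrable t ht).sub hi) fun ψ hψ hψp => by
    obtain ⟨B, hB⟩ := exists_bound_iteratedDeriv_of_periodic hψ hψp 0
    simp only [Pi.sub_apply, sub_mul]
    rw [integral_sub (H.integrable_mul ht hψ.continuous (by simpa using hB))
      (hcont (fun θ => F (X t 0 θ) * flowDeriv σ X t 0 θ * ψ θ)
        (((hF.comp hcX).mul hcE).mul hψ.continuous)), hrep ψ hψ hψp, sub_self]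
  filter_upwards [h3] with θ hθ
  exact sub_eq_zero.1 hθ

/-! ### Global solutions at a fixed value of the random parameter -/

theorem exists_hasDerivAt_influence {z : ℝ} (hz : 1 ≤ z) :
    ∃ χ : ℝ → ℝ, Continuous χ ∧ ∀ θ, HasDerivAt (fun θ => influence θ z) (χ θ) θ := by
  refine ⟨fun θ => normFactor z * (-Real.sin θ * z * (1 + Real.cos θ) ^ (z - 1)), ?_, fun θ => ?_⟩
  · refine continuous_const.mul ((by fun_prop : Continuous fun θ => -Real.sin θ * z).mul ?_)
    exact Continuous.rpow_const (by fun_prop) fun θ => Or.inr (by linarith)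
  · exact (((Real.hasDerivAt_cos θ).const_add 1).rpow_const (Or.inr hz)).const_mul (normFactor z)

theorem exists_bound_of_periodic {χ : ℝ → ℝ} (hχ : Continuous χ)
    (hp : Function.Periodic χ (2 * Real.pi)) : ∃ B, ∀ θ, |χ θ| ≤ B := by
  obtain ⟨B, hB⟩ := isCompact_Icc.exists_bound_of_continuousOn (s := Icc 0 (2 * Real.pi))
    hχ.continuousOn
  refine ⟨B, fun y => ?_⟩
  obtain ⟨x, hx, hyx⟩ := hp.exists_mem_Ico₀ Real.two_pi_pos y
  rw [hyx]
  exact hB x ⟨hx.1, hx.2.le⟩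

/-- The weak formulation of the kinetic equation at the parameter `z`. -/
def SolvesAt (κ : ℝ) (g : ℝ → ℝ) (fin : ℝ → ℝ → ℝ) (f : ℝ → ℝ → ℝ → ℝ → ℝ) (z : ℝ) : Prop :=
  ∀ᵐ ν ∂(freqLaw g), ∀ t : ℝ, 0 ≤ t →
    (∀ᵐ θ ∂torus, 0 ≤ f t θ ν z) ∧ Integrable (fun θ => f t θ ν z) torus ∧
    ∀ ψ : ℝ → ℝ, ContDiff ℝ 1 ψ → Function.Periodic ψ (2 * Real.pi) →
      ∫ θ, f t θ ν z * ψ θ ∂torus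
        = (∫ θ, fin θ ν * ψ θ ∂torus)
          + ∫ s in (0 : ℝ)..t, ∫ θ, f s θ ν z * velocity κ g f s θ ν z * deriv ψ θ ∂torus

section

variable {κ : ℝ} {g : ℝ → ℝ} {fin : ℝ → ℝ → ℝ} {f : ℝ → ℝ → ℝ → ℝ → ℝ} {z B : ℝ}

theorem IsInitialDatum.integrable (h : IsInitialDatum g fin) :
    Integrable (fun x : ℝ × ℝ => fin x.1 x.2) (torus.prod (freqLaw g)) := by
  by_contra hn
  have := h.mass
  rw [integral_undef hn] at this
  exact zero_ne_one this

theorem SolvesAt.mass (hz : SolvesAt κ g fin f z) :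
    ∀ᵐ ν ∂(freqLaw g), ∀ t : ℝ, 0 ≤ t → ∫ θ, ‖f t θ ν z‖ ∂torus = ∫ θ, fin θ ν ∂torus := by
  filter_upwards [hz] with ν hν t ht
  obtain ⟨h1, h2, h3⟩ := hν t ht
  have h4 := h3 (fun _ => 1) contDiff_const fun _ => rfl
  simp only [mul_one, deriv_const', mul_zero, integral_zero, intervalIntegral.integral_zero,
    add_zero] at h4
  rw [← h4]
  refine integral_congr_ae ?_
  filter_upwards [h1] with θ hθ
  rw [Real.norm_eq_abs, abs_of_nonneg hθ]

theorem IsInitialDatum.integrable_mass (hg : IsProbDensity volume g) (h : IsInitialDatum g fin) :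
    Integrable (fun ν => ∫ θ, fin θ ν ∂torus) (freqLaw g) := by
  have : IsProbabilityMeasure (freqLaw g) := hg.isProbabilityMeasure
  exact h.integrable.integral_prod_right

theorem IsInitialDatum.integral_mass (hg : IsProbDensity volume g) (h : IsInitialDatum g fin) :
    ∫ ν, ∫ θ, fin θ ν ∂torus ∂(freqLaw g) = 1 := by
  have : IsProbabilityMeasure (freqLaw g) := hg.isProbabilityMeasure
  rw [← h.mass, integral_prod_symm _ h.integrable]

theorem SolvesAt.integrable (hz : SolvesAt κ g fin f z) (hg : IsProbDensity volume g)
    (hfin : IsInitialDatum g fin)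
    (hf : Measurable fun x : ℝ × ℝ × ℝ × ℝ => f x.1 x.2.1 x.2.2.1 x.2.2.2) {t : ℝ} (ht : 0 ≤ t) :
    Integrable (fun x : ℝ × ℝ => f t x.1 x.2 z) (torus.prod (freqLaw g)) := by
  have : IsProbabilityMeasure (freqLaw g) := hg.isProbabilityMeasure
  have hm : Measurable fun x : ℝ × ℝ => f t x.1 x.2 z :=
    hf.comp (by fun_prop : Measurable fun x : ℝ × ℝ => (t, x.1, x.2, z))
  rw [integrable_prod_iff' hm.aestronglyMeasurable]
  refine ⟨hz.mono fun ν hν => (hν t ht).2.1, (hfin.integrable_mass hg).congr ?_⟩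
  filter_upwards [hz.mass] with ν hν
  exact (hν t ht).symm

theorem SolvesAt.abs_meanField_le (hz : SolvesAt κ g fin f z) (hg : IsProbDensity volume g)
    (hfin : IsInitialDatum g fin)
    (hf : Measurable fun x : ℝ × ℝ × ℝ × ℝ => f x.1 x.2.1 x.2.2.1 x.2.2.2) (hκ : 0 ≤ κ)
    (hB : ∀ θ, |influence θ z| ≤ B) {t : ℝ} (ht : 0 ≤ t) : |meanField κ g f t z| ≤ κ * B := by
  have : IsProbabilityMeasure (freqLaw g) := hg.isProbabilityMeasure
  have hi := hz.integrable hg hfin hf ht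
  rw [meanField, abs_mul, abs_of_nonneg hκ]
  refine mul_le_mul_of_nonneg_left ?_ hκ
  have h1 : ∫ x : ℝ × ℝ, ‖f t x.1 x.2 z‖ ∂(torus.prod (freqLaw g)) = 1 := by
    rw [integral_prod_symm _ hi.norm, ← hfin.integral_mass hg]
    refine integral_congr_ae ?_
    filter_upwards [hz.mass] with ν hν
    exact hν t ht
  calc |∫ x : ℝ × ℝ, influence x.1 z * f t x.1 x.2 z ∂(torus.prod (freqLaw g))|
      ≤ ∫ x : ℝ × ℝ, B * ‖f t x.1 x.2 z‖ ∂(torus.prod (freqLaw g)) := by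
        rw [← Real.norm_eq_abs]
        refine norm_integral_le_of_norm_le (hi.norm.const_mul B)
          (Filter.Eventually.of_forall fun x => ?_)
        rw [norm_mul]
        exact mul_le_mul_of_nonneg_right (hB x.1) (norm_nonneg _)
    _ = B := by rw [integral_const_mul, h1, mul_one]

theorem continuous_influence_left (hz : 1 ≤ z) : Continuous fun θ => influence θ z := by
  have := continuous_influence_max.comp (by fun_prop : Continuous fun θ : ℝ => (θ, z))
  simpa only [Function.comp_def, max_eq_left hz] using this

theorem measurable_meanField (hg : IsProbDensity volume g)
    (hf : Measurable fun x : ℝ × ℝ × ℝ × ℝ => f x.1 x.2.1 x.2.2.1 x.2.2.2) (hz : 1 ≤ z) :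
    Measurable fun t => meanField κ g f t z := by
  have : IsProbabilityMeasure (freqLaw g) := hg.isProbabilityMeasure
  have h : Measurable fun y : ℝ × ℝ × ℝ => influence y.2.1 z * f y.1 y.2.1 y.2.2 z :=
    ((continuous_influence_left hz).measurable.comp (by fun_prop)).mul
      (hf.comp (by fun_prop : Measurable fun y : ℝ × ℝ × ℝ => (y.1, y.2.1, y.2.2, z)))
  exact (h.stronglyMeasurable.integral_prod_right (ν := torus.prod (freqLaw g))).measurable.const_mul κ

theorem SolvesAt.ae_isWeakSolution (hz : SolvesAt κ g fin f z) (hg : IsProbDensity volume g)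
    (hfin : IsInitialDatum g fin)
    (hf : Measurable fun x : ℝ × ℝ × ℝ × ℝ => f x.1 x.2.1 x.2.2.1 x.2.2.2) (hκ : 0 ≤ κ)
    (hz1 : 1 ≤ z) (hB : ∀ θ, |influence θ z| ≤ B) : ∀ᵐ ν ∂(freqLaw g),
      IsWeakSolution ν (κ * B) (fun t => meanField κ g f t z) (fun θ => fin θ ν)
        (fun t θ => f t θ ν z) := by
  filter_upwards [hz] with ν hν
  exact ⟨hf.comp (by fun_prop : Measurable fun x : ℝ × ℝ => (x.1, x.2, ν, z)),
    measurable_meanField hg hf hz1, fun t ht => hz.abs_meanField_le hg hfin hf hκ hB ht,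
    fun t ht => (hν t ht).1, fun t ht => (hν t ht).2.1, fun t ht => (hν t ht).2.2⟩

/-- For each frequency the contribution is Lipschitz in time, but the constant grows with $|\nu|$
and no moment of $g$ is assumed. Continuity is therefore obtained by dominated convergence, with the
conserved mass as majorant. -/
theorem SolvesAt.continuousOn_meanField (hz : SolvesAt κ g fin f z) (hg : IsProbDensity volume g)
    (hfin : IsInitialDatum g fin)
    (hf : Measurable fun x : ℝ × ℝ × ℝ × ℝ => f x.1 x.2.1 x.2.2.1 x.2.2.2) (hκ : 0 ≤ κ)
    (hz1 : 1 ≤ z) (hB : ∀ θ, |influence θ z| ≤ B) :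
    ContinuousOn (fun t => meanField κ g f t z) (Ici 0) := by
  have : IsProbabilityMeasure (freqLaw g) := hg.isProbabilityMeasure
  have hB0 : 0 ≤ B := (abs_nonneg _).trans (hB 0)
  have hIc := continuous_influence_left hz1
  have hI : ∀ t, 0 ≤ t → Integrable (fun x : ℝ × ℝ => f t x.1 x.2 z * influence x.1 z)
      (torus.prod (freqLaw g)) := fun t ht =>
    (hz.integrable hg hfin hf ht).mul_bdd (c := B)
      (hIc.comp continuous_fst).aestronglyMeasurable (Filter.Eventually.of_forall fun x => hB x.1)
  have hw := hz.ae_isWeakSolution hg hfin hf hκ hz1 hB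
  have hc : ContinuousOn (fun t => ∫ ν, ∫ θ, f t θ ν z * influence θ z ∂torus ∂(freqLaw g))
      (Ici 0) := by
    refine continuousOn_of_dominated (bound := fun ν => B * ∫ θ, fin θ ν ∂torus)
      (fun t ht => ?_) (fun t ht => ?_) ((hfin.integrable_mass hg).const_mul B) ?_
    · exact (hI t ht).integral_prod_right.aestronglyMeasurable
    · filter_upwards [hw] with ν hν
      exact hν.abs_integral_le ht hB
    · filter_upwards [hw] with ν hν
      obtain ⟨χ, hχ, hχd⟩ := exists_hasDerivAt_influence hz1
      have hp : Function.Periodic (fun θ => influence θ z) (2 * Real.pi) :=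
        fun θ => influence_periodic θ z
      obtain ⟨B', hB'⟩ := exists_bound_of_periodic hχ (periodic_of_hasDerivAt hχd hp)
      have hinc : ∀ a ∈ Ici (0 : ℝ), ∀ b ∈ Ici (0 : ℝ),
          |(∫ θ, f b θ ν z * influence θ z ∂torus) - ∫ θ, f a θ ν z * influence θ z ∂torus|
            ≤ (|ν| + κ * B) * (B' * ∫ θ, fin θ ν ∂torus) * |b - a| := by
        intro a ha b hb
        rcases le_total a b with hab | hab
        · rw [abs_of_nonneg (sub_nonneg.2 hab)]
          exact hν.abs_increment_le hχd hp hχ hB' ha hab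
        · rw [abs_sub_comm, abs_sub_comm b a, abs_of_nonneg (sub_nonneg.2 hab)]
          exact hν.abs_increment_le hχd hp hχ hB' hb hab
      refine (LipschitzOnWith.of_dist_le_mul
        (K := ((|ν| + κ * B) * (B' * ∫ θ, fin θ ν ∂torus)).toNNReal) fun b hb a ha => ?_).continuousOn
      have hm := hν.mass_nonneg
      have hB'0 : 0 ≤ B' := (abs_nonneg _).trans (hB' 0)
      rw [Real.coe_toNNReal _ (by positivity)]
      exact hinc a ha b hb
  refine (hc.const_smul κ).congr fun t ht => ?_
  rw [meanField, Pi.smul_apply, smul_eq_mul, ← integral_prod_symm _ (hI t ht)]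
  simp only [mul_comm (influence _ _)]

/-- The mean field, extended to negative times. -/
noncomputable def extendedField (κ : ℝ) (g : ℝ → ℝ) (f : ℝ → ℝ → ℝ → ℝ → ℝ) (z t : ℝ) : ℝ :=
  meanField κ g f (max t 0) z

theorem SolvesAt.abs_extendedField_le (hz : SolvesAt κ g fin f z) (hg : IsProbDensity volume g)
    (hfin : IsInitialDatum g fin)
    (hf : Measurable fun x : ℝ × ℝ × ℝ × ℝ => f x.1 x.2.1 x.2.2.1 x.2.2.2) (hκ : 0 ≤ κ)
    (hB : ∀ θ, |influence θ z| ≤ B) (t : ℝ) : |extendedField κ g f z t| ≤ κ * B :=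
  hz.abs_meanField_le hg hfin hf hκ hB (le_max_right _ _)

theorem SolvesAt.continuous_extendedField (hz : SolvesAt κ g fin f z)
    (hg : IsProbDensity volume g) (hfin : IsInitialDatum g fin)
    (hf : Measurable fun x : ℝ × ℝ × ℝ × ℝ => f x.1 x.2.1 x.2.2.1 x.2.2.2) (hκ : 0 ≤ κ)
    (hz1 : 1 ≤ z) (hB : ∀ θ, |influence θ z| ≤ B) : Continuous (extendedField κ g f z) :=
  (hz.continuousOn_meanField hg hfin hf hκ hz1 hB).comp_continuous
    (by fun_prop : Continuous fun t : ℝ => max t 0) fun t => le_max_right t 0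

theorem SolvesAt.ae_eq_flow (hz : SolvesAt κ g fin f z) (hg : IsProbDensity volume g)
    (hfin : IsInitialDatum g fin)
    (hf : Measurable fun x : ℝ × ℝ × ℝ × ℝ => f x.1 x.2.1 x.2.2.1 x.2.2.2) (hκ : 0 ≤ κ)
    (hz1 : 1 ≤ z) (hB : ∀ θ, |influence θ z| ≤ B) {F : ℝ → ℝ → ℝ}
    (hF : ∀ ν, Continuous fun θ => F θ ν)
    (hFp : ∀ ν, Function.Periodic (fun θ => F θ ν) (2 * Real.pi))
    (hFw : ∀ᵐ ν ∂(freqLaw g), ∀ᵐ θ ∂torus, F θ ν = fin θ ν) {X : ℝ → ℝ → ℝ → ℝ → ℝ}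
    (hX : ∀ ν, IsFlow ν (extendedField κ g f z) (X ν)) :
    ∀ᵐ ν ∂(freqLaw g), ∀ t, 0 ≤ t → ∀ᵐ θ ∂torus,
      f t θ ν z = F (X ν t 0 θ) ν * flowDeriv (extendedField κ g f z) (X ν) t 0 θ := by
  have hσ := hz.continuous_extendedField hg hfin hf hκ hz1 hB
  have hS := hz.abs_extendedField_le hg hfin hf hκ hB
  filter_upwards [hz.ae_isWeakSolution hg hfin hf hκ hz1 hB, hFw] with ν hν hFν t ht
  have H : IsWeakSolution ν (κ * B) (extendedField κ g f z) (fun θ => fin θ ν)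
      (fun t θ => f t θ ν z) := by
    refine ⟨hν.measurable, hσ.measurable, fun t _ => hS t, hν.nonneg, hν.integrable,
      fun t ht ψ hψ hψp => ?_⟩
    rw [hν.weak t ht ψ hψ hψp]
    congr 1
    refine intervalIntegral.integral_congr fun s hs => ?_
    rw [uIcc_of_le ht] at hs
    simp only [extendedField, max_eq_left hs.1]
  exact H.eq_flow (hX ν) hσ hS (hF ν) (hFp ν) hFν ht

end

/-! ### Convergence of the scheme -/

/-- A multiple of $1/(n+8)$ is a supersolution: the shift 8 makes the ratio of consecutive terms at
most $9/8$, and $\frac34\cdot\frac98<1$. -/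
theorem tendsto_of_linear_recurrence {c : ℕ → ℝ} {L : ℝ} (hL : 0 ≤ L) (h0 : 0 ≤ c 0)
    (h : ∀ n, c (n + 1) = 3 / 4 * c n + L * (1 / ((n : ℝ) + 1))) (hc : ∀ n, 0 ≤ c n) :
    Filter.Tendsto c Filter.atTop (nhds 0) := by
  set D := 64 * L + 8 * c 0 with hD
  have hb : ∀ n, c n ≤ D * (1 / ((n : ℝ) + 8)) := by
    intro n
    induction n with
    | zero =>
      rw [Nat.cast_zero, zero_add, hD]
      linarith
    | succ n ih =>
      have hn : (0 : ℝ) ≤ n := n.cast_nonneg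
      have h1 : 1 / ((n : ℝ) + 1) ≤ 8 * (1 / ((n : ℝ) + 8)) := by
        rw [mul_one_div, div_le_div_iff₀ (by positivity) (by positivity)]
        linarith
      have h2 : 1 / ((n : ℝ) + 8) ≤ 9 / 8 * (1 / (((n + 1 : ℕ) : ℝ) + 8)) := by
        push_cast
        rw [mul_one_div, div_le_div_iff₀ (by positivity) (by positivity)]
        linarith
      have h3 : 0 ≤ 1 / ((n : ℝ) + 8) := by positivity
      have h4 : 0 ≤ 1 / (((n + 1 : ℕ) : ℝ) + 8) := by positivity
      rw [h]
      calc 3 / 4 * c n + L * (1 / ((n : ℝ) + 1))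
          ≤ 3 / 4 * (D * (1 / ((n : ℝ) + 8))) + L * (8 * (1 / ((n : ℝ) + 8))) := by gcongr
        _ = (3 / 4 * D + 8 * L) * (1 / ((n : ℝ) + 8)) := by ring
        _ ≤ (3 / 4 * D + 8 * L) * (9 / 8 * (1 / (((n + 1 : ℕ) : ℝ) + 8))) := by gcongr
        _ = ((3 / 4 * D + 8 * L) * (9 / 8)) * (1 / (((n + 1 : ℕ) : ℝ) + 8)) := by ring
        _ ≤ D * (1 / (((n + 1 : ℕ) : ℝ) + 8)) := by
          gcongr
          rw [hD]
          linarith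
  refine squeeze_zero hc hb ?_
  have h5 := ((tendsto_one_div_add_atTop_nhds_zero_nat (𝕜 := ℝ)).comp
    (Filter.tendsto_add_atTop_nat 7)).const_mul D
  rw [mul_zero] at h5
  refine h5.congr fun n => ?_
  simp only [Function.comp_apply, Nat.cast_add]
  norm_num
  left
  ring

/-- The fixed point equation whose Picard iteration is `nextAngle`. -/
theorem IsFlow.eq_add_integral {ν : ℝ} {σ : ℝ → ℝ} {X : ℝ → ℝ → ℝ → ℝ} (hX : IsFlow ν σ X)
    (hσ : Continuous σ) (s t θ : ℝ) :
    X t s θ = θ - ν * (t - s) + ∫ r in s..t, σ r * Real.sin (X t r θ) := by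
  have hc := hX.continuous t θ
  have h := intervalIntegral.integral_eq_sub_of_hasDerivAt (a := s) (b := t)
    (fun r _ => hX.hasDerivAt t θ r)
    ((by fun_prop : Continuous fun r => ν - σ r * Real.sin (X t r θ)).intervalIntegrable _ _)
  rw [intervalIntegral.integral_sub intervalIntegrable_const
    ((by fun_prop : Continuous fun r => σ r * Real.sin (X t r θ)).intervalIntegrable _ _),
    intervalIntegral.integral_const, smul_eq_mul, hX.self] at h
  linarith

theorem abs_mul_sub_mul_le {a a' b b' S : ℝ} (hb : |b| ≤ 1) (ha' : |a'| ≤ S) :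
    |a * b - a' * b'| ≤ |a - a'| + S * |b - b'| := by
  rw [show a * b - a' * b' = (a - a') * b + a' * (b - b') by ring]
  refine (abs_add_le _ _).trans ?_
  rw [abs_mul, abs_mul]
  exact add_le_add (mul_le_of_le_one_right (abs_nonneg _) hb)
    (mul_le_mul_of_nonneg_right ha' (abs_nonneg _))

theorem IsState.abs_charIntegral_sub_le {k : ℕ} {T : ℝ} {J : Set ℝ} {σ : ℝ → ℝ → ℝ}
    {Y : ℝ → ℝ → ℝ → ℝ → ℝ → ℝ} (h : IsState k T J σ Y) {z : ℝ} (hz : z ∈ J) {c : ℝ → ℝ}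
    (hc : Continuous c) (hc1 : ∀ x, |c x| ≤ 1) (hcl : ∀ x y, |c x - c y| ≤ |x - y|)
    {τ y : ℝ → ℝ} (hτ : Continuous τ) (hy : Continuous y) {S : ℝ} (hS : ∀ t, |τ t| ≤ S)
    {s t θ ν : ℝ} (hs : 0 ≤ s) (hst : s ≤ t) (ht : t ≤ T) {α β : ℝ → ℝ} (hα : Continuous α)
    (hβ : Continuous β) (hα1 : ∀ r ∈ Icc 0 T, |σ r z - τ r| ≤ α r)
    (hβ1 : ∀ r, 0 ≤ r → r ≤ t → |Y r t θ ν z - y r| ≤ β r) :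
    |charIntegral c σ Y s t θ ν z - ∫ r in s..t, τ r * c (y r)|
      ≤ ∫ r in s..t, (α r + S * β r) := by
  have hS0 : 0 ≤ S := (abs_nonneg _).trans (hS 0)
  obtain ⟨B, hB⟩ := h.bound_field
  have hm : Measurable fun r => σ r z * c (Y r t θ ν z) :=
    (h.measurable_charIntegrand hc).comp (f := fun r => ((s, t, θ, ν, z), r)) (by fun_prop)
  have hi : IntervalIntegrable (fun r => σ r z * c (Y r t θ ν z)) volume s t := by
    refine (intervalIntegrable_const (c := B)).mono_fun' hm.aestronglyMeasurable ?_
    filter_upwards [ae_restrict_mem measurableSet_uIoc] with r hr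
    rw [uIoc_of_le hst] at hr
    have := hB 0 (Nat.zero_le _) r ⟨hs.trans hr.1.le, hr.2.trans ht⟩ z hz
    rw [iteratedDerivWithin_zero] at this
    rw [norm_mul]
    exact (mul_le_of_le_one_right (abs_nonneg _) (hc1 _)).trans this
  have hi2 : IntervalIntegrable (fun r => τ r * c (y r)) volume s t :=
    (by fun_prop : Continuous fun r => τ r * c (y r)).intervalIntegrable _ _
  rw [charIntegral, ← intervalIntegral.integral_of_le hst, ← intervalIntegral.integral_sub hi hi2,
    ← Real.norm_eq_abs]
  refine intervalIntegral.norm_integral_le_of_norm_le hst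
    (Filter.Eventually.of_forall fun r hr => ?_)
    ((by fun_prop : Continuous fun r => α r + S * β r).intervalIntegrable _ _)
  have hr0 : 0 ≤ r := hs.trans hr.1.le
  refine (abs_mul_sub_mul_le (hc1 _) (hS r)).trans (add_le_add (hα1 r ⟨hr0, hr.2.trans ht⟩) ?_)
  exact mul_le_mul_of_nonneg_left ((hcl _ _).trans (hβ1 r hr0 hr.2)) hS0

theorem abs_sin_sub_sin_le (x y : ℝ) : |Real.sin x - Real.sin y| ≤ |x - y| := by
  rw [sin_sub_sin_eq_sinc, abs_mul, abs_mul]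
  exact mul_le_of_le_one_right (abs_nonneg _)
    (mul_le_one₀ (Real.abs_sinc_le_one _) (abs_nonneg _) (Real.abs_cos_le_one _))

theorem abs_cos_sub_cos_le (x y : ℝ) : |Real.cos x - Real.cos y| ≤ |x - y| := by
  rw [← Real.sin_add_pi_div_two, ← Real.sin_add_pi_div_two]
  refine (abs_sin_sub_sin_le _ _).trans (le_of_eq ?_)
  rw [add_sub_add_right_eq_sub]

section

variable {k : ℕ} {A T κ M B z : ℝ} {g : ℝ → ℝ} {φ : ℕ → ℝ → ℝ → ℝ} {η : ℝ → ℝ} {J : Set ℝ}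
  {fin F : ℝ → ℝ → ℝ} {f : ℝ → ℝ → ℝ → ℝ → ℝ}

theorem IsSchemeData.abs_cutoff_sub_le (d : IsSchemeData k A T κ g φ η J) (hk : 1 ≤ k) (x y : ℝ) :
    |η x - η y| ≤ A * |x - y| := by
  have hd : Differentiable ℝ η := d.contDiff_cutoff.differentiable
    (by exact_mod_cast (by omega : k ≠ 0))
  refine abs_sub_le_of_hasDerivAt (fun x => (hd x).hasDerivAt) (fun x => ?_) x y
  have := d.cutoff_le 1 hk x
  rwa [iteratedDeriv_one] at this

theorem IsSchemeData.abs_density_sub_le (d : IsSchemeData k A T κ g φ η J) (hk : 1 ≤ k)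
    (hr : IsRegularization k M φ F) {n : ℕ} {σ : ℝ → ℝ → ℝ} {Y : ℝ → ℝ → ℝ → ℝ → ℝ → ℝ}
    {t θ ν y E b e : ℝ} (hb : |Y 0 t θ ν z - y| ≤ b)
    (he : |charIntegral Real.cos σ Y 0 t θ ν z - E| ≤ e) :
    |density (φ n) η σ Y t θ ν z - F y ν * η E|
      ≤ A * (M * (1 / ((n : ℝ) + 1)) + M * b) + M * (A * e) := by
  have hM : 0 ≤ M := by
    have := (abs_nonneg _).trans (hr.abs_le 0 0)
    exact this
  have hA : 0 ≤ A := zero_le_one.trans d.one_le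
  have hη := d.cutoff_le 0 (Nat.zero_le _) (charIntegral Real.cos σ Y 0 t θ ν z)
  rw [iteratedDeriv_zero] at hη
  rw [density, show ∀ p q p' q' : ℝ, p * q - p' * q' = q * (p - p') + p' * (q - q') by
    intros; ring]
  refine (abs_add_le _ _).trans ?_
  rw [abs_mul, abs_mul]
  refine add_le_add (mul_le_mul hη ?_ (abs_nonneg _) hA) (mul_le_mul (hr.abs_le ν y) ?_
    (abs_nonneg _) hM)
  · have h1 := hr.dist_le n ν (Y 0 t θ ν z)
    have h2 := (hr.lipschitz ν (Y 0 t θ ν z) y).trans (mul_le_mul_of_nonneg_left hb hM)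
    rw [mul_one_div]
    rw [← sub_add_sub_cancel _ (F (Y 0 t θ ν z) ν)]
    exact (abs_add_le _ _).trans (add_le_add h1 h2)
  · exact (d.abs_cutoff_sub_le hk _ _).trans (mul_le_mul_of_nonneg_left he hA)

/-- At a fixed parameter the errors in field and angles obey the recursion of `iteration_bound`,
driven by the mollification error. No regularity of the given solution in `z` is used. -/
theorem SolvesAt.tendsto_density (hz : SolvesAt κ g fin f z)
    (d : IsSchemeData k A T κ g φ η J) (hk : 1 ≤ k) (hr : IsRegularization k M φ F)
    (hzJ : z ∈ J) (hfin : IsInitialDatum g fin)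
    (hf : Measurable fun x : ℝ × ℝ × ℝ × ℝ => f x.1 x.2.1 x.2.2.1 x.2.2.2)
    (hB : ∀ θ, |influence θ z| ≤ B) (hη : ∀ x, |x| ≤ κ * B * T → η x = Real.exp x)
    (hFw : ∀ᵐ ν ∂(freqLaw g), ∀ᵐ θ ∂torus, F θ ν = fin θ ν) :
    ∀ᵐ ν ∂(freqLaw g), ∀ t ∈ Icc 0 T, ∀ᵐ θ ∂torus, Filter.Tendsto
      (fun n => density (φ n) η (scheme κ g φ η n).1 (scheme κ g φ η n).2 t θ ν z)
      Filter.atTop (nhds (f t θ ν z)) := by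
  have hg := d.prob
  have hκ := d.coupling_nonneg
  have hT := d.time_nonneg
  have hz1 : 1 ≤ z := (mem_Ioi.1 (d.subset hzJ)).le
  have : IsProbabilityMeasure (freqLaw g) := hg.isProbabilityMeasure
  have hM : 0 ≤ M := (abs_nonneg _).trans (hr.abs_le 0 0)
  have hA : 0 ≤ A := zero_le_one.trans d.one_le
  have hB0 : 0 ≤ B := (abs_nonneg _).trans (hB 0)
  set σ := extendedField κ g f z with hσdef
  have hσ : Continuous σ := hz.continuous_extendedField hg hfin hf hκ hz1 hB
  set S := κ * B with hS
  have hS0 : 0 ≤ S := by positivity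
  have hσS : ∀ t, |σ t| ≤ S := hz.abs_extendedField_le hg hfin hf hκ hB
  choose X hX using fun ν => exists_isFlow (ν := ν) hσ hσS
  have hflow := hz.ae_eq_flow hg hfin hf hκ hz1 hB hr.continuous hr.periodic hFw hX
  -- The exponent is at most `κ * B * T` in absolute value, where the cut-off agrees with the
  -- exponential.
  have hE : ∀ ν θ, ∀ t ∈ Icc 0 T, flowDeriv σ (X ν) t 0 θ
      = η (∫ r in (0 : ℝ)..t, σ r * Real.cos (X ν t r θ)) := by
    intro ν θ t ht
    rw [flowDeriv, ← intervalIntegral.integral_symm, hη]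
    rw [← Real.norm_eq_abs]
    refine (intervalIntegral.norm_integral_le_of_norm_le_const (C := S) fun r _ => ?_).trans ?_
    · rw [norm_mul]
      exact (mul_le_of_le_one_right (abs_nonneg _) (Real.abs_cos_le_one _)).trans (hσS r)
    · rw [sub_zero, abs_of_nonneg ht.1]
      gcongr
      exact ht.2
  set K := 1 + S + 7 * S * (A * M * (1 + S)) with hK
  have hK1 : 1 ≤ K := by
    have : 0 ≤ 7 * S * (A * M * (1 + S)) := by positivity
    linarith
  have hKS : 1 + S ≤ K := by
    have : 0 ≤ 7 * S * (A * M * (1 + S)) := by positivity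
    linarith
  obtain ⟨L, hL1, hL⟩ := iteration_bound hK1 hT
  -- The source `1 / (n + 1)` is the regularization error of the datum. The constant `S + S * T`
  -- covers the initial errors: `S` for the zero field, `S * T` for the free flow.
  have hstep := hL (fun n t => |(scheme κ g φ η n).1 t z - σ t|)
    (fun n i s t => |(scheme κ g φ η n).2 s t i.1 i.2 z - X i.2 t s i.1|)
    (fun n => 1 / ((n : ℝ) + 1)) (S + S * T) (by positivity) (fun n => by positivity)
    (fun t _ => by
      simp only [scheme, zero_sub, abs_neg]
      have : 0 ≤ S * T := by positivity
      linarith [hσS t])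
    (fun i s t hs hst ht => by
      have h1 := (hX i.2).eq_add_integral hσ s t i.1
      simp only [scheme]
      rw [h1, sub_add_cancel_left, abs_neg]
      have h2 : |∫ r in s..t, σ r * Real.sin (X i.2 t r i.1)| ≤ S * |t - s| := by
        rw [← Real.norm_eq_abs]
        refine intervalIntegral.norm_integral_le_of_norm_le_const fun r _ => ?_
        rw [norm_mul]
        exact (mul_le_of_le_one_right (abs_nonneg _) (Real.abs_sin_le_one _)).trans (hσS r)
      have h3 : S * |t - s| ≤ S * T := by
        rw [abs_of_nonneg (sub_nonneg.2 hst)]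
        gcongr
        linarith
      linarith)
  obtain ⟨c, hc0, hcs, hc⟩ := hstep (by
    intro n α β hα hβ hα0 hβ0 hna hnb
    have hst := d.isState n
    set ε := 1 / ((n : ℝ) + 1) with hε
    have hε0 : 0 ≤ ε := by positivity
    have hint : ∀ s t, s ≤ t → ∫ r in s..t, (α r + S * β r t)
        ≤ (1 + S) * ∫ r in s..t, (ε + α r + β r t) := by
      intro s t hst
      have := hβ t
      rw [← intervalIntegral.integral_const_mul]
      refine intervalIntegral.integral_mono_on hst
        ((by fun_prop : Continuous _).intervalIntegrable _ _)
        ((by fun_prop : Continuous _).intervalIntegrable _ _) fun r _ => ?_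
      have e1 := hα0 r
      have e2 := hβ0 r t
      have e3 : 0 ≤ S * ε := by positivity
      have e4 : 0 ≤ S * α r := by positivity
      linarith
    have hintn : ∀ s t, s ≤ t → 0 ≤ ∫ r in s..t, (ε + α r + β r t) := fun s t hst =>
      intervalIntegral.integral_nonneg hst fun r _ => by linarith [hα0 r, hβ0 r t]
    refine ⟨fun i s t hs hst' ht => ?_, fun t ht => ?_⟩
    · have h1 := hst.abs_charIntegral_sub_le hzJ (θ := i.1) (ν := i.2) Real.continuous_sin
        Real.abs_sin_le_one
        abs_sin_sub_sin_le hσ ((hX i.2).continuous t i.1) hσS hs hst' ht hα (hβ t) hna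
        (fun r hr hrt => hnb i r t hr hrt ht)
      have h2 := (hX i.2).eq_add_integral hσ s t i.1
      simp only [scheme, nextAngle]
      rw [h2, add_sub_add_left_eq_sub]
      refine h1.trans ((hint s t hst').trans ?_)
      exact mul_le_mul_of_nonneg_right hKS (hintn s t hst')
    · set I := ∫ r in (0 : ℝ)..t, (ε + α r + β r t) with hI
      have hI0 : 0 ≤ I := hintn 0 t ht.1
      have hdm : Measurable fun x : ℝ × ℝ => density (φ n) η (scheme κ g φ η n).1
          (scheme κ g φ η n).2 t x.1 x.2 z :=
        (hst.measurable_density d n).comp (f := fun x : ℝ × ℝ => (t, x.1, x.2, z)) (by fun_prop)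
      have hfm : Measurable fun x : ℝ × ℝ => f t x.1 x.2 z :=
        hf.comp (by fun_prop : Measurable fun x : ℝ × ℝ => (t, x.1, x.2, z))
      set e := A * (M * ε + M * β 0 t) + M * (A * ((1 + S) * I)) with he
      have hae : ∀ᵐ x ∂(torus.prod (freqLaw g)), |density (φ n) η (scheme κ g φ η n).1
          (scheme κ g φ η n).2 t x.1 x.2 z - f t x.1 x.2 z| ≤ e := by
        have hmeas : MeasurableSet {x : ℝ × ℝ | |density (φ n) η (scheme κ g φ η n).1
            (scheme κ g φ η n).2 t x.1 x.2 z - f t x.1 x.2 z| ≤ e} :=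
          measurableSet_le (by
            exact (continuous_abs.measurable.comp (hdm.sub hfm))) measurable_const
        rw [Measure.ae_prod_iff_ae_ae hmeas]
        refine (Measure.ae_ae_comm hmeas).2 ?_
        filter_upwards [hflow] with ν hν
        filter_upwards [hν t ht.1] with θ hθ
        rw [hθ, hE ν θ t ht]
        refine d.abs_density_sub_le hk hr (hnb (θ, ν) 0 t le_rfl ht.1 ht.2) ?_
        exact (hst.abs_charIntegral_sub_le hzJ (θ := θ) (ν := ν) Real.continuous_cos
          Real.abs_cos_le_one
          abs_cos_sub_cos_le hσ ((hX ν).continuous t θ) hσS le_rfl ht.1 ht.2 hα (hβ t) hna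
          (fun r hr hrt => hnb (θ, ν) r t hr hrt ht.2)).trans (hint 0 t ht.1)
      have hIm : Measurable fun x : ℝ × ℝ => influence x.1 z :=
        (continuous_influence_left hz1).measurable.comp measurable_fst
      have i1 : Integrable (fun x : ℝ × ℝ => influence x.1 z * density (φ n) η
          (scheme κ g φ η n).1 (scheme κ g φ η n).2 t x.1 x.2 z) (torus.prod (freqLaw g)) :=
        Integrable.of_bound (hIm.mul hdm).aestronglyMeasurable (B * (A * A))
          (Filter.Eventually.of_forall fun x => by
            rw [norm_mul]
            exact mul_le_mul (hB x.1) (d.abs_density_le n t x.1 x.2 z) (abs_nonneg _) hB0)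
      have i2 : Integrable (fun x : ℝ × ℝ => influence x.1 z * f t x.1 x.2 z)
          (torus.prod (freqLaw g)) :=
        (hz.integrable hg hfin hf ht.1).bdd_mul (c := B) hIm.aestronglyMeasurable
          (Filter.Eventually.of_forall fun x => hB x.1)
      simp only [scheme, nextField, hσdef, extendedField, meanField, max_eq_left hz1,
        max_eq_left ht.1]
      rw [← mul_sub, ← integral_sub i1 i2, abs_mul, abs_of_nonneg hκ]
      have hbd : |∫ x : ℝ × ℝ, (influence x.1 z * density (φ n) η (scheme κ g φ η n).1
          (scheme κ g φ η n).2 t x.1 x.2 z - influence x.1 z * f t x.1 x.2 z)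
            ∂(torus.prod (freqLaw g))| ≤ B * e * 7 := by
        have he0 : 0 ≤ e := by
          have := hβ0 0 t
          positivity
        have h1 := norm_integral_le_of_norm_le_const (μ := torus.prod (freqLaw g)) (C := B * e)
          (f := fun x : ℝ × ℝ => influence x.1 z * density (φ n) η (scheme κ g φ η n).1
          (scheme κ g φ η n).2 t x.1 x.2 z - influence x.1 z * f t x.1 x.2 z) (by
            filter_upwards [hae] with x hx
            rw [← mul_sub, norm_mul]
            exact mul_le_mul (hB x.1) hx (abs_nonneg _) hB0)
        rw [Real.norm_eq_abs] at h1
        refine h1.trans ?_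
        have := torus_prod_freqLaw_real_univ_le hg
        gcongr
      have e1 := hβ0 0 t
      calc _ ≤ κ * (B * e * 7) := mul_le_mul_of_nonneg_left hbd hκ
        _ = 7 * S * (A * M) * (ε + β 0 t + (1 + S) * I) := by rw [he, hS]; ring
        _ ≤ 7 * S * (A * M) * ((1 + S) * (ε + β 0 t + I)) := by
          gcongr
          have : 0 ≤ S * (ε + β 0 t) := by positivity
          linarith
        _ = 7 * S * (A * M * (1 + S)) * (ε + β 0 t + I) := by ring
        _ ≤ K * (ε + β 0 t + I) := by
          gcongr
          linarith)
  have hct : Filter.Tendsto c Filter.atTop (nhds 0) :=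
    tendsto_of_linear_recurrence (by linarith) (hc 0).1 hcs fun n => (hc n).1
  filter_upwards [hflow] with ν hν t ht
  filter_upwards [hν t ht.1] with θ hθ
  rw [hθ, hE ν θ t ht, tendsto_iff_dist_tendsto_zero]
  refine squeeze_zero (g := fun n : ℕ => A * (M * (1 / ((n : ℝ) + 1)) + M * (L * c n))
    + M * (A * ((L * c n + S * (L * c n)) * t))) (fun _ => dist_nonneg) (fun n => ?_) ?_
  · rw [Real.dist_eq]
    obtain ⟨h1, h2, h3⟩ := hc n
    refine d.abs_density_sub_le hk hr (h3 (θ, ν) 0 t le_rfl ht.1 ht.2) ?_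
    refine ((d.isState n).abs_charIntegral_sub_le hzJ (θ := θ) (ν := ν) Real.continuous_cos
      Real.abs_cos_le_one
      abs_cos_sub_cos_le hσ ((hX ν).continuous t θ) hσS le_rfl ht.1 ht.2
      (α := fun _ => L * c n) (β := fun _ => L * c n) continuous_const continuous_const h2
      (fun r hr hrt => h3 (θ, ν) r t hr hrt ht.2)).trans (le_of_eq ?_)
    rw [intervalIntegral.integral_const, smul_eq_mul, sub_zero, mul_comm]
  · have h1 := tendsto_one_div_add_atTop_nhds_zero_nat (𝕜 := ℝ)
    have h2 := hct.const_mul L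
    have h3 := (((h1.const_mul M).add (h2.const_mul M)).const_mul A).add
      ((((h2.add (h2.const_mul S)).mul_const t).const_mul A).const_mul M)
    simpa using h3

end

/-! ### Derivatives of limits with respect to the random parameter -/

/-- The `l`-th derivative of a representative of `h`, as an upper limit of difference quotients
of order one of the previous derivative; the representative is an upper limit of averages. -/
noncomputable def iteratedQuotient (h : ℝ → ℝ) : ℕ → ℝ → ℝ
  | 0, z => Filter.limsup (fun m : ℕ => ((m : ℝ) + 1) * ∫ r in Ioc z (z + 1 / ((m : ℝ) + 1)), h r)
      Filter.atTop
  | l + 1, z => Filter.limsup (fun m : ℕ => ((m : ℝ) + 1) *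
      (iteratedQuotient h l (z + 1 / ((m : ℝ) + 1)) - iteratedQuotient h l z)) Filter.atTop

/-- Countable upper limits give a candidate derivative that is jointly measurable in all variables
for any measurable `h`, differentiable or not. -/
theorem measurable_iteratedQuotient {X : Type*} [MeasurableSpace X] {h : X → ℝ → ℝ}
    (hh : Measurable (Function.uncurry h)) (l : ℕ) :
    Measurable fun p : X × ℝ => iteratedQuotient (h p.1) l p.2 := by
  induction l with
  | zero =>
    refine Measurable.limsup fun m => Measurable.const_mul ?_ _
    refine measurable_setIntegral_Ioc (F := fun (p : X × ℝ) r => h p.1 r) ?_ measurable_snd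
      (by fun_prop)
    exact hh.comp (f := fun q : (X × ℝ) × ℝ => (q.1.1, q.2)) (by fun_prop)
  | succ l ih =>
    refine Measurable.limsup fun m => Measurable.const_mul (Measurable.sub ?_ ih) _
    exact ih.comp (f := fun p : X × ℝ => (p.1, p.2 + 1 / ((m : ℝ) + 1))) (by fun_prop)

theorem iteratedQuotient_succ_eq {h : ℝ → ℝ} {l : ℕ} {z w : ℝ}
    (hd : HasDerivAt (iteratedQuotient h l) w z) : iteratedQuotient h (l + 1) z = w := by
  refine Filter.Tendsto.limsup_eq ?_
  have h1 := hasDerivAt_iff_tendsto_slope_zero.1 hd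
  have h2 : Filter.Tendsto (fun m : ℕ => 1 / ((m : ℝ) + 1)) Filter.atTop (nhdsWithin 0 {0}ᶜ) := by
    refine tendsto_nhdsWithin_iff.2 ⟨tendsto_one_div_add_atTop_nhds_zero_nat,
      Filter.Eventually.of_forall fun m => ?_⟩
    have : (0 : ℝ) < 1 / ((m : ℝ) + 1) := by positivity
    exact this.ne'
  refine (h1.comp h2).congr fun m => ?_
  simp only [Function.comp_apply, smul_eq_mul, one_div, inv_inv]

/-! ### Limits of functions with uniformly bounded derivatives. -/

section Limit

variable {a b K : ℝ}

/-- Shrinking averages ignore null sets and recover the value of the Lipschitz representative at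
every point. -/
theorem iteratedQuotient_zero_eq {h v : ℝ → ℝ} (hK : 0 ≤ K)
    (hv : ∀ x ∈ Ioo a b, ∀ y ∈ Ioo a b, |v x - v y| ≤ K * |x - y|)
    (he : ∀ᵐ r ∂(volume.restrict (Ioo a b)), h r = v r) {z : ℝ} (hz : z ∈ Ioo a b) :
    iteratedQuotient h 0 z = v z := by
  refine Filter.Tendsto.limsup_eq ?_
  rw [tendsto_iff_dist_tendsto_zero]
  have h0 := tendsto_one_div_add_atTop_nhds_zero_nat (𝕜 := ℝ)
  refine squeeze_zero' (g := fun m : ℕ => K * (1 / ((m : ℝ) + 1)))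
    (Filter.Eventually.of_forall fun _ => dist_nonneg) ?_ (by simpa using h0.const_mul K)
  filter_upwards [h0.eventually (gt_mem_nhds (sub_pos.2 hz.2))] with m hm
  set δ := 1 / ((m : ℝ) + 1) with hδ
  have hδ0 : 0 < δ := by positivity
  have hsub : Ioc z (z + δ) ⊆ Ioo a b := fun r hr => ⟨hz.1.trans hr.1, by linarith [hr.2]⟩
  have h1 : ∫ r in Ioc z (z + δ), h r = ∫ r in Ioc z (z + δ), v r :=
    integral_congr_ae (ae_restrict_of_ae_restrict_of_subset hsub he)
  have hc : ContinuousOn v (Icc z (z + δ)) := by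
    refine (LipschitzOnWith.of_dist_le_mul (K := K.toNNReal) (s := Ioo a b)
      fun x hx y hy => ?_).continuousOn.mono fun r hr => ⟨hz.1.trans_le hr.1, by linarith [hr.2]⟩
    rw [Real.coe_toNNReal _ hK]
    exact hv x hx y hy
  have hi : IntervalIntegrable v volume z (z + δ) :=
    hc.intervalIntegrable_of_Icc (by linarith)
  have h2 : ((m : ℝ) + 1) * ∫ r in Ioc z (z + δ), h r
      = v z + ((m : ℝ) + 1) * ∫ r in z..(z + δ), (v r - v z) := by
    rw [h1, ← intervalIntegral.integral_of_le (by linarith),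
      intervalIntegral.integral_sub hi intervalIntegrable_const, intervalIntegral.integral_const,
      smul_eq_mul, add_sub_cancel_left, hδ]
    field_simp
    ring
  have h3 : |∫ r in z..(z + δ), (v r - v z)| ≤ K * δ * |z + δ - z| := by
    rw [← Real.norm_eq_abs]
    refine intervalIntegral.norm_integral_le_of_norm_le_const fun r hr => ?_
    rw [uIoc_of_le (by linarith)] at hr
    refine (hv r (hsub hr) z hz).trans ?_
    rw [abs_of_pos (by linarith [hr.1])]
    gcongr
    linarith [hr.2]
  rw [Real.dist_eq, h2, add_sub_cancel_left, abs_mul, abs_of_pos (by positivity)]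
  calc ((m : ℝ) + 1) * |∫ r in z..(z + δ), (v r - v z)|
      ≤ ((m : ℝ) + 1) * (K * δ * |z + δ - z|) := by gcongr
    _ = K * δ := by
      rw [add_sub_cancel_left, abs_of_pos hδ0, hδ]
      field_simp

theorem exists_tendsto_of_lipschitz {h : ℕ → ℝ → ℝ} {w : ℝ → ℝ} (hK : 0 ≤ K)
    (hl : ∀ n, ∀ x ∈ Ioo a b, ∀ y ∈ Ioo a b, |h n x - h n y| ≤ K * |x - y|)
    (hw : ∀ᵐ r ∂(volume.restrict (Ioo a b)),
      Filter.Tendsto (fun n => h n r) Filter.atTop (nhds (w r))) {z : ℝ} (hz : z ∈ Ioo a b) :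
    ∃ v, Filter.Tendsto (fun n => h n z) Filter.atTop (nhds v) := by
  refine cauchySeq_tendsto_of_complete ?_
  rw [Metric.cauchySeq_iff']
  intro ε hε
  set δ := ε / (4 * (K + 1)) with hδ
  have hδ0 : 0 < δ := by positivity
  obtain ⟨y, hyJ, hy, hyz⟩ : ∃ y ∈ Ioo a b,
      Filter.Tendsto (fun n => h n y) Filter.atTop (nhds (w y)) ∧ |z - y| ≤ δ := by
    by_contra! hcon
    have hsub : Ioo z (min (z + δ) b) ⊆ {y | ¬ Filter.Tendsto (fun n => h n y) Filter.atTop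
        (nhds (w y))} ∩ Ioo a b := by
      intro y hy
      have h1 := hy.2.trans_le (min_le_left _ _)
      have h2 := hy.2.trans_le (min_le_right _ _)
      have hyJ : y ∈ Ioo a b := ⟨hz.1.trans hy.1, h2⟩
      refine ⟨fun ht => ?_, hyJ⟩
      have h3 := hcon y hyJ ht
      rw [abs_of_neg (by linarith [hy.1])] at h3
      linarith
    have h4 : volume ({y | ¬ Filter.Tendsto (fun n => h n y) Filter.atTop
        (nhds (w y))} ∩ Ioo a b) = 0 := by
      rw [← Measure.restrict_apply₀' measurableSet_Ioo.nullMeasurableSet]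
      exact hw
    have h5 := measure_mono_null hsub h4
    rw [Real.volume_Ioo, ENNReal.ofReal_eq_zero] at h5
    have h6 : z < min (z + δ) b := lt_min (by linarith) hz.2
    linarith
  obtain ⟨N, hN⟩ := Metric.cauchySeq_iff'.1 hy.cauchySeq (ε / 2) (half_pos hε)
  refine ⟨N, fun n hn => ?_⟩
  have h1 := hN n hn
  rw [Real.dist_eq] at h1 ⊢
  have h2 := hl n z hz y hyJ
  have h3 := hl N y hyJ z hz
  rw [abs_sub_comm y z] at h3
  have h4 : K * |z - y| ≤ ε / 4 := by
    calc K * |z - y| ≤ (K + 1) * δ := by gcongr; linarith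
      _ = ε / 4 := by rw [hδ]; field_simp
  rw [show h n z - h N z = (h n z - h n y) + (h n y - h N y) + (h N y - h N z) by ring]
  refine (abs_add_three _ _ _).trans_lt ?_
  linarith

theorem abs_taylor_le {u u' : ℝ → ℝ} (hu : ∀ x ∈ Ioo a b, HasDerivAt u (u' x) x)
    (hl : ∀ x ∈ Ioo a b, ∀ y ∈ Ioo a b, |u' x - u' y| ≤ K * |x - y|) (hK : 0 ≤ K) {y z : ℝ}
    (hy : y ∈ Ioo a b) (hz : z ∈ Ioo a b) :
    |u y - u z - u' z * (y - z)| ≤ K * |y - z| * |y - z| := by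
  have hsub : uIcc z y ⊆ Ioo a b := ordConnected_Ioo.uIcc_subset hz hy
  have h := (convex_uIcc z y).norm_image_sub_le_of_norm_hasDerivWithin_le
    (f := fun r => u r - u' z * r) (f' := fun r => u' r - u' z) (C := K * |y - z|)
    (fun r hr => by
      have := ((hu r (hsub hr)).sub ((hasDerivAt_id r).const_mul (u' z))).hasDerivWithinAt
        (s := uIcc z y)
      simpa using! this)
    (fun r hr => (hl r (hsub hr) z hz).trans
      (mul_le_mul_of_nonneg_left (abs_sub_left_of_mem_uIcc hr) hK))
    left_mem_uIcc right_mem_uIcc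
  simp only [Real.norm_eq_abs] at h
  convert! h using 2
  ring

/-- With equi-Lipschitz derivatives the Taylor remainder is quadratic uniformly in `n`. Difference
quotients with a small fixed increment thus force the derivatives to be Cauchy, and the limiting
Taylor estimate differentiates `v`. -/
theorem exists_tendsto_deriv {u u' : ℕ → ℝ → ℝ} {v : ℝ → ℝ} (hK : 0 ≤ K)
    (hu : ∀ n, ∀ x ∈ Ioo a b, HasDerivAt (u n) (u' n x) x)
    (hl : ∀ n, ∀ x ∈ Ioo a b, ∀ y ∈ Ioo a b, |u' n x - u' n y| ≤ K * |x - y|)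
    (hv : ∀ x ∈ Ioo a b, Filter.Tendsto (fun n => u n x) Filter.atTop (nhds (v x))) {z : ℝ}
    (hz : z ∈ Ioo a b) :
    ∃ w, Filter.Tendsto (fun n => u' n z) Filter.atTop (nhds w) ∧ HasDerivAt v w z := by
  have ht : ∀ n, ∀ y ∈ Ioo a b, |u n y - u n z - u' n z * (y - z)| ≤ K * |y - z| * |y - z| :=
    fun n y hy => abs_taylor_le (hu n) (hl n) hK hy hz
  have hc : CauchySeq fun n => u' n z := by
    rw [Metric.cauchySeq_iff']
    intro ε hε
    set δ := min ((b - z) / 2) (ε / (4 * (K + 1))) with hδ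
    have hδ0 : 0 < δ := lt_min (by linarith [hz.2]) (by positivity)
    have hδb : δ ≤ (b - z) / 2 := min_le_left _ _
    have hδε : (K + 1) * δ ≤ ε / 4 := by
      calc (K + 1) * δ ≤ (K + 1) * (ε / (4 * (K + 1))) := by gcongr; exact min_le_right _ _
        _ = ε / 4 := by field_simp
    have hy : z + δ ∈ Ioo a b := ⟨by linarith [hz.1], by linarith [hz.2]⟩
    obtain ⟨N, hN⟩ := Metric.cauchySeq_iff'.1 ((hv _ hy).sub (hv z hz)).cauchySeq
      (δ * (ε / 4)) (by positivity)
    refine ⟨N, fun n hn => ?_⟩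
    have h1 := hN n hn
    have h2 := ht n _ hy
    have h3 := ht N _ hy
    rw [Real.dist_eq] at h1 ⊢
    rw [add_sub_cancel_left, abs_of_pos hδ0] at h2 h3
    have h4 : δ * |u' n z - u' N z| < δ * ε := by
      rw [← abs_of_pos hδ0, ← abs_mul, abs_of_pos hδ0,
        show δ * (u' n z - u' N z) = -(u n (z + δ) - u n z - u' n z * δ)
        + (u n (z + δ) - u n z - (u N (z + δ) - u N z))
        + (u N (z + δ) - u N z - u' N z * δ) by ring]
      refine (abs_add_three _ _ _).trans_lt ?_
      rw [abs_neg]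
      have h5 : K * δ * δ ≤ ε / 4 * δ := by
        gcongr
        linarith
      nlinarith
    exact lt_of_mul_lt_mul_left h4 hδ0.le
  obtain ⟨w, hw⟩ := cauchySeq_tendsto_of_complete hc
  refine ⟨w, hw, ?_⟩
  have hlim : ∀ y ∈ Ioo a b, |v y - v z - w * (y - z)| ≤ K * |y - z| * |y - z| := fun y hy =>
    le_of_tendsto ((((hv y hy).sub (hv z hz)).sub (hw.mul_const _)).abs)
      (Filter.Eventually.of_forall fun n => ht n y hy)
  rw [hasDerivAt_iff_isLittleO]
  have hO : (fun y => v y - v z - (y - z) • w) =O[nhds z] fun y => (y - z) * (y - z) := by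
    refine Asymptotics.IsBigO.of_bound K ?_
    filter_upwards [isOpen_Ioo.mem_nhds hz] with y hy
    rw [smul_eq_mul, mul_comm (y - z) w, norm_mul, ← mul_assoc]
    exact hlim y hy
  refine hO.trans_isLittleO ?_
  have h0 : Filter.Tendsto (fun y : ℝ => y - z) (nhds z) (nhds 0) := by
    have : Continuous fun y : ℝ => y - z := by fun_prop
    simpa using this.tendsto z
  have h1 := (Asymptotics.isLittleO_one_iff ℝ).2 h0
  simpa using h1.mul_isBigO (Asymptotics.isBigO_refl (fun y : ℝ => y - z) (nhds z))

/-- Properties of the derivatives of a function on `(a, b)` of class `W^{k,∞}`. -/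
structure HasQuotients (k : ℕ) (K a b : ℝ) (h : ℝ → ℝ) : Prop where
  ae_eq : ∀ᵐ z ∂(volume.restrict (Ioo a b)), iteratedQuotient h 0 z = h z
  lipschitz : ∀ l < k, ∀ x ∈ Ioo a b, ∀ y ∈ Ioo a b,
    |iteratedQuotient h l x - iteratedQuotient h l y| ≤ K * |x - y|
  hasDerivAt : ∀ l < k, ∀ᵐ z ∂(volume.restrict (Ioo a b)),
    HasDerivAt (iteratedQuotient h l) (iteratedQuotient h (l + 1) z) z

/-- Orders below `k` converge pointwise, one after the other, because the next derivative is
bounded. At order `k` no convergence is claimed; this derivative exists almost everywhere as that of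
a Lipschitz function. -/
theorem hasQuotients_of_tendsto {k : ℕ} (hk : 1 ≤ k) (hK : 0 ≤ K) {u : ℕ → ℝ → ℝ} {h : ℝ → ℝ}
    (hu : ∀ n, ContDiffOn ℝ k (u n) (Ioo a b))
    (hb : ∀ n, ∀ l, 1 ≤ l → l ≤ k → ∀ z ∈ Ioo a b, |iteratedDerivWithin l (u n) (Ioo a b) z| ≤ K)
    (hh : ∀ᵐ z ∂(volume.restrict (Ioo a b)),
      Filter.Tendsto (fun n => u n z) Filter.atTop (nhds (h z))) : HasQuotients k K a b h := by
  have hder : ∀ n, ∀ l < k, ∀ x ∈ Ioo a b, HasDerivAt (iteratedDerivWithin l (u n) (Ioo a b))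
      (iteratedDerivWithin (l + 1) (u n) (Ioo a b) x) x := by
    intro n l hl x hx
    have h1 := (hu n).differentiableOn_iteratedDerivWithin (m := l) (by exact_mod_cast hl)
      isOpen_Ioo.uniqueDiffOn x hx
    rw [iteratedDerivWithin_succ]
    exact h1.hasDerivWithinAt.hasDerivAt (isOpen_Ioo.mem_nhds hx)
  have hlip : ∀ n, ∀ l < k, ∀ x ∈ Ioo a b, ∀ y ∈ Ioo a b,
      |iteratedDerivWithin l (u n) (Ioo a b) x - iteratedDerivWithin l (u n) (Ioo a b) y|
        ≤ K * |x - y| := by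
    intro n l hl x hx y hy
    exact (convex_Ioo a b).norm_image_sub_le_of_norm_hasDerivWithin_le
      (fun z hz => (hder n l hl z hz).hasDerivWithinAt)
      (fun z hz => hb n (l + 1) (by omega) hl z hz) hy hx
  have hlim : ∀ l < k, ∀ z ∈ Ioo a b, Filter.Tendsto
      (fun n => iteratedDerivWithin l (u n) (Ioo a b) z) Filter.atTop
      (nhds (iteratedQuotient h l z)) := by
    intro l
    induction l with
    | zero =>
      intro hl
      have hlip0 := fun n => hlip n 0 hl
      simp only [iteratedDerivWithin_zero] at hlip0 ⊢
      have hex : ∀ z, ∃ v, z ∈ Ioo a b →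
          Filter.Tendsto (fun n => u n z) Filter.atTop (nhds v) := by
        intro z
        by_cases hz : z ∈ Ioo a b
        · obtain ⟨v, hv⟩ := exists_tendsto_of_lipschitz hK hlip0 hh hz
          exact ⟨v, fun _ => hv⟩
        · exact ⟨0, fun h => absurd h hz⟩
      choose v hv using hex
      intro z hz
      rw [iteratedQuotient_zero_eq (v := v) hK (fun x hx y hy => le_of_tendsto
        ((hv x hx).sub (hv y hy)).abs (Filter.Eventually.of_forall fun n => hlip0 n x hx y hy)) ?_ hz]
      · exact hv z hz
      · filter_upwards [hh, ae_restrict_mem measurableSet_Ioo] with r hr hrJ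
        exact tendsto_nhds_unique hr (hv r hrJ)
    | succ l ih =>
      intro hl z hz
      obtain ⟨w, hw, hwd⟩ := exists_tendsto_deriv hK (fun n => hder n l (by omega))
        (fun n => hlip n (l + 1) hl) (ih (by omega)) hz
      rwa [iteratedQuotient_succ_eq hwd]
  have hlipq : ∀ l < k, ∀ x ∈ Ioo a b, ∀ y ∈ Ioo a b,
      |iteratedQuotient h l x - iteratedQuotient h l y| ≤ K * |x - y| := fun l hl x hx y hy =>
    le_of_tendsto ((hlim l hl x hx).sub (hlim l hl y hy)).abs
      (Filter.Eventually.of_forall fun n => hlip n l hl x hx y hy)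
  refine ⟨?_, hlipq, fun l hl => ?_⟩
  · filter_upwards [hh, ae_restrict_mem measurableSet_Ioo] with z hz hzJ
    have := hlim 0 (by omega) z hzJ
    simp only [iteratedDerivWithin_zero] at this
    exact tendsto_nhds_unique this hz
  · have hL : LipschitzOnWith K.toNNReal (iteratedQuotient h l) (Ioo a b) :=
      LipschitzOnWith.of_dist_le_mul fun x hx y hy => by
        rw [Real.coe_toNNReal _ hK]
        exact hlipq l hl x hx y hy
    -- Rademacher's theorem in one dimension.
    filter_upwards [hL.ae_differentiableWithinAt_real measurableSet_Ioo,
      ae_restrict_mem measurableSet_Ioo] with z hz hzJ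
    have h1 := hz.hasDerivWithinAt.hasDerivAt (isOpen_Ioo.mem_nhds hzJ)
    rwa [iteratedQuotient_succ_eq h1]

theorem HasQuotients.ae_abs_le {k : ℕ} {h : ℝ → ℝ} (H : HasQuotients k K a b h) {l : ℕ}
    (h1 : 1 ≤ l) (hl : l ≤ k) :
    ∀ᵐ z ∂(volume.restrict (Ioo a b)), |iteratedQuotient h l z| ≤ K := by
  obtain ⟨l, rfl⟩ := Nat.exists_eq_add_of_le' h1
  filter_upwards [H.hasDerivAt l (by omega), ae_restrict_mem measurableSet_Ioo] with z hz hzJ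
  -- The interval contains `z`, so it is nonempty, and the Lipschitz bound at two distinct points
  -- forces the sign.
  have hK : 0 ≤ K := by
    by_contra hneg
    have h2 := (abs_nonneg _).trans (H.lipschitz l (by omega) z hzJ ((z + b) / 2)
      ⟨by linarith [hzJ.1, hzJ.2], by linarith [hzJ.2]⟩)
    have h3 : 0 < |z - (z + b) / 2| := abs_pos.2 (by linarith [hzJ.2])
    nlinarith
  have hL : LipschitzOnWith K.toNNReal (iteratedQuotient h l) (Ioo a b) :=
    LipschitzOnWith.of_dist_le_mul fun x hx y hy => by
      rw [Real.coe_toNNReal _ hK]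
      exact H.lipschitz l (by omega) x hx y hy
  have h4 := hz.le_of_lipschitzOn (isOpen_Ioo.mem_nhds hzJ) hL
  rwa [Real.coe_toNNReal _ hK] at h4

end Limit

/-! ### Weak derivatives with respect to the random parameter -/

theorem tsupport_iteratedDeriv_subset (l : ℕ) (φ : ℝ → ℝ) :
    tsupport (iteratedDeriv l φ) ⊆ tsupport φ := by
  induction l with
  | zero => rw [iteratedDeriv_zero]
  | succ l ih =>
    rw [iteratedDeriv_succ]
    exact tsupport_deriv_subset.trans ih

theorem exists_Ioo_of_isCompact {s : Set ℝ} (hs : IsCompact s) {a b : ℝ} (hab : a < b)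
    (h : s ⊆ Ioo a b) : ∃ a' b', a < a' ∧ a' < b' ∧ b' < b ∧ s ⊆ Ioo a' b' := by
  rcases s.eq_empty_or_nonempty with rfl | hne
  · exact ⟨(2 * a + b) / 3, (a + 2 * b) / 3, by linarith, by linarith, by linarith, empty_subset _⟩
  · obtain ⟨x, hx⟩ := hs.exists_isLeast hne
    obtain ⟨y, hy⟩ := hs.exists_isGreatest hne
    have h1 := h hx.1
    have h2 := h hy.1
    have h3 := hx.2 hy.1
    exact ⟨(a + x) / 2, (y + b) / 2, by linarith [h1.1], by linarith [h1.1, h2.2],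
      by linarith [h2.2], fun r hr => ⟨by linarith [hx.2 hr, h1.1], by linarith [hy.2 hr, h2.2]⟩⟩

theorem setIntegral_mul_eq_of_tsupport_subset {v φ : ℝ → ℝ} {s t : Set ℝ} (ht : MeasurableSet t)
    (hφ : tsupport φ ⊆ s) (hst : s ⊆ t) : ∫ z in t, v z * φ z = ∫ z in s, v z * φ z :=
  setIntegral_eq_of_subset_of_forall_sdiff_eq_zero ht hst fun z hz => by
    rw [image_eq_zero_of_notMem_tsupport fun h => hz.2 (hφ h), mul_zero]

section

variable {a b K : ℝ}

/-- Lipschitz functions are absolutely continuous, so integration by parts holds on a slightly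
smaller interval containing the support of `φ`, at whose ends `φ` vanishes. -/
theorem setIntegral_mul_deriv_eq_neg (hab : a < b) (hK : 0 ≤ K) {v w φ : ℝ → ℝ}
    (hv : ∀ x ∈ Ioo a b, ∀ y ∈ Ioo a b, |v x - v y| ≤ K * |x - y|)
    (hd : ∀ᵐ z ∂(volume.restrict (Ioo a b)), HasDerivAt v (w z) z)
    (hφ : ContDiff ℝ ∞ φ) (hc : HasCompactSupport φ) (hs : tsupport φ ⊆ Ioo a b) :
    ∫ z in Ioo a b, v z * deriv φ z = -∫ z in Ioo a b, w z * φ z := by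
  obtain ⟨a', b', ha, hab', hb, hsub⟩ := exists_Ioo_of_isCompact hc hab hs
  have hIcc : Icc a' b' ⊆ Ioo a b := fun z hz => ⟨ha.trans_le hz.1, hz.2.trans_lt hb⟩
  have hIoc : tsupport φ ⊆ Ioc a' b' := hsub.trans Ioo_subset_Ioc_self
  have hIocs : Ioc a' b' ⊆ Ioo a b := Ioc_subset_Icc_self.trans hIcc
  rw [setIntegral_mul_eq_of_tsupport_subset measurableSet_Ioo (tsupport_deriv_subset.trans hIoc)
    hIocs, setIntegral_mul_eq_of_tsupport_subset measurableSet_Ioo hIoc hIocs,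
    ← intervalIntegral.integral_of_le hab'.le, ← intervalIntegral.integral_of_le hab'.le]
  have hvac : AbsolutelyContinuousOnInterval v a' b' := by
    refine LipschitzOnWith.absolutelyContinuousOnInterval (K := K.toNNReal)
      (LipschitzOnWith.of_dist_le_mul fun x hx y hy => ?_)
    rw [uIcc_of_le hab'.le] at hx hy
    rw [Real.coe_toNNReal _ hK]
    exact hv x (hIcc hx) y (hIcc hy)
  obtain ⟨C, hC⟩ := isCompact_Icc.exists_bound_of_continuousOn (s := Icc a' b')
    (hφ.continuous_deriv (by simp)).continuousOn
  have hφac : AbsolutelyContinuousOnInterval φ a' b' := by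
    refine LipschitzOnWith.absolutelyContinuousOnInterval (K := C.toNNReal)
      (LipschitzOnWith.of_dist_le_mul fun x hx y hy => ?_)
    rw [uIcc_of_le hab'.le] at hx hy
    have hC0 : 0 ≤ C := (norm_nonneg _).trans (hC x hx)
    rw [Real.coe_toNNReal _ hC0]
    exact (convex_Icc a' b').norm_image_sub_le_of_norm_deriv_le
      (fun z _ => hφ.differentiable (by simp) z) hC hy hx
  have h0a : φ a' = 0 := image_eq_zero_of_notMem_tsupport fun h => lt_irrefl _ (hsub h).1
  have h0b : φ b' = 0 := image_eq_zero_of_notMem_tsupport fun h => lt_irrefl _ (hsub h).2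
  rw [hvac.integral_mul_deriv_eq_deriv_mul hφac, h0a, h0b, mul_zero, mul_zero, sub_zero, zero_sub]
  congr 1
  refine intervalIntegral.integral_congr_ae ?_
  have := (ae_restrict_iff' measurableSet_Ioo).1 hd
  filter_upwards [this] with z hz hz2
  rw [uIoc_of_le hab'.le] at hz2
  rw [(hz (hIocs hz2)).deriv]

theorem HasQuotients.weak {k : ℕ} {h : ℝ → ℝ} (H : HasQuotients k K a b h) (hab : a < b)
    (hK : 0 ≤ K) {l : ℕ} (hl : l ≤ k) : ∀ {φ : ℝ → ℝ}, ContDiff ℝ ∞ φ → HasCompactSupport φ →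
      tsupport φ ⊆ Ioo a b → ∫ z in Ioo a b, h z * iteratedDeriv l φ z
        = (-1) ^ l * ∫ z in Ioo a b, iteratedQuotient h l z * φ z := by
  induction l with
  | zero =>
    intro φ _ _ _
    rw [pow_zero, one_mul, iteratedDeriv_zero]
    refine integral_congr_ae ?_
    filter_upwards [H.ae_eq] with z hz
    rw [hz]
  | succ l ih =>
    intro φ hφ hc hs
    have h1 : ContDiff ℝ ∞ (deriv φ) := by
      have := hφ.iterate_deriv 1
      simpa using this
    rw [iteratedDeriv_succ', ih (by omega) h1 hc.deriv (tsupport_deriv_subset.trans hs),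
      setIntegral_mul_deriv_eq_neg hab hK (H.lipschitz l hl) (H.hasDerivAt l hl) hφ hc hs]
    ring

theorem HasQuotients.integrableOn {k : ℕ} {h : ℝ → ℝ} (H : HasQuotients k K a b h) (hk : 1 ≤ k)
    (hab : a < b) (hK : 0 ≤ K) (hm : Measurable h) {l : ℕ} (hl : l ≤ k) :
    IntegrableOn (iteratedQuotient h l) (Ioo a b) := by
  have hmeas : Measurable (iteratedQuotient h l) :=
    (measurable_iteratedQuotient (X := Unit) (h := fun _ => h) (hm.comp measurable_snd) l).comp
      (f := fun z : ℝ => ((), z)) (by fun_prop)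
  obtain ⟨B, hB⟩ : ∃ B, ∀ᵐ z ∂(volume.restrict (Ioo a b)), |iteratedQuotient h l z| ≤ B := by
    rcases Nat.eq_zero_or_pos l with rfl | hpos
    · refine ⟨|iteratedQuotient h 0 ((a + b) / 2)| + K * (b - a), ?_⟩
      filter_upwards [ae_restrict_mem measurableSet_Ioo] with z hz
      have h1 := H.lipschitz 0 hk z hz ((a + b) / 2) ⟨by linarith, by linarith⟩
      have h2 : |z - (a + b) / 2| ≤ b - a := abs_le.2 ⟨by linarith [hz.1], by linarith [hz.2]⟩
      have h3 := mul_le_mul_of_nonneg_left h2 hK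
      have h4 := abs_sub_abs_le_abs_sub (iteratedQuotient h 0 z)
        (iteratedQuotient h 0 ((a + b) / 2))
      linarith
    · exact ⟨K, H.ae_abs_le hpos hl⟩
  exact Integrable.of_bound hmeas.aestronglyMeasurable B hB

end

/-- The members of an exhaustion of `(1, ∞)`. -/
def exhaustion (m : ℕ) : Set ℝ := Ioo (1 + 1 / ((m : ℝ) + 2)) ((m : ℝ) + 3)

theorem exists_subset_exhaustion {s : Set ℝ} (hs : IsCompact s) (h : s ⊆ Ioi 1) :
    ∃ m, s ⊆ exhaustion m := by
  rcases s.eq_empty_or_nonempty with rfl | hne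
  · exact ⟨0, empty_subset _⟩
  obtain ⟨x, hx⟩ := hs.exists_isLeast hne
  obtain ⟨y, hy⟩ := hs.exists_isGreatest hne
  have h1 : 0 < x - 1 := sub_pos.2 (h hx.1)
  obtain ⟨m, hm⟩ := exists_nat_gt (max y (1 / (x - 1)))
  have hm1 := (le_max_left _ _).trans_lt hm
  have hm2 := (le_max_right _ _).trans_lt hm
  refine ⟨m, fun z hz => ⟨?_, by linarith [hy.2 hz]⟩⟩
  have h3 : 1 / ((m : ℝ) + 2) < x - 1 := by
    rw [div_lt_comm₀ (by positivity) h1]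
    linarith
  linarith [hx.2 hz]

theorem exhaustion_subset (m : ℕ) : exhaustion m ⊆ Ioi 1 := fun z hz => by
  have : (0 : ℝ) < 1 / ((m : ℝ) + 2) := by positivity
  exact lt_trans (by linarith) hz.1

theorem exhaustion_lt (m : ℕ) : 1 + 1 / ((m : ℝ) + 2) < (m : ℝ) + 3 := by
  have h1 : 1 / ((m : ℝ) + 2) ≤ 1 :=
    (div_le_one (by positivity)).2 (by linarith [m.cast_nonneg (α := ℝ)])
  linarith [m.cast_nonneg (α := ℝ)]

/-- Being a weak derivative is local: each test function is supported in one member of the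
exhaustion, so the constants may depend on `m`. -/
theorem weak_of_hasQuotients {k : ℕ} (hk : 1 ≤ k) {h : ℝ → ℝ} (hm : Measurable h)
    (H : ∀ m : ℕ, ∃ K, 0 ≤ K ∧ HasQuotients k K (1 + 1 / ((m : ℝ) + 2)) ((m : ℝ) + 3) h) {l : ℕ}
    (hl : l ≤ k) :
    LocallyIntegrableOn h (Ioi 1) ∧ LocallyIntegrableOn (iteratedQuotient h l) (Ioi 1) ∧
    ∀ φ : ℝ → ℝ, ContDiff ℝ ∞ φ → HasCompactSupport φ → tsupport φ ⊆ Ioi 1 →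
      ∫ z in Ioi 1, h z * iteratedDeriv l φ z
        = (-1) ^ l * ∫ z in Ioi 1, iteratedQuotient h l z * φ z := by
  have hloc : ∀ u : ℝ → ℝ, (∀ m, IntegrableOn u (exhaustion m)) →
      LocallyIntegrableOn u (Ioi 1) := by
    intro u hu z hz
    obtain ⟨m, hm⟩ := exists_subset_exhaustion (isCompact_singleton (x := z))
      (singleton_subset_iff.2 hz)
    exact ⟨exhaustion m, mem_nhdsWithin_of_mem_nhds
      (isOpen_Ioo.mem_nhds (hm (mem_singleton z))), hu m⟩
  refine ⟨hloc _ fun m => ?_, hloc _ fun m => ?_, fun φ hφ hc hs => ?_⟩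
  · obtain ⟨K, hK, Hm⟩ := H m
    exact (Hm.integrableOn hk (exhaustion_lt m) hK hm (Nat.zero_le _)).congr_fun_ae Hm.ae_eq
  · obtain ⟨K, hK, Hm⟩ := H m
    exact Hm.integrableOn hk (exhaustion_lt m) hK hm hl
  · obtain ⟨m, hm⟩ := exists_subset_exhaustion hc hs
    obtain ⟨K, hK, Hm⟩ := H m
    rw [setIntegral_mul_eq_of_tsupport_subset measurableSet_Ioi
      ((tsupport_iteratedDeriv_subset l φ).trans hm) (exhaustion_subset m),
      setIntegral_mul_eq_of_tsupport_subset measurableSet_Ioi hm (exhaustion_subset m)]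
    exact Hm.weak (exhaustion_lt m) hK hl hφ hc hm

/-! ### Uniform bounds for the solution -/

/-- The exponential times a bump: all derivatives become bounded on the line, and nothing changes on
the range that the exponent can attain. -/
theorem exists_cutoff (k : ℕ) (R : ℝ) : ∃ (η : ℝ → ℝ) (B : ℝ), ContDiff ℝ k η ∧
    (∀ j ≤ k, ∀ x, |iteratedDeriv j η x| ≤ B) ∧ ∀ x, |x| ≤ R → η x = Real.exp x := by
  let β : ContDiffBump (0 : ℝ) := ⟨|R| + 1, |R| + 2, by positivity, by linarith⟩
  set η : ℝ → ℝ := fun x => Real.exp x * β x with hη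
  have hs : ContDiff ℝ ∞ η := Real.contDiff_exp.mul β.contDiff
  have hc : HasCompactSupport η := β.hasCompactSupport.mul_left
  have hb : ∀ j : ℕ, ∃ B, ∀ x, |iteratedDeriv j η x| ≤ B := by
    intro j
    have h1 : HasCompactSupport (iteratedDeriv j η) :=
      hc.mono' (subset_closure.trans (tsupport_iteratedDeriv_subset j η))
    exact h1.exists_bound_of_continuous
      (hs.continuous_iteratedDeriv j (by exact_mod_cast le_top))
  choose B hB using hb
  refine ⟨η, ∑ j ∈ Finset.range (k + 1), B j, hs.of_le (by exact_mod_cast le_top),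
    fun j hj x => (hB j x).trans ?_, fun x hx => ?_⟩
  · exact Finset.single_le_sum (f := B) (fun i _ => (abs_nonneg _).trans (hB i 0))
      (Finset.mem_range.2 (by omega))
  · rw [hη]
    simp only
    rw [β.one_of_mem_closedBall, mul_one]
    rw [mem_closedBall_zero_iff, Real.norm_eq_abs]
    change |x| ≤ |R| + 1
    linarith [le_abs_self R]

/-- The order of the quantifiers matters: `K` precedes the laws, the datum, the solution and the
interval. The factor `t` comes from `exists_density_bound`. -/
theorem exists_quotient_bound {k : ℕ} (hk : 1 ≤ k) {T : ℝ} (hT : 0 ≤ T) {κ : ℝ} (hκ : 0 ≤ κ)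
    (C M : ℝ) : ∃ K, 0 ≤ K ∧ ∀ (g : ℝ → ℝ) (φ : ℕ → ℝ → ℝ → ℝ) (fin F : ℝ → ℝ → ℝ)
      (f : ℝ → ℝ → ℝ → ℝ → ℝ), IsProbDensity volume g → IsInitialDatum g fin →
      IsRegularization k M φ F → (∀ᵐ ν ∂(freqLaw g), ∀ᵐ θ ∂torus, F θ ν = fin θ ν) →
      IsGlobalSolution κ g fin f → ∀ a b, 1 < a →
      (∀ l ≤ k, ∀ θ, ∀ z ∈ Ioo a b, |iteratedDeriv l (influence θ) z| ≤ C) →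
      ∀ t ∈ Icc 0 T, ∀ᵐ x ∂(torus.prod (freqLaw g)), HasQuotients k (K * t) a b (f t x.1 x.2) := by
  obtain ⟨η, B, hη, hηB, hηe⟩ := exists_cutoff k (κ * C * T)
  set A := 1 + T + κ + |C| + |M| + |B| with hA
  have hC0 := abs_nonneg C
  have hM0 := abs_nonneg M
  have hB0 := abs_nonneg B
  have hA1 : 1 ≤ A := by linarith
  obtain ⟨K, hK, hKb⟩ := exists_density_bound k hA1 hT
  refine ⟨K, hK, fun g φ fin F f hg hfin hr hFw hf a b ha hI t ht => ?_⟩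
  have : IsProbabilityMeasure (freqLaw g) := hg.isProbabilityMeasure
  have d : IsSchemeData k A T κ g φ η (Ioo a b) :=
    { prob := hg
      isOpen := isOpen_Ioo
      subset := fun z hz => ha.trans hz.1
      one_le := hA1
      time_nonneg := hT
      time_le := by linarith
      coupling_nonneg := hκ
      coupling_le := by linarith
      influence_le := fun l hl θ z hz => (hI l hl θ z hz).trans (by linarith [le_abs_self C])
      measurable_datum := hr.measurable_approx
      contDiff_datum := hr.contDiff_approx
      datum_le := fun n ν j hj θ => (hr.approx_le n ν j hj θ).trans (by linarith [le_abs_self M])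
      contDiff_cutoff := hη
      cutoff_le := fun j hj x => (hηB j hj x).trans (by linarith [le_abs_self B]) }
  have hconv : ∀ᵐ z ∂(volume.restrict (Ioo a b)), ∀ᵐ ν ∂(freqLaw g), ∀ᵐ θ ∂torus,
      Filter.Tendsto (fun n => density (φ n) η (scheme κ g φ η n).1 (scheme κ g φ η n).2 t θ ν z)
        Filter.atTop (nhds (f t θ ν z)) := by
    have hsub : Ioo a b ⊆ Ici 1 := fun z hz => (ha.trans hz.1).le
    filter_upwards [ae_restrict_of_ae_restrict_of_subset hsub hf.weak,
      ae_restrict_mem measurableSet_Ioo] with z hz hzJ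
    have hz' : SolvesAt κ g fin f z := hz
    have h1 := hz'.tendsto_density d hk hr hzJ hfin hf.measurable (B := C)
      (fun θ => by simpa using hI 0 (Nat.zero_le _) θ z hzJ) hηe hFw
    filter_upwards [h1] with ν hν using hν t ht
  have hdm : ∀ n, Measurable fun p : (ℝ × ℝ) × ℝ =>
      density (φ n) η (scheme κ g φ η n).1 (scheme κ g φ η n).2 t p.1.1 p.1.2 p.2 := fun n =>
    ((d.isState n).measurable_density d n).comp
      (f := fun p : (ℝ × ℝ) × ℝ => (t, p.1.1, p.1.2, p.2)) (by fun_prop)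
  have hfm : Measurable fun p : (ℝ × ℝ) × ℝ => f t p.1.1 p.1.2 p.2 :=
    hf.measurable.comp (f := fun p : (ℝ × ℝ) × ℝ => (t, p.1.1, p.1.2, p.2)) (by fun_prop)
  have hmeas := measurableSet_tendsto_fun (l := Filter.atTop) hdm hfm
  have hconv2 : ∀ᵐ x ∂(torus.prod (freqLaw g)), ∀ᵐ z ∂(volume.restrict (Ioo a b)),
      Filter.Tendsto (fun n => density (φ n) η (scheme κ g φ η n).1 (scheme κ g φ η n).2
        t x.1 x.2 z) Filter.atTop (nhds (f t x.1 x.2 z)) := by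
    -- Convergence is known for almost every `z` first. Fubini exchanges the quantifiers, so that
    -- for almost every `(θ, ν)` it holds along almost every `z`.
    refine (Measure.ae_ae_comm (p := fun (x : ℝ × ℝ) (z : ℝ) => Filter.Tendsto
      (fun n => density (φ n) η (scheme κ g φ η n).1 (scheme κ g φ η n).2 t x.1 x.2 z)
      Filter.atTop (nhds (f t x.1 x.2 z))) hmeas).2 ?_
    filter_upwards [hconv] with z hz
    have hmz : MeasurableSet {x : ℝ × ℝ | Filter.Tendsto (fun n => density (φ n) η
        (scheme κ g φ η n).1 (scheme κ g φ η n).2 t x.1 x.2 z) Filter.atTop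
        (nhds (f t x.1 x.2 z))} :=
      hmeas.preimage (by fun_prop : Measurable fun x : ℝ × ℝ => (x, z))
    rw [Measure.ae_prod_iff_ae_ae hmz]
    exact (Measure.ae_ae_comm (p := fun (θ ν : ℝ) => Filter.Tendsto
      (fun n => density (φ n) η (scheme κ g φ η n).1 (scheme κ g φ η n).2 t θ ν z)
      Filter.atTop (nhds (f t θ ν z))) hmz).2 hz
  filter_upwards [hconv2] with x hx
  exact hasQuotients_of_tendsto hk (mul_nonneg hK ht.1)
    (fun n => d.contDiffOn_density n ht x.1 x.2)
    (fun n l h1 hl z hz => hKb d n t ht x.1 x.2 l h1 hl z hz) hx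

/-! ### Almost everywhere bounds -/

theorem le_of_ae_torus_le {u : ℝ → ℝ} (hu : Continuous u) (hp : Function.Periodic u (2 * Real.pi))
    {c : ℝ} (h : ∀ᵐ θ ∂torus, u θ ≤ c) (θ : ℝ) : u θ ≤ c := by
  obtain ⟨x, hx, hxe⟩ := hp.exists_mem_Ico₀ Real.two_pi_pos θ
  rw [hxe]
  by_contra! hcon
  obtain ⟨δ, hδ, hsub⟩ := Metric.eventually_nhds_iff.1 (hu.continuousAt.eventually
    (lt_mem_nhds hcon))
  have h1 : Ioo x (min (x + δ) (2 * Real.pi)) ⊆ {y | ¬ u y ≤ c} ∩ Ioc 0 (2 * Real.pi) := by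
    intro y hy
    have h2 := hy.2.trans_le (min_le_left _ _)
    have h3 := hy.2.trans_le (min_le_right _ _)
    refine ⟨not_le.2 (hsub ?_), hx.1.trans_lt hy.1, h3.le⟩
    rw [Real.dist_eq, abs_of_pos (by linarith [hy.1])]
    linarith
  have h4 : volume ({y | ¬ u y ≤ c} ∩ Ioc 0 (2 * Real.pi)) = 0 := by
    rw [← Measure.restrict_apply₀' measurableSet_Ioc.nullMeasurableSet]
    exact h
  have h5 := measure_mono_null h1 h4
  rw [Real.volume_Ioo, ENNReal.ofReal_eq_zero] at h5
  have h6 : x < min (x + δ) (2 * Real.pi) := lt_min (by linarith) hx.2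
  linarith

theorem ae_abs_le_of_eLpNorm_top_le {X : Type*} [MeasurableSpace X] {μ : Measure X} {u : X → ℝ}
    {C : ℝ} (h : eLpNorm u ⊤ μ ≤ ENNReal.ofReal C) : ∀ᵐ x ∂μ, |u x| ≤ |C| := by
  rw [eLpNorm_exponent_top] at h
  filter_upwards [ae_le_eLpNormEssSup (f := u) (μ := μ)] with x hx
  have h1 := (hx.trans h).trans (ENNReal.ofReal_le_ofReal (le_abs_self C))
  rw [Real.enorm_eq_ofReal_abs] at h1
  exact (ENNReal.ofReal_le_ofReal_iff (abs_nonneg C)).1 h1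

theorem one_le_toReal {p : ℝ≥0∞} (hp : 1 ≤ p) (hpt : p ≠ ⊤) : 1 ≤ p.toReal := by
  simpa using ENNReal.toReal_mono hpt hp

theorem randLaw_absolutelyContinuous (ρ : ℝ → ℝ) : randLaw ρ ≪ zLebesgue :=
  withDensity_absolutelyContinuous _ _

theorem ae_randLaw_gt_one (ρ : ℝ → ℝ) : ∀ᵐ z ∂(randLaw ρ), 1 < z := by
  refine (randLaw_absolutelyContinuous ρ).ae_le ?_
  have h1 : ∀ᵐ z ∂zLebesgue, z ∈ Ici (1 : ℝ) := ae_restrict_mem measurableSet_Ici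
  have h2 : ∀ᵐ z ∂zLebesgue, z ≠ 1 := ae_restrict_of_ae (Measure.ae_ne volume _)
  filter_upwards [h1, h2] with z hz1 hz2 using lt_of_le_of_ne hz1 hz2.symm

theorem continuous_iteratedDeriv_influence (l : ℕ) {z : ℝ} (hz : 1 < z) :
    Continuous fun θ : ℝ => iteratedDeriv l (influence θ) z := by
  have h1 : Continuous fun θ : ℝ => (θ, z) := by fun_prop
  have h2 : ∀ θ : ℝ, (θ, z) ∈ (univ ×ˢ Ioi 1 : Set (ℝ × ℝ)) := fun θ =>
    mk_mem_prod (mem_univ _) hz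
  generalize hu : (fun p : ℝ × ℝ => iteratedDeriv l (influence p.1) p.2) = u
  have h3 := continuousOn_iteratedDeriv_influence l
  rw [hu] at h3
  have h4 := h3.comp_continuous h1 h2
  rw [← hu] at h4
  exact h4

/-- Continuity and periodicity in the angle upgrade the bound from almost every angle to every
angle. -/
theorem ae_influence_le {ρ : ℝ → ℝ} (hρ : IsProbDensity zLebesgue ρ) {k : ℕ} {C : ℝ}
    (h : ∀ l ≤ k, influenceNorm ρ l ≤ ENNReal.ofReal C) :
    ∀ᵐ z ∂(randLaw ρ), ∀ l ≤ k, ∀ θ, |iteratedDeriv l (influence θ) z| ≤ |C| := by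
  have : IsProbabilityMeasure (randLaw ρ) := hρ.isProbabilityMeasure
  rw [ae_all_iff]
  intro l
  by_cases hl : l ≤ k
  swap
  · exact Filter.Eventually.of_forall fun z h => absurd h hl
  have h1 : ∀ᵐ x ∂(torus.prod (randLaw ρ)), |iteratedDeriv l (influence x.1) x.2| ≤ |C| :=
    ae_abs_le_of_eLpNorm_top_le (h l hl)
  have h2 := (Measure.measurePreserving_swap (μ := randLaw ρ)
    (ν := torus)).quasiMeasurePreserving.ae h1
  filter_upwards [Measure.ae_ae_of_ae_prod h2, ae_randLaw_gt_one ρ] with z hz hz1 _ θ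
  refine le_of_ae_torus_le (u := fun θ => |iteratedDeriv l (influence θ) z|) ?_ (fun θ => ?_) hz θ
  · exact (continuous_iteratedDeriv_influence l hz1).abs
  · have h3 := iteratedDeriv_influence_periodic l z θ
    simp only at h3 ⊢
    rw [h3]

section

variable {g ρ : ℝ → ℝ}

theorem ae_abs_le_of_lpNorm_top_le (hg : IsProbDensity volume g) (hρ : IsProbDensity zLebesgue ρ)
    {u : ℝ → ℝ → ℝ} (hu : Measurable fun x : ℝ × ℝ => u x.1 x.2) {M : ℝ}
    (h : lpNorm g ρ ⊤ (fun θ ν _ => u θ ν) ≤ ENNReal.ofReal M) :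
    ∀ᵐ ν ∂(freqLaw g), ∀ᵐ θ ∂torus, |u θ ν| ≤ |M| := by
  have : IsProbabilityMeasure (freqLaw g) := hg.isProbabilityMeasure
  have : IsProbabilityMeasure (randLaw ρ) := hρ.isProbabilityMeasure
  have h1 : ∀ᵐ x ∂(torus.prod ((freqLaw g).prod (randLaw ρ))), |u x.1 x.2.1| ≤ |M| :=
    ae_abs_le_of_eLpNorm_top_le h
  have hm : MeasurableSet {x : ℝ × ℝ | |u x.1 x.2| ≤ |M|} :=
    measurableSet_le (continuous_abs.measurable.comp hu) measurable_const
  refine (Measure.ae_ae_comm hm).1 ?_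
  filter_upwards [Measure.ae_ae_of_ae_prod h1] with θ hθ
  filter_upwards [Measure.ae_ae_of_ae_prod hθ] with ν hν
  exact Filter.eventually_const.1 hν

theorem ae_prod_of_ae_ae (hg : IsProbDensity volume g) (hρ : IsProbDensity zLebesgue ρ)
    {P : ℝ × ℝ × ℝ → Prop} (hP : MeasurableSet {x | P x})
    (h : ∀ᵐ x ∂(torus.prod (freqLaw g)), ∀ᵐ z ∂(randLaw ρ), P (x.1, x.2, z)) :
    ∀ᵐ x ∂(torus.prod ((freqLaw g).prod (randLaw ρ))), P x := by
  have : IsProbabilityMeasure (freqLaw g) := hg.isProbabilityMeasure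
  have : IsProbabilityMeasure (randLaw ρ) := hρ.isProbabilityMeasure
  have hP' : MeasurableSet {y : (ℝ × ℝ) × ℝ | P (y.1.1, y.1.2, y.2)} :=
    hP.preimage (by fun_prop : Measurable fun y : (ℝ × ℝ) × ℝ => (y.1.1, y.1.2, y.2))
  have h1 := (Measure.ae_prod_iff_ae_ae (μ := torus.prod (freqLaw g)) (ν := randLaw ρ) hP').2 h
  exact (measurePreserving_prodAssoc torus (freqLaw g)
    (randLaw ρ)).symm.quasiMeasurePreserving.ae h1

/-- The total mass is at most 7, and $7^{1/p}\le7$, which removes the dependence on `p`. -/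
theorem lpNorm_le_of_ae_abs_le (hg : IsProbDensity volume g) (hρ : IsProbDensity zLebesgue ρ)
    {p : ℝ≥0∞} (hp : 1 ≤ p) {h : ℝ → ℝ → ℝ → ℝ} {B : ℝ}
    (hB : ∀ᵐ x ∂(torus.prod ((freqLaw g).prod (randLaw ρ))), |h x.1 x.2.1 x.2.2| ≤ B) :
    lpNorm g ρ p h ≤ ENNReal.ofReal (7 * B) := by
  have : IsProbabilityMeasure (freqLaw g) := hg.isProbabilityMeasure
  have : IsProbabilityMeasure (randLaw ρ) := hρ.isProbabilityMeasure
  refine (eLpNorm_le_of_ae_bound (C := B) hB).trans ?_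
  rw [ENNReal.ofReal_mul (by norm_num)]
  refine mul_le_mul_left ?_ _
  have h7 : torus.prod ((freqLaw g).prod (randLaw ρ)) univ ≤ 7 := by
    rw [← univ_prod_univ, Measure.prod_prod, 
      measure_univ (μ := (freqLaw g).prod (randLaw ρ)), mul_one]
    have := torus_real_univ_le
    rw [Measure.real, ← ENNReal.le_ofReal_iff_toReal_le (measure_ne_top _ _) (by norm_num)] at this
    simpa using this
  rw [ENNReal.ofReal_ofNat]
  refine (ENNReal.rpow_le_rpow h7 (by positivity)).trans ?_
  calc (7 : ℝ≥0∞) ^ p.toReal⁻¹ ≤ 7 ^ (1 : ℝ) := by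
        refine ENNReal.rpow_le_rpow_of_exponent_le (by norm_num) ?_
        rcases eq_or_ne p ⊤ with rfl | hpt
        · simp
        · exact inv_le_one_of_one_le₀ (one_le_toReal hp hpt)
    _ = 7 := ENNReal.rpow_one _

end

theorem sum_rpow_le_rpow_sum {ι : Type*} (s : Finset ι) (a : ι → ℝ≥0∞) {q : ℝ} (hq : 1 ≤ q) :
    ∑ i ∈ s, a i ^ q ≤ (∑ i ∈ s, a i) ^ q := by
  classical
  induction s using Finset.induction_on with
  | empty => simp
  | insert i s hi ih =>
    rw [Finset.sum_insert hi, Finset.sum_insert hi]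
    exact (add_le_add le_rfl ih).trans (ENNReal.add_rpow_le_rpow_add _ _ hq)

theorem sobolevNorm_le_sum (g ρ : ℝ → ℝ) (k : ℕ) {p : ℝ≥0∞} (hp : 1 ≤ p)
    (D : ℕ → ℝ → ℝ → ℝ → ℝ) :
    sobolevNorm g ρ k p D ≤ ∑ l ∈ Finset.range (k + 1), lpNorm g ρ p (D l) := by
  rw [sobolevNorm]
  split_ifs with h
  · rw [h]
    exact Finset.sup_le fun l hl => Finset.single_le_sum
      (f := fun l => lpNorm g ρ ⊤ (D l)) (fun _ _ => zero_le) hl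
  · have hq : 1 ≤ p.toReal := one_le_toReal hp h
    refine (ENNReal.rpow_le_rpow (sum_rpow_le_rpow_sum _ _ hq) (by positivity)).trans ?_
    rw [← ENNReal.rpow_mul, mul_one_div_cancel (by linarith), ENNReal.rpow_one]

/-! ### The `L^p` estimate -/

/-- Of the `q` powers of the Jacobian $E$, one is spent on the change of variables. The other $q-1$
are bounded by the maximum of $E$, which is at least 1 in this bound, so the exponent may be raised
to `q`. -/
theorem IsFlow.lintegral_comp_mul_flowDeriv_le {ν S : ℝ} {σ : ℝ → ℝ} {X : ℝ → ℝ → ℝ → ℝ}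
    (hX : IsFlow ν σ X) (hσ : Continuous σ) (hS : ∀ t, |σ t| ≤ S) (s t : ℝ) {F : ℝ → ℝ}
    (hF : Continuous F) (hp : Function.Periodic F (2 * Real.pi)) {q : ℝ} (hq : 1 ≤ q) :
    ∫⁻ θ, ‖F (X s t θ) * flowDeriv σ X s t θ‖ₑ ^ q ∂torus
      ≤ ENNReal.ofReal (Real.exp (S * |t - s|)) ^ q * ∫⁻ θ, ‖F θ‖ₑ ^ q ∂torus := by
  have hS0 : 0 ≤ S := (abs_nonneg _).trans (hS 0)
  have hq0 : 0 ≤ q := by linarith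
  set e := Real.exp (S * |t - s|) with he
  have he1 : 1 ≤ e := Real.one_le_exp (by positivity)
  have hcE := hX.continuous_flowDeriv hσ hS s t
  have hcX := hX.continuous_left hσ hS s t
  have hcq : Continuous fun x => |F x| ^ q := hF.abs.rpow_const fun _ => Or.inr hq0
  have hcq2 : Continuous fun θ => |F (X s t θ)| ^ q * flowDeriv σ X s t θ :=
    (hcq.comp hcX).mul hcE
  have hint : ∀ Φ : ℝ → ℝ, Continuous Φ → Integrable Φ torus := fun Φ hΦ =>
    hΦ.continuousOn.integrableOn_Icc.mono_set Ioc_subset_Icc_self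
  have henorm : ∀ x : ℝ, ‖x‖ₑ ^ q = ENNReal.ofReal (|x| ^ q) := fun x => by
    rw [Real.enorm_eq_ofReal_abs, ENNReal.ofReal_rpow_of_nonneg (abs_nonneg _) hq0]
  calc ∫⁻ θ, ‖F (X s t θ) * flowDeriv σ X s t θ‖ₑ ^ q ∂torus
      ≤ ∫⁻ θ, ENNReal.ofReal e ^ q
          * ENNReal.ofReal (|F (X s t θ)| ^ q * flowDeriv σ X s t θ) ∂torus := by
        refine lintegral_mono fun θ => ?_
        rw [henorm, ENNReal.ofReal_rpow_of_nonneg (by positivity) hq0,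
          ← ENNReal.ofReal_mul (by positivity)]
        refine ENNReal.ofReal_le_ofReal ?_
        have hE := flowDeriv_pos (σ := σ) (X := X) s t θ
        have hEe := flowDeriv_le (X := X) hS s t θ
        rw [abs_mul, abs_of_pos hE, Real.mul_rpow (abs_nonneg _) hE.le]
        have h1 : flowDeriv σ X s t θ ^ q ≤ e ^ q * flowDeriv σ X s t θ := by
          calc flowDeriv σ X s t θ ^ q
              = flowDeriv σ X s t θ ^ (q - 1) * flowDeriv σ X s t θ := by
                rw [← Real.rpow_add_one hE.ne', sub_add_cancel]
            _ ≤ e ^ (q - 1) * flowDeriv σ X s t θ := by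
                gcongr
            _ ≤ e ^ q * flowDeriv σ X s t θ := by
                gcongr
                linarith
        calc |F (X s t θ)| ^ q * flowDeriv σ X s t θ ^ q
            ≤ |F (X s t θ)| ^ q * (e ^ q * flowDeriv σ X s t θ) := by gcongr
          _ = e ^ q * (|F (X s t θ)| ^ q * flowDeriv σ X s t θ) := by ring
    _ = ENNReal.ofReal e ^ q
          * ∫⁻ θ, ENNReal.ofReal (|F (X s t θ)| ^ q * flowDeriv σ X s t θ) ∂torus :=
        lintegral_const_mul' _ _ (ENNReal.rpow_ne_top_of_nonneg hq0 ENNReal.ofReal_ne_top)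
    _ = ENNReal.ofReal e ^ q * ∫⁻ θ, ‖F θ‖ₑ ^ q ∂torus := by
        congr 1
        rw [← ofReal_integral_eq_lintegral_ofReal (hint _ hcq2)
          (Filter.Eventually.of_forall fun θ => mul_nonneg (by positivity) (flowDeriv_pos _ _ _).le),
          hX.integral_comp_mul_flowDeriv hσ hS s t (Φ := fun x => |F x| ^ q) hcq
          (fun x => by simp only [hp x]),
          ofReal_integral_eq_lintegral_ofReal (hint _ hcq)
          (Filter.Eventually.of_forall fun θ => by positivity)]
        simp only [henorm]

section

variable {g ρ : ℝ → ℝ} {κ C M : ℝ} {k : ℕ} {φ : ℕ → ℝ → ℝ → ℝ} {fin F : ℝ → ℝ → ℝ}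
  {f : ℝ → ℝ → ℝ → ℝ → ℝ}

/-- For almost every parameter, the solution is transported by a flow with bounded field. -/
theorem IsGlobalSolution.ae_exists_flow (hf : IsGlobalSolution κ g fin f)
    (hg : IsProbDensity volume g) (hκ : 0 ≤ κ)
    (hfin : IsInitialDatum g fin) (hr : IsRegularization k M φ F)
    (hFw : ∀ᵐ ν ∂(freqLaw g), ∀ᵐ θ ∂torus, F θ ν = fin θ ν)
    (hI : ∀ᵐ z ∂(randLaw ρ), ∀ θ, |influence θ z| ≤ C) {t : ℝ} (ht : 0 ≤ t) :
    ∀ᵐ z ∂(randLaw ρ), ∀ᵐ ν ∂(freqLaw g), ∃ (σ : ℝ → ℝ) (X : ℝ → ℝ → ℝ → ℝ), Continuous σ ∧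
      (∀ s, |σ s| ≤ κ * C) ∧ IsFlow ν σ X ∧
      ∀ᵐ θ ∂torus, f t θ ν z = F (X t 0 θ) ν * flowDeriv σ X t 0 θ := by
  filter_upwards [(randLaw_absolutelyContinuous ρ).ae_le hf.weak, hI, ae_randLaw_gt_one ρ]
    with z hz hzI hz1
  have hz' : SolvesAt κ g fin f z := hz
  have hσ := hz'.continuous_extendedField hg hfin hf.measurable hκ hz1.le hzI
  have hS := hz'.abs_extendedField_le hg hfin hf.measurable hκ hzI
  choose X hX using fun ν => exists_isFlow (ν := ν) hσ hS
  filter_upwards [hz'.ae_eq_flow hg hfin hf.measurable hκ hz1.le hzI hr.continuous hr.periodic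
    hFw hX] with ν hν
  exact ⟨_, X ν, hσ, hS, hX ν, hν t ht⟩

/-- At each parameter and frequency the solution is the datum composed with a flow, times a Jacobian
of size at most $e^{\kappa Ct}$. For finite `p` one integrates over the angle first; for `p = ⊤` the
bound is pointwise. -/
theorem IsGlobalSolution.lpNorm_le (hf : IsGlobalSolution κ g fin f)
    (hg : IsProbDensity volume g) (hρ : IsProbDensity zLebesgue ρ) (hκ : 0 ≤ κ)
    (hfin : IsInitialDatum g fin) (hr : IsRegularization k M φ F)
    (hFw : ∀ᵐ ν ∂(freqLaw g), ∀ᵐ θ ∂torus, F θ ν = fin θ ν)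
    (hI : ∀ᵐ z ∂(randLaw ρ), ∀ θ, |influence θ z| ≤ C) {t : ℝ} (ht : 0 ≤ t) {p : ℝ≥0∞}
    (hp : 1 ≤ p) :
    lpNorm g ρ p (f t)
      ≤ lpNorm g ρ p (fun θ ν _ => fin θ ν) * ENNReal.ofReal (Real.exp (κ * C * t)) := by
  have : IsProbabilityMeasure (freqLaw g) := hg.isProbabilityMeasure
  have : IsProbabilityMeasure (randLaw ρ) := hρ.isProbabilityMeasure
  have hflow := hf.ae_exists_flow hg hκ hfin hr hFw hI ht
  have htt : |0 - t| = t := by rw [zero_sub, abs_neg, abs_of_nonneg ht]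
  have hfm : Measurable fun x : ℝ × ℝ × ℝ => f t x.1 x.2.1 x.2.2 :=
    hf.measurable.comp (f := fun x : ℝ × ℝ × ℝ => (t, x)) (by fun_prop)
  have hfinm : Measurable fun x : ℝ × ℝ × ℝ => fin x.1 x.2.1 :=
    hfin.measurable.comp (f := fun x : ℝ × ℝ × ℝ => (x.1, x.2.1)) (by fun_prop)
  rcases eq_or_ne p ⊤ with rfl | hpt
  · set N := lpNorm g ρ ⊤ (fun θ ν _ => fin θ ν) with hN
    rcases eq_or_ne N ⊤ with hNt | hNt
    · rw [hNt, ENNReal.top_mul (ENNReal.ofReal_pos.2 (Real.exp_pos _)).ne']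
      exact le_top
    have hNb : ∀ᵐ ν ∂(freqLaw g), ∀ᵐ θ ∂torus, |fin θ ν| ≤ |N.toReal| :=
      ae_abs_le_of_lpNorm_top_le hg hρ hfin.measurable (by rw [ENNReal.ofReal_toReal hNt])
    rw [abs_of_nonneg ENNReal.toReal_nonneg] at hNb
    have hbound : ∀ᵐ x ∂(torus.prod ((freqLaw g).prod (randLaw ρ))),
        |f t x.1 x.2.1 x.2.2| ≤ N.toReal * Real.exp (κ * C * t) := by
      have hmeas : MeasurableSet {x : ℝ × ℝ × ℝ | |f t x.1 x.2.1 x.2.2|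
          ≤ N.toReal * Real.exp (κ * C * t)} :=
        measurableSet_le (continuous_abs.measurable.comp hfm) measurable_const
      refine ae_prod_of_ae_ae hg hρ hmeas ?_
      have hmeas2 : MeasurableSet {y : (ℝ × ℝ) × ℝ | |f t y.1.1 y.1.2 y.2|
          ≤ N.toReal * Real.exp (κ * C * t)} :=
        hmeas.preimage (by fun_prop : Measurable fun y : (ℝ × ℝ) × ℝ => (y.1.1, y.1.2, y.2))
      refine (Measure.ae_ae_comm (p := fun (x : ℝ × ℝ) (z : ℝ) => |f t x.1 x.2 z|
          ≤ N.toReal * Real.exp (κ * C * t)) hmeas2).2 ?_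
      filter_upwards [hflow] with z hz
      have hmeas3 : MeasurableSet {x : ℝ × ℝ | |f t x.1 x.2 z|
          ≤ N.toReal * Real.exp (κ * C * t)} :=
        hmeas2.preimage (by fun_prop : Measurable fun x : ℝ × ℝ => (x, z))
      rw [Measure.ae_prod_iff_ae_ae hmeas3]
      refine (Measure.ae_ae_comm (p := fun θ ν : ℝ => |f t θ ν z|
          ≤ N.toReal * Real.exp (κ * C * t)) hmeas3).2 ?_
      filter_upwards [hz, hNb, hFw] with ν ⟨σ, X, hσ, hS, hX, hfX⟩ hνN hνF
      have hFN : ∀ y, |F y ν| ≤ N.toReal :=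
        le_of_ae_torus_le (u := fun y => |F y ν|) (hr.continuous ν).abs
          (fun y => by
            have := hr.periodic ν y
            simp only at this
            simp only [this])
          (by filter_upwards [hνN, hνF] with θ h1 h2; rwa [h2])
      filter_upwards [hfX] with θ hθ
      rw [hθ, abs_mul, abs_of_pos (flowDeriv_pos _ _ _)]
      have h1 := flowDeriv_le (X := X) hS t 0 θ
      rw [htt] at h1
      exact mul_le_mul (hFN _) h1 (flowDeriv_pos _ _ _).le ENNReal.toReal_nonneg
    rw [lpNorm, eLpNorm_exponent_top]
    refine (eLpNormEssSup_le_of_ae_bound hbound).trans (le_of_eq ?_)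
    rw [ENNReal.ofReal_mul ENNReal.toReal_nonneg, ENNReal.ofReal_toReal hNt]
  · set q := p.toReal with hq
    have hq1 : 1 ≤ q := one_le_toReal hp hpt
    have hq0 : 0 ≤ q := by linarith
    have hqpos : 0 < q := by linarith
    have hp0 : p ≠ 0 := (lt_of_lt_of_le one_pos hp).ne'
    set e := ENNReal.ofReal (Real.exp (κ * C * t)) with he
    have hm1 : Measurable fun x : ℝ × ℝ × ℝ => ‖f t x.1 x.2.1 x.2.2‖ₑ ^ q :=
      hfm.enorm.pow_const q
    have hm2 : Measurable fun x : ℝ × ℝ × ℝ => ‖fin x.1 x.2.1‖ₑ ^ q := hfinm.enorm.pow_const q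
    have hle : ∀ᵐ y ∂((freqLaw g).prod (randLaw ρ)), ∫⁻ θ, ‖f t θ y.1 y.2‖ₑ ^ q ∂torus
        ≤ e ^ q * ∫⁻ θ, ‖fin θ y.1‖ₑ ^ q ∂torus := by
      have hmeas : MeasurableSet {y : ℝ × ℝ | ∫⁻ θ, ‖f t θ y.1 y.2‖ₑ ^ q ∂torus
          ≤ e ^ q * ∫⁻ θ, ‖fin θ y.1‖ₑ ^ q ∂torus} :=
        measurableSet_le hm1.lintegral_prod_left' (hm2.lintegral_prod_left'.const_mul _)
      rw [Measure.ae_prod_iff_ae_ae hmeas]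
      refine (Measure.ae_ae_comm (p := fun ν z : ℝ => ∫⁻ θ, ‖f t θ ν z‖ₑ ^ q ∂torus
          ≤ e ^ q * ∫⁻ θ, ‖fin θ ν‖ₑ ^ q ∂torus) hmeas).2 ?_
      filter_upwards [hflow] with z hz
      filter_upwards [hz, hFw] with ν ⟨σ, X, hσ, hS, hX, hfX⟩ hνF
      have h1 := hX.lintegral_comp_mul_flowDeriv_le hσ hS t 0 (hr.continuous ν) (hr.periodic ν) hq1
      rw [htt] at h1
      calc ∫⁻ θ, ‖f t θ ν z‖ₑ ^ q ∂torus
          = ∫⁻ θ, ‖F (X t 0 θ) ν * flowDeriv σ X t 0 θ‖ₑ ^ q ∂torus :=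
            lintegral_congr_ae (by filter_upwards [hfX] with θ hθ; rw [hθ])
        _ ≤ e ^ q * ∫⁻ θ, ‖F θ ν‖ₑ ^ q ∂torus := h1
        _ = e ^ q * ∫⁻ θ, ‖fin θ ν‖ₑ ^ q ∂torus := by
            congr 1
            exact lintegral_congr_ae (by filter_upwards [hνF] with θ hθ; rw [hθ])
    have hI : ∫⁻ x, ‖f t x.1 x.2.1 x.2.2‖ₑ ^ q ∂(torus.prod ((freqLaw g).prod (randLaw ρ)))
        ≤ e ^ q * ∫⁻ x, ‖fin x.1 x.2.1‖ₑ ^ q ∂(torus.prod ((freqLaw g).prod (randLaw ρ))) := by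
      rw [lintegral_prod_symm _ hm1.aemeasurable, lintegral_prod_symm _ hm2.aemeasurable,
        ← lintegral_const_mul _ hm2.lintegral_prod_left']
      exact lintegral_mono_ae hle
    rw [lpNorm, lpNorm, eLpNorm_eq_lintegral_rpow_enorm_toReal hp0 hpt,
      eLpNorm_eq_lintegral_rpow_enorm_toReal hp0 hpt]
    refine (ENNReal.rpow_le_rpow hI (by positivity)).trans (le_of_eq ?_)
    rw [ENNReal.mul_rpow_of_nonneg _ _ (by positivity), ← ENNReal.rpow_mul,
      mul_one_div_cancel hqpos.ne', ENNReal.rpow_one, mul_comm]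

end

/-! ### The weak `z`-derivatives and their bounds -/

/-- The candidate for the `l`-th weak `z`-derivative of `h`: the iterated quotient for `l ≥ 1`. -/
noncomputable def zDeriv (h : ℝ → ℝ → ℝ → ℝ) (l : ℕ) (θ ν z : ℝ) : ℝ :=
  if l = 0 then h θ ν z else iteratedQuotient (h θ ν) l z

theorem measurable_zDeriv {h : ℝ → ℝ → ℝ → ℝ}
    (hh : Measurable fun x : ℝ × ℝ × ℝ => h x.1 x.2.1 x.2.2) (l : ℕ) :
    Measurable fun x : ℝ × ℝ × ℝ => zDeriv h l x.1 x.2.1 x.2.2 := by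
  unfold zDeriv
  split_ifs
  · exact hh
  · have h1 : Measurable (Function.uncurry fun x : ℝ × ℝ => h x.1 x.2) :=
      hh.comp (f := fun y : (ℝ × ℝ) × ℝ => (y.1.1, y.1.2, y.2)) (by fun_prop)
    exact (measurable_iteratedQuotient h1 l).comp
      (f := fun x : ℝ × ℝ × ℝ => ((x.1, x.2.1), x.2.2)) (by fun_prop)

section

variable {g ρ : ℝ → ℝ} {κ C M T : ℝ} {k : ℕ} {φ : ℕ → ℝ → ℝ → ℝ} {fin F : ℝ → ℝ → ℝ}
  {f : ℝ → ℝ → ℝ → ℝ → ℝ}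

theorem exists_regularization_of_lpNorm_le (hk : 1 ≤ k) (hg : IsProbDensity volume g)
    (hρ : IsProbDensity zLebesgue ρ) (hfin : IsInitialDatum g fin)
    (h : ∀ j ≤ k, ∃ u : ℝ → ℝ → ℝ, IsWeakThetaDeriv g j fin u ∧
      lpNorm g ρ ⊤ (fun θ ν _ => u θ ν) ≤ ENNReal.ofReal M) :
    ∃ φ F, IsRegularization k |M| φ F ∧ ∀ᵐ ν ∂(freqLaw g), ∀ᵐ θ ∂torus, F θ ν = fin θ ν := by
  refine exists_regularization hk (abs_nonneg M) hfin.measurable fun j hj => ?_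
  obtain ⟨u, hu, hn⟩ := h j hj
  exact ⟨u, hu, ae_abs_le_of_lpNorm_top_le hg hρ hu.measurable hn⟩

/-- On each compact part of $(1,\infty)$ the influence function is bounded by continuity, so no
information from $\rho$ is needed. The constants deteriorate along the exhaustion, which does no
harm here. -/
theorem IsGlobalSolution.isWeakZDeriv (hf : IsGlobalSolution κ g fin f) (hk : 1 ≤ k)
    (hg : IsProbDensity volume g) (hκ : 0 ≤ κ)
    (hfin : IsInitialDatum g fin) (hr : IsRegularization k M φ F)
    (hFw : ∀ᵐ ν ∂(freqLaw g), ∀ᵐ θ ∂torus, F θ ν = fin θ ν) {t : ℝ} (ht : 0 ≤ t)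
    {l : ℕ} (hl : l ≤ k) : IsWeakZDeriv g l (f t) (zDeriv (f t) l) := by
  have hfm : Measurable fun x : ℝ × ℝ × ℝ => f t x.1 x.2.1 x.2.2 :=
    hf.measurable.comp (f := fun x : ℝ × ℝ × ℝ => (t, x)) (by fun_prop)
  refine ⟨measurable_zDeriv hfm l, ?_⟩
  have hq : ∀ᵐ x ∂(torus.prod (freqLaw g)), ∀ m : ℕ, ∃ K, 0 ≤ K ∧
      HasQuotients k K (1 + 1 / ((m : ℝ) + 2)) ((m : ℝ) + 3) (f t x.1 x.2) := by
    refine ae_all_iff.2 fun m => ?_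
    have ha : (1 : ℝ) < 1 + 1 / ((m : ℝ) + 2) := lt_add_of_pos_right _ (by positivity)
    obtain ⟨C, -, hC⟩ := exists_influence_bound k (b := (m : ℝ) + 3) ha
    obtain ⟨K, hK, hb⟩ := exists_quotient_bound hk ht hκ C M
    filter_upwards [hb g φ fin F f hg hfin hr hFw hf _ _ ha
      (fun l hl θ z hz => hC l hl θ z (Ioo_subset_Icc_self hz)) t ⟨ht, le_rfl⟩] with x hx
    exact ⟨_, mul_nonneg hK ht, hx⟩
  filter_upwards [hq] with x hx
  have hm : Measurable (f t x.1 x.2) :=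
    hfm.comp (f := fun z : ℝ => (x.1, x.2, z)) (by fun_prop)
  obtain ⟨h1, h2, h3⟩ := weak_of_hasQuotients hk hm hx hl
  rcases Nat.eq_zero_or_pos l with rfl | hl0
  · have h0 : zDeriv (f t) 0 x.1 x.2 = f t x.1 x.2 := funext fun z => if_pos rfl
    rw [h0]
    exact ⟨h1, h1, fun φ _ _ _ => by simp⟩
  · have h0 : zDeriv (f t) l x.1 x.2 = iteratedQuotient (f t x.1 x.2) l :=
      funext fun z => if_neg hl0.ne'
    rw [h0]
    exact ⟨h1, h2, h3⟩

/-- A uniform local bound on difference quotients bounds the weak derivatives. -/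
theorem ae_abs_zDeriv_le (hg : IsProbDensity volume g) (hρ : IsProbDensity zLebesgue ρ)
    {h : ℝ → ℝ → ℝ → ℝ} (hh : Measurable fun x : ℝ × ℝ × ℝ => h x.1 x.2.1 x.2.2)
    (hC : ∀ l ≤ k, influenceNorm ρ l ≤ ENNReal.ofReal C) {K : ℝ}
    (H : ∀ a b : ℝ, 1 < a →
      (∀ l ≤ k, ∀ θ, ∀ z ∈ Ioo a b, |iteratedDeriv l (influence θ) z| ≤ |C| + 1) →
      ∀ᵐ x ∂(torus.prod (freqLaw g)), HasQuotients k K a b (h x.1 x.2))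
    {l : ℕ} (h1 : 1 ≤ l) (hl : l ≤ k) :
    ∀ᵐ x ∂(torus.prod ((freqLaw g).prod (randLaw ρ))), |zDeriv h l x.1 x.2.1 x.2.2| ≤ K := by
  refine ae_prod_of_ae_ae (P := fun x : ℝ × ℝ × ℝ => |zDeriv h l x.1 x.2.1 x.2.2| ≤ K) hg hρ
    (measurableSet_le (continuous_abs.measurable.comp (measurable_zDeriv hh l))
      measurable_const) ?_
  -- Rational endpoints leave countably many intervals, so a single null set of `(θ, ν)` works for
  -- all of them.
  have hrat : ∀ᵐ x ∂(torus.prod (freqLaw g)), ∀ r : ℚ × ℚ, 1 < (r.1 : ℝ) →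
      (∀ l ≤ k, ∀ θ, ∀ z ∈ Ioo (r.1 : ℝ) r.2, |iteratedDeriv l (influence θ) z| ≤ |C| + 1) →
      HasQuotients k K r.1 r.2 (h x.1 x.2) := by
    refine ae_all_iff.2 fun r => ?_
    by_cases hr1 : 1 < (r.1 : ℝ)
    · by_cases hr2 : ∀ l ≤ k, ∀ θ, ∀ z ∈ Ioo (r.1 : ℝ) r.2,
          |iteratedDeriv l (influence θ) z| ≤ |C| + 1
      · filter_upwards [H _ _ hr1 hr2] with x hx _ _ using hx
      · exact Filter.Eventually.of_forall fun x _ h => absurd h hr2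
    · exact Filter.Eventually.of_forall fun x h => absurd h hr1
  filter_upwards [hrat] with x hx
  have hz : ∀ᵐ z ∂(randLaw ρ), ∀ r : ℚ × ℚ, 1 < (r.1 : ℝ) →
      (∀ l ≤ k, ∀ θ, ∀ z ∈ Ioo (r.1 : ℝ) r.2, |iteratedDeriv l (influence θ) z| ≤ |C| + 1) →
      z ∈ Ioo (r.1 : ℝ) r.2 → |iteratedQuotient (h x.1 x.2) l z| ≤ K := by
    refine ae_all_iff.2 fun r => ?_
    by_cases hr : HasQuotients k K r.1 r.2 (h x.1 x.2)
    · have h2 := (ae_restrict_iff' measurableSet_Ioo).1 (hr.ae_abs_le h1 hl)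
      have h3 : randLaw ρ ≪ volume :=
        (randLaw_absolutelyContinuous ρ).trans Measure.restrict_le_self.absolutelyContinuous
      filter_upwards [h3.ae_le h2] with z hz _ _ hzr using hz hzr
    · exact Filter.Eventually.of_forall fun z h2 h3 => absurd (hx r h2 h3) hr
  filter_upwards [hz, ae_influence_le hρ hC, ae_randLaw_gt_one ρ] with z hz hzC hz1
  -- Around almost every `z` the bound holds up to 1 on an interval, which contains a rational one
  -- through `z`.
  obtain ⟨a, b, ha, haz, hzb, hab⟩ := exists_influence_bound_nhds k hz1 hzC
  obtain ⟨r, har, hrz⟩ := exists_rat_btwn haz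
  obtain ⟨s, hzs, hsb⟩ := exists_rat_btwn hzb
  have h4 := hz (r, s) (ha.trans har)
    (fun l hl θ y hy => hab l hl θ y ⟨har.trans hy.1, hy.2.trans hsb⟩) ⟨hrz, hzs⟩
  simpa only [zDeriv, if_neg (show l ≠ 0 by omega)] using h4

end

end Winfree

open Winfree in
theorem theorem5p1 (k : ℕ) (hk : 1 ≤ k) (T : ℝ) (hT : 0 < T) (κ : ℝ) (hκ : 0 ≤ κ) (C M : ℝ) :
    ∃ Λ₁ Λ₂ : ℝ, 0 < Λ₁ ∧ 0 ≤ Λ₂ ∧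
      ∀ (g ρ : ℝ → ℝ) (fin : ℝ → ℝ → ℝ) (f : ℝ → ℝ → ℝ → ℝ → ℝ),
        Winfree.IsProbDensity MeasureTheory.volume g →
        Winfree.IsProbDensity Winfree.zLebesgue ρ →
        (∀ l ≤ k, Winfree.influenceNorm ρ l ≤ ENNReal.ofReal C) →
        Winfree.IsInitialDatum g fin →
        (∀ j ≤ k, ∃ u : ℝ → ℝ → ℝ, Winfree.IsWeakThetaDeriv g j fin u ∧
          Winfree.lpNorm g ρ ⊤ (fun θ ν _ => u θ ν) ≤ ENNReal.ofReal M) →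
        Winfree.IsGlobalSolution κ g fin f →
        ∀ t ∈ Set.Icc 0 T, ∃ D : ℕ → ℝ → ℝ → ℝ → ℝ,
          (∀ l ≤ k, Winfree.IsWeakZDeriv g l (f t) (D l)) ∧
          ∀ p : ENNReal, 1 < p →
            Winfree.sobolevNorm g ρ k p D
              ≤ Winfree.lpNorm g ρ p (fun θ ν _ => fin θ ν) * ENNReal.ofReal (Real.exp (Λ₁ * t))
                + ENNReal.ofReal (Λ₂ / Λ₁ * (Real.exp (Λ₁ * t) - 1)) := by
  -- The bound `|C| + 1` leaves the room that passing from almost every `z` to intervals requires.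
  obtain ⟨K, hK, hb⟩ := exists_quotient_bound hk hT.le hκ (|C| + 1) |M|
  have hΛ : 0 < κ * |C| + 1 := by positivity
  -- Adding 1 to `κ * |C|` makes the rate positive even without coupling. The second constant sums
  -- `k` derivatives, each with the mass factor 7.
  refine ⟨κ * |C| + 1, k * (7 * K), hΛ, by positivity, ?_⟩
  intro g ρ fin f hg hρ hC hfin hder hf t ht
  obtain ⟨φ, F, hr, hFw⟩ := exists_regularization_of_lpNorm_le hk hg hρ hfin hder
  refine ⟨zDeriv (f t), fun l hl => hf.isWeakZDeriv hk hg hκ hfin hr hFw ht.1 hl,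
    fun p hp => ?_⟩
  have hfm : Measurable fun x : ℝ × ℝ × ℝ => f t x.1 x.2.1 x.2.2 :=
    hf.measurable.comp (f := fun x : ℝ × ℝ × ℝ => (t, x)) (by fun_prop)
  have hzero : lpNorm g ρ p (zDeriv (f t) 0)
      ≤ lpNorm g ρ p (fun θ ν _ => fin θ ν) * ENNReal.ofReal (Real.exp (κ * |C| * t)) := by
    have h0 : zDeriv (f t) 0 = f t := by
      funext θ ν z
      exact if_pos rfl
    rw [h0]
    refine hf.lpNorm_le hg hρ hκ hfin hr hFw ?_ ht.1 hp.le
    filter_upwards [ae_influence_le hρ hC] with z hz θ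
    simpa only [iteratedDeriv_zero] using hz 0 (Nat.zero_le k) θ
  have hsucc : ∀ l ∈ Finset.range k,
      lpNorm g ρ p (zDeriv (f t) (l + 1)) ≤ ENNReal.ofReal (7 * (K * t)) := fun l hl =>
    lpNorm_le_of_ae_abs_le hg hρ hp.le
      (ae_abs_zDeriv_le hg hρ hfm hC
        (fun a b ha hab => hb g φ fin F f hg hfin hr hFw hf a b ha hab t ht)
        (Nat.le_add_left 1 l) (Finset.mem_range.1 hl))
  refine (sobolevNorm_le_sum g ρ k hp.le _).trans ?_
  rw [Finset.sum_range_succ', add_comm]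
  refine add_le_add (hzero.trans ?_) ((Finset.sum_le_card_nsmul _ _ _ hsucc).trans ?_)
  · refine mul_le_mul_right (ENNReal.ofReal_le_ofReal (Real.exp_le_exp.2 ?_)) _
    nlinarith [ht.1]
  · rw [Finset.card_range, nsmul_eq_mul, ← ENNReal.ofReal_natCast,
      ← ENNReal.ofReal_mul (by positivity)]
    refine ENNReal.ofReal_le_ofReal ?_
    -- Linear growth in `t` is put into exponential form by $1+x\le e^x$.
    have h1 : t ≤ (Real.exp ((κ * |C| + 1) * t) - 1) / (κ * |C| + 1) := by
      rw [le_div_iff₀ hΛ]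
      linarith [Real.add_one_le_exp ((κ * |C| + 1) * t)]
    calc (k : ℝ) * (7 * (K * t)) = k * (7 * K) * t := by ring
      _ ≤ k * (7 * K) * ((Real.exp ((κ * |C| + 1) * t) - 1) / (κ * |C| + 1)) := by gcongr
      _ = k * (7 * K) / (κ * |C| + 1) * (Real.exp ((κ * |C| + 1) * t) - 1) := by ring
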